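/- Let $Z\subset\mathbb{C}$ be a two-dimensional lattice (a discrete additive subgroup spanning $\mathbb{C}$ over $\mathbb{R}$) and let $R=(R_n)_{n\ge 0}$ be a random walk on $Z$: $R_0=0$, the increments $R_{n+1}-R_n$ are independent and identically distributed with values in $Z$, and for every $z\in Z$ there is an $n$ with $\mathbb{P}(R_n=z)>0$. Assume that $R$ is spherical, i.e. its step $X=R_1-R_0$ is bounded, $\mathbb{E}X=0$, and $\mathbb{E}[(\operatorname{Re}X)^2]=\mathbb{E}[(\operatorname{Im}X)^2]$, $\mathbb{E}[\operatorname{Re}X\,\operatorname{Im}X]=0$. With $P_n(z)=\mathbb{P}(R_n=z)$, let $$a(z)=\sum_{n=0}^\infty \bigl(P_n(0)-P_n(z)\bigr),\qquad z\in Z,$$ be the harmonic potential; this series converges as a limit of partial sums. For an integer $K\ge1$, real numbers $\alpha,\lambda$ and complex numbers $\alpha_{lk}$ ($l,k\ge0$ integers, $\alpha_{0k}$ real), say that $a$ has the expansion of order $K$ with these coefficients if only finitely many $\alpha_{lk}$ with $-1\ge l-k\ge-K$ are nonzero and, for $z\in Z\setminus\{0\}$, $$a(z)=\alpha\log|z|+\lambda+\operatorname{Re}\Bigl(\sum_{-1\ge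 l-k\ge -K}\alpha_{lk}\frac{z^l}{|z|^k}\Bigr)+O(|z|^{-K}).$$ (i) There are $\alpha,\lambda\in\mathbb{R}$ and coefficients $\alpha_{lk}$, all independent of $K$, with which $a$ has the expansion of every order $K\ge1$, and $\alpha_{lk}=0$ whenever $l<\frac12k$. (ii) In any expansion of $a$ of any order $K\ge 1$, $\alpha_{lk}=0$ for all $l,k$ with $l<\frac12k$ and $l-k>-K$ (the terms with $l-k=-K$ are themselves $O(|z|^{-K})$, so their coefficients are not determined by the expansion). -/

import Mathlib

open MeasureTheory ProbabilityTheory Filter Topology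

noncomputable section

/-- `R` is a random walk on the lattice `L`: it starts at `0`, its increments are independent and
identically distributed, and it visits every point of `L` with positive probability. -/
structure IsLatticeWalk {Ω : Type*} [MeasurableSpace Ω] (μ : Measure Ω)
    (L : Submodule ℤ ℂ) (R : ℕ → Ω → L) : Prop where
  measurable : ∀ n, Measurable (R n)
  start : ∀ᵐ ω ∂μ, R 0 ω = 0
  indep : iIndepFun (fun (n : ℕ) (ω : Ω) => R (n + 1) ω - R n ω) μ
  identDistrib : ∀ n : ℕ,
    IdentDistrib (fun ω => R (n + 1) ω - R n ω) (fun ω => R 1 ω - R 0 ω) μ μ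
  irreducible : ∀ z : L, ∃ n, 0 < μ {ω | R n ω = z}

/-- The first step of the walk, as a complex random variable. -/
def walkStep {Ω : Type*} {L : Submodule ℤ ℂ} (R : ℕ → Ω → L) (ω : Ω) : ℂ :=
  ((R 1 ω - R 0 ω : L) : ℂ)

/-- The walk is spherical: its step is bounded, has mean zero, and its correlation matrix in the
real coordinates `(re, im)` is a scalar multiple of the identity. -/
structure IsSpherical {Ω : Type*} [MeasurableSpace Ω] (μ : Measure Ω)
    {L : Submodule ℤ ℂ} (R : ℕ → Ω → L) : Prop where
  bounded : ∃ B : ℝ, ∀ᵐ ω ∂μ, ‖walkStep R ω‖ ≤ B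
  balanced : ∫ ω, walkStep R ω ∂μ = 0
  correlation : ∃ C : ℝ,
    ∫ ω, (walkStep R ω).re * (walkStep R ω).re ∂μ = C ∧
    ∫ ω, (walkStep R ω).im * (walkStep R ω).im ∂μ = C ∧
    ∫ ω, (walkStep R ω).re * (walkStep R ω).im ∂μ = 0

/-- `P_n(z)`, the probability that the walk is at `z` at time `n`. -/
def walkProb {Ω : Type*} [MeasurableSpace Ω] (μ : Measure Ω)
    {L : Submodule ℤ ℂ} (R : ℕ → Ω → L) (n : ℕ) (z : L) : ℝ :=
  μ.real {ω | R n ω = z}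

/-- `a` is the harmonic potential: `a(z) = ∑_{n ≥ 0} (P_n(0) - P_n(z))`, the series converging
in the ordered sense (for periodic walks it does not converge absolutely). -/
def IsHarmonicPotential {Ω : Type*} [MeasurableSpace Ω] (μ : Measure Ω)
    {L : Submodule ℤ ℂ} (R : ℕ → Ω → L) (a : L → ℝ) : Prop :=
  ∀ z : L, Tendsto (fun N : ℕ => ∑ n ∈ Finset.range N, (walkProb μ R n 0 - walkProb μ R n z))
    atTop (𝓝 (a z))

/-- The pairs `(l, k)` with `-1 ≥ l - k ≥ -K` and a nonzero coefficient. -/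
def expansionIndex (K : ℕ) (c : ℕ → ℕ → ℂ) : Set (ℕ × ℕ) :=
  {p | p.1 + 1 ≤ p.2 ∧ p.2 ≤ p.1 + K ∧ c p.1 p.2 ≠ 0}

/-- The expansion of order `K`: for nonzero `z` in the lattice,
`a(z) = α log|z| + lam + Re (∑ c_{lk} z^l / |z|^k) + O(|z|^{-K})`, a finite sum over
`-1 ≥ l - k ≥ -K`. The coefficients `c_{0k}`, of which only the real part matters,
are taken real. -/
structure IsExpansion {L : Submodule ℤ ℂ} (a : L → ℝ) (K : ℕ) (α lam : ℝ)
    (c : ℕ → ℕ → ℂ) : Prop where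
  real_zero : ∀ k, (c 0 k).im = 0
  finite : (expansionIndex K c).Finite
  bound : ∃ C : ℝ, ∀ z : L, z ≠ 0 →
    |a z - (α * Real.log ‖(z : ℂ)‖ + lam +
      (∑ p ∈ finite.toFinset, c p.1 p.2 * ((z : ℂ) ^ p.1 / (‖(z : ℂ)‖ : ℂ) ^ p.2)).re)|
      ≤ C / ‖(z : ℂ)‖ ^ K

end

/-!
The point probabilities of the walk are recovered from the powers of the characteristic function
`φ` of its step by integrating against a smooth, compactly supported weight `w` on the frequency
plane, whose Fourier transform restricts to a point mass on the lattice (`exists_dual_window`).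
Summing the geometric series gives
`a(z) = Re ∫ w(ξ) (1 - exp (-2πi ⟨ξ, z⟩)) / (1 - φ(ξ)) dξ`
(`IsLatticeWalk.exists_harmonicPotential`), an integral over the whole plane which is singular only
at the origin: irreducibility puts the other zeros of `1 - φ` on the dual lattice, off the support
of `w`. With such a weight no boundary terms of a fundamental domain occur, so the asymptotics of
`a` come from the Taylor expansion of `1 / (1 - φ)` at the origin
(`exists_potential_expansion`).

Sphericity makes `1 - φ` start with a multiple of `‖ξ‖²`. Hence `1 / (1 - φ)` expands into terms
`F_m` which are homogeneous of degree `m - 2` and are sums of monomials `ξ^p conj(ξ)^q`, with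
`p + q = m - 2` and `p`, `q` possibly negative. For `m = 0` the term `‖ξ‖⁻²` yields the logarithm
and the constant (`exists_logPotential_sub`). For `m ≥ 1` the transform of a cut-off monomial is a
multiple of the dual monomial `z^(-1-q) conj(z)^(-1-p)` up to rapid decay, because a dilation or
rotation only changes the cutoff (`exists_planeFT_homMonomial_sub`). The dual monomial has order `m`
and angular frequency `|p - q|`. If `p, q ≥ 0`, the monomial is a polynomial and its contribution
decays rapidly; otherwise `|p - q| ≥ m`. So only terms `z^l / ‖z‖^k` with `k - l = m` and `l ≥ m`
survive, which is the condition `2 * l ≥ k` (`hasAngularExpansion_homMonomial`).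

The error after the terms of order at most `K` is the transform of a cut-off Taylor remainder. The
remainder is not exactly homogeneous, but it belongs to a family in an additional parameter `t`
which is homogeneous jointly in `t` and `ξ` and smooth down to `t = 0`. Its dyadic pieces, rescaled
to unit size, therefore have uniformly decaying transforms, and summing them gives `O(‖z‖^(-K))`
(`IsSymbolTower.exists_pow_mul_norm_planeFT_recipRem_le`).

The statement about arbitrary expansions follows by uniqueness of the coefficients below the top
order (`IsExpansion.coeff_eq`): along the multiples of a lattice point the orders separate, and a
trigonometric polynomial of nonnegative frequencies with real constant term is determined by its
real part in infinitely many directions.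
-/

section FourierAnalysis

open scoped ContDiff ComplexConjugate FourierTransform

/-! ### Fourier transforms of smooth compactly supported functions -/

/-- The character `ξ ↦ exp (2πi ⟨ξ, z⟩)` of the plane. -/
noncomputable def planeChar (z ξ : ℂ) : ℂ :=
  Complex.exp (2 * Real.pi * Complex.I * (inner ℝ ξ z : ℝ))

/-- The Fourier transform of the plane, `z ↦ ∫ exp (-2πi ⟨ξ, z⟩) f(ξ) dξ`. -/
noncomputable def planeFT (f : ℂ → ℂ) (z : ℂ) : ℂ := ∫ ξ, planeChar (-z) ξ * f ξ

lemma norm_planeChar (z ξ : ℂ) : ‖planeChar z ξ‖ = 1 := by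
  rw [planeChar, Complex.norm_exp]; simp

lemma planeChar_zero_left (ξ : ℂ) : planeChar 0 ξ = 1 := by simp [planeChar]

lemma planeChar_add (z w ξ : ℂ) : planeChar (z + w) ξ = planeChar z ξ * planeChar w ξ := by
  simp only [planeChar, inner_add_right, ← Complex.exp_add]; push_cast; ring_nf

lemma planeChar_mul_right (z w ξ : ℂ) : planeChar z (w * ξ) = planeChar (conj w * z) ξ := by
  simp only [planeChar, Complex.inner]
  congr 4
  simp; ring

lemma contDiff_planeChar_uncurry : ContDiff ℝ ∞ (fun p : ℂ × ℂ => planeChar p.1 p.2) := by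
  unfold planeChar
  refine Complex.contDiff_exp.comp (contDiff_const.mul ?_)
  exact Complex.ofRealCLM.contDiff.comp (contDiff_snd.inner ℝ contDiff_fst)

lemma continuous_planeChar (z : ℂ) : Continuous (planeChar z) :=
  contDiff_planeChar_uncurry.continuous.comp (by fun_prop : Continuous fun ξ : ℂ => (z, ξ))

lemma norm_one_sub_planeChar_le (z ξ : ℂ) :
    ‖1 - planeChar z ξ‖ ≤ 2 * Real.pi * (‖ξ‖ * ‖z‖) := by
  have h := Real.norm_exp_I_mul_ofReal_sub_one_le (x := 2 * Real.pi * inner ℝ ξ z)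
  rw [norm_sub_rev, planeChar]
  have e : 2 * (Real.pi : ℂ) * Complex.I * ((inner ℝ ξ z : ℝ) : ℂ)
    = Complex.I * ((2 * Real.pi * inner ℝ ξ z : ℝ) : ℂ) := by push_cast; ring
  rw [e]
  refine h.trans ?_
  rw [norm_mul, Real.norm_of_nonneg (by positivity)]
  gcongr
  exact norm_inner_le_norm ξ z

lemma integrable_planeChar_mul {f : ℂ → ℂ} (hf : Integrable f) (z : ℂ) :
    Integrable fun ξ => planeChar z ξ * f ξ :=
  hf.bdd_mul (c := 1) (continuous_planeChar z).aestronglyMeasurable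
    (Eventually.of_forall fun ξ => (norm_planeChar z ξ).le)

lemma planeFT_eq_fourier (f : ℂ → ℂ) (z : ℂ) : planeFT f z = 𝓕 f z := by
  rw [Real.fourier_eq', planeFT]
  congr 1; ext ξ
  rw [planeChar, smul_eq_mul]; congr 2
  simp only [inner_neg_right]; push_cast; ring

lemma planeFT_add {f g : ℂ → ℂ} (hf : Integrable f) (hg : Integrable g) (z : ℂ) :
    planeFT (fun ξ => f ξ + g ξ) z = planeFT f z + planeFT g z := by
  simp only [planeFT, mul_add]
  exact integral_add (integrable_planeChar_mul hf _) (integrable_planeChar_mul hg _)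

lemma planeFT_sub {f g : ℂ → ℂ} (hf : Integrable f) (hg : Integrable g) (z : ℂ) :
    planeFT (fun ξ => f ξ - g ξ) z = planeFT f z - planeFT g z := by
  simp only [planeFT, mul_sub]
  exact integral_sub (integrable_planeChar_mul hf _) (integrable_planeChar_mul hg _)

lemma planeFT_const_mul (c : ℂ) (f : ℂ → ℂ) (z : ℂ) :
    planeFT (fun ξ => c * f ξ) z = c * planeFT f z := by
  simp only [planeFT, ← integral_const_mul]
  congr 1; ext ξ; ring

/-- Substituting `ξ ↦ w ξ` in a plane integral. -/
lemma integral_comp_complex_mul {w : ℂ} (hw : w ≠ 0) (f : ℂ → ℂ) :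
    ∫ ξ, f ξ = (‖w‖ : ℂ) ^ 2 * ∫ ξ, f (w * ξ) := by
  have hn : ‖w‖ ≠ 0 := by simpa using hw
  have hn' : (‖w‖ : ℂ) ≠ 0 := by exact_mod_cast hn
  -- split `w` into a rotation and a dilation
  let r : Circle := ⟨w / ‖w‖, by simp [Submonoid.unitSphere, hn]⟩
  have h1 : ∫ ξ, f ((‖w‖ : ℝ) • (rotation r ξ)) = ∫ ξ, f ((‖w‖ : ℝ) • ξ) :=
    ((rotation r).measurePreserving).integral_comp
      (rotation r).toHomeomorph.measurableEmbedding (fun ξ => f ((‖w‖ : ℝ) • ξ))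
  have h2 := Measure.integral_comp_smul (volume : Measure ℂ) f ‖w‖
  have h3 : (fun ξ => f (w * ξ)) = fun ξ => f ((‖w‖ : ℝ) • (rotation r ξ)) := by
    ext ξ; congr 1
    rw [rotation_apply, Complex.real_smul, ← mul_assoc]
    congr 1
    change w = (‖w‖ : ℂ) * (w / ‖w‖)
    field_simp
  rw [h3, h1, h2, Complex.finrank_real_complex, abs_of_nonneg (by positivity), Complex.real_smul]
  push_cast
  field_simp

/-- Covariance of the Fourier transform under a dilation composed with a rotation. For `w` fixed,
`ξ ↦ w ξ` has Jacobian `‖w‖ ^ 2` and adjoint `z ↦ conj w * z`. -/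
lemma planeFT_comp_mul {w : ℂ} (hw : w ≠ 0) (f : ℂ → ℂ) (z : ℂ) :
    planeFT f z = (‖w‖ : ℂ) ^ 2 * planeFT (fun ξ => f (w * ξ)) (conj w * z) := by
  rw [planeFT, integral_comp_complex_mul hw, planeFT]
  simp only [planeChar_mul_right, mul_neg]

/-- Uniform rapid decay of the Fourier transforms of a smooth compactly supported family. -/
lemma exists_pow_mul_norm_planeFT_le_of_family {G : ℝ × ℂ → ℂ} (hG : ContDiff ℝ ∞ G)
    (hc : HasCompactSupport G) (N : ℕ) :
    ∃ C, ∀ t z, ‖z‖ ^ N * ‖planeFT (fun ξ => G (t, ξ)) z‖ ≤ C := by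
  obtain ⟨B, hB⟩ : ∃ B, ∀ p ∈ tsupport G, ‖p‖ ≤ B := hc.isBounded.exists_norm_le
  have hbd : ∀ n : ℕ, ∃ A, ∀ p, ‖iteratedFDeriv ℝ n G p‖ ≤ A := fun n =>
    (hc.iteratedFDeriv n).exists_bound_of_continuous
      (hG.continuous_iteratedFDeriv (by exact_mod_cast le_top))
  choose A hA using hbd
  have hsm : ∀ t, ContDiff ℝ ∞ fun ξ => G (t, ξ) := fun t => hG.comp (by fun_prop)
  -- derivatives of a slice are dominated by those of `G`, uniformly in the parameter
  have hd : ∀ n t ξ, ‖iteratedFDeriv ℝ n (fun ξ => G (t, ξ)) ξ‖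
      ≤ (Metric.closedBall (0 : ℂ) B).indicator (fun _ => A n) ξ := by
    intro n t ξ
    have e : (fun ξ => G (t, ξ)) =
        (fun p => G ((t, 0) + p)) ∘ (ContinuousLinearMap.inr ℝ ℝ ℂ) := by
      ext ξ; simp
    have hG' : ContDiff ℝ ∞ fun p => G ((t, 0) + p) := hG.comp (by fun_prop)
    have hle : ‖iteratedFDeriv ℝ n (fun ξ => G (t, ξ)) ξ‖ ≤ ‖iteratedFDeriv ℝ n G (t, ξ)‖ := by
      rw [e, ContinuousLinearMap.iteratedFDeriv_comp_right _ hG' _ (by exact_mod_cast le_top)]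
      refine (ContinuousMultilinearMap.norm_compContinuousLinearMap_le _ _).trans ?_
      rw [iteratedFDeriv_comp_add_left]
      simp only [ContinuousLinearMap.inr_apply, Prod.mk_add_mk, add_zero, zero_add,
        Finset.prod_const]
      exact mul_le_of_le_one_right (norm_nonneg _)
        (pow_le_one₀ (norm_nonneg _) (ContinuousLinearMap.norm_inr_le_one ℝ ℝ ℂ))
    by_cases h : ξ ∈ Metric.closedBall (0 : ℂ) B
    · rw [Set.indicator_of_mem h]; exact hle.trans (hA n _)
    · rw [Set.indicator_of_notMem h]
      refine hle.trans (le_of_eq ?_)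
      rw [norm_eq_zero]
      by_contra h0
      have := hB _ (support_iteratedFDeriv_subset n h0)
      exact h (by simpa using (norm_snd_le (t, ξ)).trans this)
  have hint : ∀ n t, Integrable (fun ξ => ‖iteratedFDeriv ℝ n (fun ξ => G (t, ξ)) ξ‖) := by
    intro n t
    refine Integrable.mono' (g := (Metric.closedBall (0 : ℂ) B).indicator (fun _ => A n)) ?_ ?_ ?_
    · exact (integrable_indicator_iff measurableSet_closedBall).2
        (integrableOn_const (isCompact_closedBall _ _).measure_ne_top)
    · exact ((hsm t).continuous_iteratedFDeriv
        (by exact_mod_cast le_top)).norm.aestronglyMeasurable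
    · exact Eventually.of_forall fun ξ => by simpa using hd n t ξ
  refine ⟨2 ^ N * ∑ n ∈ Finset.range (N + 1), ∫ ξ,
    (Metric.closedBall (0 : ℂ) B).indicator (fun _ => A n) ξ, fun t z => ?_⟩
  have := Real.pow_mul_norm_iteratedFDeriv_fourier_le (K := 0) (N := ⊤) (hsm t) (by
    intro k n hk _
    obtain rfl : k = 0 := by simpa using hk
    simpa using hint n t) (k := 0) (n := N) le_rfl le_top z
  rw [planeFT_eq_fourier]
  simp only [pow_zero, norm_iteratedFDeriv_zero, zero_add, Finset.range_one,
    Finset.singleton_product, Finset.sum_map, Function.Embedding.coeFn_mk, one_mul,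
    CharP.cast_eq_zero, mul_zero] at this
  refine this.trans ?_
  gcongr with n hn
  · exact hint n t
  · exact (integrable_indicator_iff measurableSet_closedBall).2
        (integrableOn_const (isCompact_closedBall _ _).measure_ne_top)
  · exact fun ξ => hd n t ξ

/-- `f` is bounded by every negative power of `‖z‖` away from the origin. -/
def RapidDecay (f : ℂ → ℂ) : Prop :=
  ∀ (N : ℕ) (r : ℝ), 0 < r → ∃ C, ∀ z, r ≤ ‖z‖ → ‖z‖ ^ N * ‖f z‖ ≤ C

lemma rapidDecay_planeFT {g : ℂ → ℂ} (hg : ContDiff ℝ ∞ g) (hc : HasCompactSupport g) :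
    RapidDecay (planeFT g) := by
  intro N r _
  -- `g` is a member of a compactly supported family: cut the constant family off in `t`
  let κ : ContDiffBump (0 : ℝ) := ⟨1, 2, by norm_num, by norm_num⟩
  obtain ⟨C, hC⟩ := exists_pow_mul_norm_planeFT_le_of_family
    (G := fun p => (κ p.1 : ℂ) * g p.2)
    ((Complex.ofRealCLM.contDiff.comp (κ.contDiff.comp contDiff_fst)).mul
      (hg.comp contDiff_snd)) (by
      refine HasCompactSupport.intro (κ.hasCompactSupport.isCompact.prod hc.isCompact) ?_
      rintro ⟨t, ξ⟩ h
      rw [Set.mem_prod, not_and_or] at h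
      rcases h with h | h
      · simp [image_eq_zero_of_notMem_tsupport h]
      · simp [image_eq_zero_of_notMem_tsupport h]) N
  refine ⟨C, fun z _ => ?_⟩
  have := hC 0 z
  have h1 : κ 0 = 1 := κ.one_of_mem_closedBall (by simp [κ])
  simpa [h1] using this

/-- A smooth compactly supported function equal to one near the origin. -/
structure IsCutoff (χ : ℂ → ℂ) : Prop where
  contDiff : ContDiff ℝ ∞ χ
  compact : HasCompactSupport χ
  one_near : ∀ᶠ ξ in 𝓝 0, χ ξ = 1

/-- In the plane `1 / ‖ξ‖` is integrable near the origin. -/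
lemma integrableOn_norm_inv (r : ℝ) :
    IntegrableOn (fun ξ : ℂ => ‖ξ‖⁻¹) (Metric.ball 0 r) := by
  have := (integrableOn_fun_norm_addHaar (volume : Measure ℂ) (f := fun y : ℝ => y⁻¹) (r := r)).2
  refine this ?_
  rw [Complex.finrank_real_complex]
  refine (integrableOn_const (C := (1 : ℝ)) (by simp)).congr_fun (fun y hy => ?_) measurableSet_Ioo
  simp [mul_inv_cancel₀ hy.1.ne']

/-- A compactly supported function bounded by `C / ‖ξ‖` is integrable. -/
lemma integrable_of_norm_le_inv {f : ℂ → ℂ} (hc : HasCompactSupport f)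
    (hm : AEStronglyMeasurable f) {C : ℝ} (h : ∀ ξ, ξ ≠ 0 → ‖f ξ‖ ≤ C * ‖ξ‖⁻¹) :
    Integrable f := by
  obtain ⟨B, hB⟩ : ∃ B, ∀ p ∈ tsupport f, ‖p‖ ≤ B := hc.isBounded.exists_norm_le
  have hi : Integrable ((Metric.ball (0 : ℂ) (B + 1)).indicator fun ξ => C * ‖ξ‖⁻¹) :=
    (integrable_indicator_iff measurableSet_ball).2 ((integrableOn_norm_inv _).const_mul C)
  refine hi.mono' hm ?_
  filter_upwards [compl_mem_ae_iff.2 (measure_singleton (0 : ℂ))] with ξ hξ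
  by_cases hb : ξ ∈ Metric.ball (0 : ℂ) (B + 1)
  · rw [Set.indicator_of_mem hb]; exact h ξ hξ
  · have ht : ξ ∉ tsupport f := fun ht => by
      have := hB _ ht
      simp at hb; linarith
    rw [Set.indicator_of_notMem hb, image_eq_zero_of_notMem_tsupport ht, norm_zero]

/-- A rapidly decaying function tends to zero along the dilations by powers of two. -/
lemma RapidDecay.tendsto_dyadic {f : ℂ → ℂ} (hf : RapidDecay f) {z : ℂ} (hz : z ≠ 0) :
    Tendsto (fun j : ℕ => f (2 ^ j * z)) atTop (𝓝 0) := by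
  have hz' : 0 < ‖z‖ := norm_pos_iff.2 hz
  obtain ⟨C, hC⟩ := hf 1 ‖z‖ hz'
  refine squeeze_zero_norm (a := fun j : ℕ => C / ‖z‖ * (1 / 2) ^ j) (fun j => ?_) ?_
  · have h2 : (1 : ℝ) ≤ 2 ^ j := one_le_pow₀ (by norm_num)
    have := hC (2 ^ j * z) (by
      simpa using le_mul_of_one_le_left hz'.le h2)
    simp only [norm_mul, norm_pow, Complex.norm_ofNat, pow_one] at this
    rw [one_div, inv_pow, ← div_eq_mul_inv, div_div, le_div_iff₀ (by positivity)]
    linarith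
  · simpa using (tendsto_pow_atTop_nhds_zero_of_lt_one (r := (1 / 2 : ℝ)) (by norm_num)
      (by norm_num)).const_mul (C / ‖z‖)

/-- If `h(z) - h(2z)` decays rapidly, then `h` is rapidly close to its limit along dyadic
dilations. -/
lemma RapidDecay.exists_dyadic_limit {h : ℂ → ℂ} (hd : RapidDecay fun z => h z - h (2 * z)) :
    ∃ H : ℂ → ℂ, RapidDecay (fun z => h z - H z) ∧
      ∀ z, z ≠ 0 → Tendsto (fun j : ℕ => h (2 ^ j * z)) atTop (𝓝 (H z)) := by
  have key : ∀ N r C, 0 < r → (∀ z, r ≤ ‖z‖ → ‖z‖ ^ (N + 1) * ‖h z - h (2 * z)‖ ≤ C) →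
      ∀ z, r ≤ ‖z‖ → ∀ j : ℕ,
      dist (h (2 ^ j * z)) (h (2 ^ (j + 1) * z)) ≤ C / ‖z‖ ^ (N + 1) * (1 / 2) ^ j := by
    intro N r C hr hC z hz j
    have hz' : 0 < ‖z‖ := hr.trans_le hz
    have h2 : (1 : ℝ) ≤ 2 ^ j := one_le_pow₀ (by norm_num)
    have := hC (2 ^ j * z) (by
      simpa using hz.trans (le_mul_of_one_le_left hz'.le h2))
    have e : 2 * (2 ^ j * z) = 2 ^ (j + 1) * z := by ring
    simp only [norm_mul, norm_pow, Complex.norm_ofNat, e] at this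
    rw [dist_eq_norm, one_div, inv_pow, ← div_eq_mul_inv, div_div, le_div_iff₀ (by positivity)]
    refine le_trans ?_ this
    rw [mul_comm, mul_pow, mul_comm (‖z‖ ^ (N + 1))]
    gcongr
    exact le_self_pow₀ h2 (by omega)
  have hlim : ∀ z, ∃ a, z ≠ 0 → Tendsto (fun j : ℕ => h (2 ^ j * z)) atTop (𝓝 a) := by
    intro z
    by_cases hz : z = 0
    · exact ⟨0, fun h => absurd hz h⟩
    have hz' : 0 < ‖z‖ := norm_pos_iff.2 hz
    obtain ⟨C, hC⟩ := hd 1 ‖z‖ hz'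
    obtain ⟨a, ha⟩ := cauchySeq_tendsto_of_complete
      (cauchySeq_of_le_geometric _ _ (by norm_num) (key 0 _ C hz' (by simpa using hC) z le_rfl))
    exact ⟨a, fun _ => ha⟩
  choose H hH using hlim
  refine ⟨H, fun N r hr => ?_, hH⟩
  obtain ⟨C, hC⟩ := hd (N + 1) r hr
  refine ⟨2 * C / r, fun z hz => ?_⟩
  have hz' : 0 < ‖z‖ := hr.trans_le hz
  have hC0 : 0 ≤ C := le_trans (by positivity) (hC z hz)
  have := dist_le_of_le_geometric_of_tendsto₀ _ _ (by norm_num) (key N r C hr hC z hz)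
    (hH z (norm_pos_iff.1 hz'))
  simp only [pow_zero, one_mul, dist_eq_norm] at this
  calc ‖z‖ ^ N * ‖h z - H z‖ ≤ ‖z‖ ^ N * (C / ‖z‖ ^ (N + 1) / (1 - 1 / 2)) := by gcongr
    _ = 2 * C / ‖z‖ := by field_simp; ring
    _ ≤ 2 * C / r := by gcongr

lemma RapidDecay.mul_of_norm_le_pow {f g : ℂ → ℂ} (hf : RapidDecay f) (m : ℕ)
    (hg : ∀ z, z ≠ 0 → ‖g z‖ ≤ ‖z‖ ^ m) : RapidDecay fun z => g z * f z := by
  intro N r hr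
  obtain ⟨C, hC⟩ := hf (N + m) r hr
  refine ⟨C, fun z hz => le_trans ?_ (hC z hz)⟩
  rw [norm_mul, pow_add, mul_assoc]
  have := hg z (norm_pos_iff.1 (hr.trans_le hz))
  gcongr

lemma RapidDecay.const_mul {f : ℂ → ℂ} (hf : RapidDecay f) (c : ℂ) :
    RapidDecay fun z => c * f z := by
  intro N r hr
  obtain ⟨C, hC⟩ := hf N r hr
  refine ⟨‖c‖ * C, fun z hz => ?_⟩
  rw [norm_mul, mul_left_comm]
  exact mul_le_mul_of_nonneg_left (hC z hz) (norm_nonneg _)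

lemma RapidDecay.add {f g : ℂ → ℂ} (hf : RapidDecay f) (hg : RapidDecay g) :
    RapidDecay fun z => f z + g z := by
  intro N r hr
  obtain ⟨C, hC⟩ := hf N r hr
  obtain ⟨D, hD⟩ := hg N r hr
  refine ⟨C + D, fun z hz => ?_⟩
  calc ‖z‖ ^ N * ‖f z + g z‖ ≤ ‖z‖ ^ N * (‖f z‖ + ‖g z‖) := by
        gcongr; exact norm_add_le _ _
    _ ≤ C + D := by rw [mul_add]; exact add_le_add (hC z hz) (hD z hz)

lemma RapidDecay.congr {f g : ℂ → ℂ} (hf : RapidDecay f) (h : ∀ z, z ≠ 0 → g z = f z) :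
    RapidDecay g := by
  intro N r hr
  obtain ⟨C, hC⟩ := hf N r hr
  refine ⟨C, fun z hz => ?_⟩
  rw [h z (norm_pos_iff.1 (hr.trans_le hz))]
  exact hC z hz

/-! ### Homogeneous functions -/

/-- The homogeneous function `θ^p * conj θ^q`. -/
noncomputable def homMonomial (p q : ℤ) (θ : ℂ) : ℂ := θ ^ p * conj θ ^ q

lemma homMonomial_mul (p q : ℤ) (w θ : ℂ) :
    homMonomial p q (w * θ) = homMonomial p q w * homMonomial p q θ := by
  simp only [homMonomial, map_mul, mul_zpow]; ring

lemma homMonomial_ne_zero (p q : ℤ) {θ : ℂ} (h : θ ≠ 0) : homMonomial p q θ ≠ 0 :=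
  mul_ne_zero (zpow_ne_zero _ h) (zpow_ne_zero _ (by simpa using h))

lemma norm_homMonomial (p q : ℤ) {θ : ℂ} (h : θ ≠ 0) : ‖homMonomial p q θ‖ = ‖θ‖ ^ (p + q) := by
  rw [homMonomial, norm_mul, norm_zpow, norm_zpow, RCLike.norm_conj, zpow_add₀ (by simpa using h)]

lemma contDiffAt_zpow {f : ℂ → ℂ} {θ : ℂ} (hf : ContDiffAt ℝ ∞ f θ) (h : f θ ≠ 0) (p : ℤ) :
    ContDiffAt ℝ ∞ (fun θ => f θ ^ p) θ := by
  cases p with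
  | ofNat n => simpa using hf.pow n
  | negSucc n => simpa [zpow_negSucc, Pi.inv_def] using (hf.pow (n + 1)).inv (pow_ne_zero _ h)

lemma contDiffAt_homMonomial (p q : ℤ) {θ : ℂ} (h : θ ≠ 0) :
    ContDiffAt ℝ ∞ (homMonomial p q) θ :=
  (contDiffAt_zpow contDiffAt_id h p).mul
    (contDiffAt_zpow Complex.conjCLE.contDiff.contDiffAt (by simpa using h) q)

lemma contDiff_homMonomial_natCast (p q : ℕ) : ContDiff ℝ ∞ (homMonomial p q) := by
  unfold homMonomial
  simp only [zpow_natCast]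
  exact (contDiff_id.pow p).mul (Complex.conjCLE.contDiff.pow q)

lemma measurable_homMonomial (p q : ℤ) : Measurable (homMonomial p q) := by
  unfold homMonomial
  have : Measurable fun θ : ℂ => conj θ := Complex.continuous_conj.measurable
  fun_prop

lemma IsCutoff.comp_mul {χ : ℂ → ℂ} (h : IsCutoff χ) {w : ℂ} (hw : w ≠ 0) :
    IsCutoff fun ξ => χ (w * ξ) where
  contDiff := h.contDiff.comp (contDiff_const.mul contDiff_id)
  compact := h.compact.comp_homeomorph (Homeomorph.mulLeft₀ w hw)
  one_near := by
    have : Tendsto (fun ξ : ℂ => w * ξ) (𝓝 0) (𝓝 0) := by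
      simpa using (continuous_const_mul w).tendsto 0
    exact this.eventually h.one_near

/-- The difference of two cutoffs vanishes near the origin, so it absorbs any singularity there. -/
lemma IsCutoff.contDiff_sub_mul {χ χ' : ℂ → ℂ} (h : IsCutoff χ) (h' : IsCutoff χ') {u : ℂ → ℂ}
    (hu : ∀ θ, θ ≠ 0 → ContDiffAt ℝ ∞ u θ) :
    ContDiff ℝ ∞ (fun ξ => (χ ξ - χ' ξ) * u ξ) := by
  rw [contDiff_iff_contDiffAt]
  intro θ
  by_cases hθ : θ = 0
  · subst hθ
    refine (contDiffAt_const (c := (0 : ℂ))).congr_of_eventuallyEq ?_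
    filter_upwards [h.one_near, h'.one_near] with ξ h1 h2
    simp [h1, h2]
  · exact (h.contDiff.contDiffAt.sub h'.contDiff.contDiffAt).mul (hu θ hθ)

lemma IsCutoff.compact_sub_mul {χ χ' : ℂ → ℂ} (h : IsCutoff χ) (h' : IsCutoff χ') (u : ℂ → ℂ) :
    HasCompactSupport (fun ξ => (χ ξ - χ' ξ) * u ξ) :=
  (h.compact.sub h'.compact).mul_right

lemma IsCutoff.integrable_mul_homMonomial {χ : ℂ → ℂ} (h : IsCutoff χ) {p q : ℤ}
    (hpq : -1 ≤ p + q) : Integrable fun ξ => χ ξ * homMonomial p q ξ := by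
  -- `χ` times the continuous factor of degree `p + q + 1` is bounded
  obtain ⟨n, hn⟩ : ∃ n : ℕ, p + q = n - 1 := ⟨(p + q + 1).toNat, by omega⟩
  obtain ⟨C, hC⟩ := (h.compact.mul_right (f' := fun ξ : ℂ => ξ ^ n)).exists_bound_of_continuous
    (h.contDiff.continuous.mul (continuous_pow n))
  refine integrable_of_norm_le_inv (C := C) h.compact.mul_right
    (h.contDiff.continuous.measurable.mul (measurable_homMonomial p q)).aestronglyMeasurable
    fun ξ hξ => ?_
  have hξ' : ‖ξ‖ ≠ 0 := by simpa using hξ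
  have := hC ξ
  rw [norm_mul, norm_homMonomial _ _ hξ, hn, zpow_sub_one₀ hξ', ← mul_assoc, zpow_natCast]
  simp only [Pi.mul_apply, norm_mul, norm_pow] at this
  gcongr

/-- Dilating and rotating the transform of a cut-off homogeneous function only changes the
cutoff. -/
lemma planeFT_cutoff_homMonomial_sub {χ : ℂ → ℂ} (h : IsCutoff χ) {p q : ℤ}
    (hpq : -1 ≤ p + q) {w : ℂ} (hw : w ≠ 0) (z : ℂ) :
    planeFT (fun ξ => χ ξ * homMonomial p q ξ) z -
      (‖w‖ : ℂ) ^ 2 * homMonomial p q w * planeFT (fun ξ => χ ξ * homMonomial p q ξ) (conj w * z)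
    = planeFT (fun ξ => (χ ξ - χ (w⁻¹ * ξ)) * homMonomial p q ξ) z := by
  have h' := h.comp_mul (inv_ne_zero hw)
  simp only [sub_mul]
  rw [planeFT_sub (h.integrable_mul_homMonomial hpq) (h'.integrable_mul_homMonomial hpq),
    planeFT_comp_mul hw (fun ξ => χ (w⁻¹ * ξ) * homMonomial p q ξ)]
  simp only [inv_mul_cancel_left₀ hw, homMonomial_mul]
  rw [mul_assoc, ← planeFT_const_mul]
  congr 4; ext ξ; ring

/-- The Fourier transform of a cut-off homogeneous function is, up to a rapidly decaying error,
a multiple of the dual homogeneous function: dilations and rotations change it only by the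
transform of a smooth compactly supported function. -/
lemma exists_planeFT_homMonomial_sub {χ : ℂ → ℂ} (h : IsCutoff χ) {p q : ℤ} (hpq : -1 ≤ p + q) :
    ∃ c : ℂ, RapidDecay fun z => planeFT (fun ξ => χ ξ * homMonomial p q ξ) z
      - c * homMonomial (-1 - q) (-1 - p) z := by
  set J := planeFT (fun ξ => χ ξ * homMonomial p q ξ) with hJ
  set v := homMonomial (-1 - q) (-1 - p) with hv
  obtain ⟨m, hm⟩ : ∃ m : ℕ, p + q = m - 2 := ⟨(p + q + 2).toNat, by omega⟩
  have hv0 : ∀ z, z ≠ 0 → v z ≠ 0 := fun z hz => homMonomial_ne_zero _ _ hz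
  have hvn : ∀ z, z ≠ 0 → ‖(v z)⁻¹‖ = ‖z‖ ^ m := fun z hz => by
    rw [norm_inv, norm_homMonomial _ _ hz, ← zpow_neg, ← zpow_natCast]
    congr 1; omega
  have hvw : ∀ w, w ≠ 0 → v (conj w) = ((‖w‖ : ℂ) ^ 2 * homMonomial p q w)⁻¹ := fun w hw => by
    have hcw : conj w ≠ 0 := by simpa using hw
    rw [← Complex.mul_conj', hv, homMonomial, homMonomial, Complex.conj_conj,
      zpow_sub₀ hw, zpow_sub₀ hcw, zpow_neg_one, zpow_neg_one]
    field_simp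
  -- the quotient of the transform by the dual homogeneous function `v` is nearly invariant under
  -- every dilation and rotation
  have hrap : ∀ w, w ≠ 0 → RapidDecay fun z => J z / v z - J (conj w * z) / v (conj w * z) := by
    intro w hw
    have h' := h.comp_mul (inv_ne_zero hw)
    have hr := (rapidDecay_planeFT
      (h.contDiff_sub_mul h' fun θ hθ => contDiffAt_homMonomial p q hθ)
      (h.compact_sub_mul h' _)).mul_of_norm_le_pow m (g := fun z => (v z)⁻¹)
        (fun z hz => (hvn z hz).le)
    refine hr.congr fun z hz => ?_
    rw [← planeFT_cutoff_homMonomial_sub h hpq hw z, ← hJ, hv, homMonomial_mul, ← hv, hvw w hw]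
    have := hv0 z hz
    have h1 : (‖w‖ : ℂ) ≠ 0 := by simpa using hw
    have h2 := homMonomial_ne_zero p q hw
    field_simp
  obtain ⟨H, hH, hlim⟩ := RapidDecay.exists_dyadic_limit (h := fun z => J z / v z)
    (by have := hrap 2 two_ne_zero; rwa [Complex.conj_ofNat] at this)
  -- its dyadic limit `H` is exactly invariant, that is, constant
  have hconst : ∀ z, z ≠ 0 → H z = H 1 := by
    intro z hz
    have h1 := (hrap (conj z) (by simpa using hz)).tendsto_dyadic one_ne_zero
    simp only [Complex.conj_conj, mul_one] at h1
    have h2 := (hlim 1 one_ne_zero).sub (hlim z hz)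
    simp only [mul_one, mul_comm _ z] at h2
    exact (sub_eq_zero.1 (tendsto_nhds_unique h2 h1)).symm
  refine ⟨H 1, fun N r hr => ?_⟩
  obtain ⟨C, hC⟩ := hH N r hr
  refine ⟨(r ^ m)⁻¹ * C, fun z hz => ?_⟩
  have hz' : 0 < ‖z‖ := hr.trans_le hz
  have hz0 := norm_pos_iff.1 hz'
  have e : J z - H 1 * v z = v z * (J z / v z - H z) := by
    rw [hconst z hz0]; have := hv0 z hz0; field_simp
  have hvz : ‖v z‖ = (‖z‖ ^ m)⁻¹ := by rw [← hvn z hz0, norm_inv, inv_inv]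
  change ‖z‖ ^ N * ‖J z - H 1 * v z‖ ≤ _
  rw [e, norm_mul, hvz, mul_left_comm]
  have hCz := hC z hz
  gcongr

/-- For nonnegative exponents the function is smooth and its cut-off transform decays rapidly. -/
lemma rapidDecay_planeFT_homMonomial_natCast {χ : ℂ → ℂ} (h : IsCutoff χ) (p q : ℕ) :
    RapidDecay (planeFT fun ξ => χ ξ * homMonomial p q ξ) :=
  rapidDecay_planeFT (h.contDiff.mul (contDiff_homMonomial_natCast p q)) h.compact.mul_right

/-! ### The cut-off logarithmic potential -/

/-- The cut-off logarithmic potential `∫ χ(ξ) ‖ξ‖⁻² (1 - exp (-2πi ⟨ξ, z⟩)) dξ`. -/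
noncomputable def logPotential (χ : ℂ → ℂ) (z : ℂ) : ℂ :=
  ∫ ξ, χ ξ * homMonomial (-1) (-1) ξ * (1 - planeChar (-z) ξ)

lemma exists_norm_cutoff_log_le {χ : ℂ → ℂ} (h : IsCutoff χ) : ∃ C, ∀ z ξ, ξ ≠ 0 →
    ‖χ ξ * homMonomial (-1) (-1) ξ * (1 - planeChar (-z) ξ)‖ ≤ C * ‖z‖ * ‖ξ‖⁻¹ := by
  obtain ⟨C, hC⟩ := h.compact.exists_bound_of_continuous h.contDiff.continuous
  refine ⟨C * (2 * Real.pi), fun z ξ hξ => ?_⟩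
  have hξ' : 0 < ‖ξ‖ := norm_pos_iff.2 hξ
  have h1 := norm_one_sub_planeChar_le (-z) ξ
  rw [norm_neg] at h1
  rw [norm_mul, norm_mul, norm_homMonomial _ _ hξ]
  have hC0 : 0 ≤ C := (norm_nonneg _).trans (hC 0)
  calc _ ≤ C * ‖ξ‖ ^ (-1 + -1 : ℤ) * (2 * Real.pi * (‖ξ‖ * ‖z‖)) := by
        gcongr; exact hC ξ
    _ = C * (2 * Real.pi) * ‖z‖ * ‖ξ‖⁻¹ := by
        rw [zpow_add₀ hξ'.ne', zpow_neg_one]; field_simp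

lemma IsCutoff.integrable_log {χ : ℂ → ℂ} (h : IsCutoff χ) (z : ℂ) :
    Integrable fun ξ => χ ξ * homMonomial (-1) (-1) ξ * (1 - planeChar (-z) ξ) := by
  obtain ⟨C, hC⟩ := exists_norm_cutoff_log_le h
  refine integrable_of_norm_le_inv (C := C * ‖z‖) h.compact.mul_right.mul_right ?_ (hC z)
  exact ((h.contDiff.continuous.measurable.mul (measurable_homMonomial _ _)).mul
    (measurable_const.sub (continuous_planeChar _).measurable)).aestronglyMeasurable

lemma exists_norm_logPotential_le {χ : ℂ → ℂ} (h : IsCutoff χ) :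
    ∃ C, ∀ z, ‖logPotential χ z‖ ≤ C * ‖z‖ := by
  obtain ⟨C, hC⟩ := exists_norm_cutoff_log_le h
  obtain ⟨B, hB⟩ : ∃ B, ∀ p ∈ tsupport χ, ‖p‖ ≤ B := h.compact.isBounded.exists_norm_le
  refine ⟨C * ∫ ξ in Metric.ball (0 : ℂ) (B + 1), ‖ξ‖⁻¹, fun z => ?_⟩
  have hsupp : ∀ ξ, ξ ∉ Metric.ball (0 : ℂ) (B + 1) →
      χ ξ * homMonomial (-1) (-1) ξ * (1 - planeChar (-z) ξ) = 0 := by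
    intro ξ hξ
    have : ξ ∉ tsupport χ := fun ht => by
      have := hB _ ht
      simp at hξ; linarith
    simp [image_eq_zero_of_notMem_tsupport this]
  rw [logPotential, ← setIntegral_eq_integral_of_forall_compl_eq_zero hsupp]
  calc _ ≤ ∫ ξ in Metric.ball (0 : ℂ) (B + 1), C * ‖z‖ * ‖ξ‖⁻¹ := by
        refine norm_integral_le_of_norm_le ((integrableOn_norm_inv _).const_mul _) ?_
        refine ae_restrict_of_ae ?_
        filter_upwards [compl_mem_ae_iff.2 (measure_singleton (0 : ℂ))] with ξ hξ
        exact hC z ξ hξ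
    _ = _ := by rw [integral_const_mul]; ring

/-- The behaviour of the cut-off logarithmic potential under a dilation composed with a rotation:
the increment is a constant minus the transform of a smooth compactly supported function. -/
lemma logPotential_sub {χ : ℂ → ℂ} (h : IsCutoff χ) {w : ℂ} (hw : w ≠ 0) (z : ℂ) :
    logPotential χ z - logPotential χ (conj w * z) =
      (∫ ξ, (χ ξ - χ (w⁻¹ * ξ)) * homMonomial (-1) (-1) ξ)
      - planeFT (fun ξ => (χ ξ - χ (w⁻¹ * ξ)) * homMonomial (-1) (-1) ξ) z := by
  have h' := h.comp_mul (inv_ne_zero hw)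
  have hg : Integrable fun ξ => (χ ξ - χ (w⁻¹ * ξ)) * homMonomial (-1) (-1) ξ :=
    (h.contDiff_sub_mul h' fun θ hθ => contDiffAt_homMonomial _ _ hθ).continuous
      |>.integrable_of_hasCompactSupport (h.compact_sub_mul h' _)
  have e : logPotential χ (conj w * z) =
      ∫ ξ, χ (w⁻¹ * ξ) * homMonomial (-1) (-1) ξ * (1 - planeChar (-z) ξ) := by
    rw [integral_comp_complex_mul hw, logPotential, ← integral_const_mul]
    congr 1; ext ξ
    have hn : (‖w‖ : ℂ) ≠ 0 := by simpa using hw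
    have hw' : homMonomial (-1) (-1) w = ((‖w‖ : ℂ) ^ 2)⁻¹ := by
      simp [homMonomial, ← Complex.mul_conj', mul_comm]
    rw [inv_mul_cancel_left₀ hw, homMonomial_mul, planeChar_mul_right, hw', mul_neg]
    field_simp
  rw [e, logPotential, ← integral_sub (h.integrable_log z) (h'.integrable_log z), planeFT,
    ← integral_sub hg (integrable_planeChar_mul hg _)]
  congr 1; ext ξ; ring

/-- The cut-off potential is a logarithm up to a rapidly decaying error. The defect of being
exactly logarithmic is a homomorphism from the multiplicative group of the plane which is bounded
outside the unit disc, hence trivial. -/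
lemma exists_logPotential_sub {χ : ℂ → ℂ} (h : IsCutoff χ) :
    ∃ α lam : ℂ, RapidDecay fun z => logPotential χ z - (α * Real.log ‖z‖ + lam) := by
  set κ : ℂ → ℂ := fun w => ∫ ξ, (χ ξ - χ (w⁻¹ * ξ)) * homMonomial (-1) (-1) ξ with hκ
  have hl2 : ((Real.log 2 : ℝ) : ℂ) ≠ 0 := by
    exact_mod_cast (Real.log_pos (by norm_num)).ne'
  -- the choice of `α` for which `g` below is nearly invariant under doubling
  set α : ℂ := -κ 2 / Real.log 2 with hα
  set g : ℂ → ℂ := fun z => logPotential χ z - α * Real.log ‖z‖ with hg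
  set d : ℂ → ℂ := fun w => κ w + α * Real.log ‖w‖ with hd
  have hrap : ∀ w, w ≠ 0 → RapidDecay fun z => g z - g (conj w * z) - d w := by
    intro w hw
    have h' := h.comp_mul (inv_ne_zero hw)
    refine ((rapidDecay_planeFT
      (h.contDiff_sub_mul h' fun θ hθ => contDiffAt_homMonomial (-1) (-1) hθ)
      (h.compact_sub_mul h' _)).const_mul (-1)).congr fun z hz => ?_
    have := logPotential_sub h hw z
    have hlog : Real.log ‖conj w * z‖ = Real.log ‖w‖ + Real.log ‖z‖ := by
      rw [norm_mul, RCLike.norm_conj, Real.log_mul (by simpa using hw) (by simpa using hz)]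
    simp only [hg, hd, hlog, hκ]
    push_cast
    linear_combination this
  have hd2 : d 2 = 0 := by
    simp only [hd, hα]
    have : ‖(2 : ℂ)‖ = 2 := by simp
    rw [this]; field_simp; ring
  obtain ⟨H, hH, hlim⟩ := RapidDecay.exists_dyadic_limit (h := g) (by
    have := hrap 2 two_ne_zero
    rw [Complex.conj_ofNat, hd2] at this
    simpa using this)
  -- in the limit the near invariance is exact
  have hdH : ∀ w z, w ≠ 0 → z ≠ 0 → H z - H (conj w * z) = d w := by
    intro w z hw hz
    have h1 := (hrap w hw).tendsto_dyadic hz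
    have h2 := ((hlim z hz).sub
      (hlim (conj w * z) (mul_ne_zero (by simpa using hw) hz))).sub_const (d w)
    simp only [mul_left_comm (conj w)] at h1
    exact sub_eq_zero.1 (tendsto_nhds_unique h2 h1)
  have hH2 : ∀ (n : ℕ) z, z ≠ 0 → H (2 ^ n * z) = H z := by
    intro n z hz
    induction n with
    | zero => simp
    | succ n ih =>
      have := hdH 2 (2 ^ n * z) two_ne_zero (by simpa using hz)
      rw [Complex.conj_ofNat, hd2, ← mul_assoc, ← pow_succ'] at this
      rw [← sub_eq_zero.1 this, ih]
  obtain ⟨B, hB⟩ : ∃ B, ∀ z, 1 ≤ ‖z‖ → ‖H z‖ ≤ B := by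
    obtain ⟨C, hC⟩ := hH 0 1 one_pos
    obtain ⟨D, hD⟩ := exists_norm_logPotential_le h
    have hD0 : 0 ≤ D := by simpa using (norm_nonneg _).trans (hD 1)
    refine ⟨C + (D * 2 + ‖α‖ * 1), fun z hz => ?_⟩
    -- the dyadic invariance of `H` reduces the bound to an annulus
    obtain ⟨n, hn1, hn2⟩ := exists_nat_pow_near hz (one_lt_two : (1 : ℝ) < 2)
    have hz0 : z ≠ 0 := by rintro rfl; simp at hz; linarith
    obtain ⟨y, rfl⟩ : ∃ y, z = 2 ^ n * y := ⟨z / 2 ^ n, by field_simp⟩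
    have hy0 : y ≠ 0 := right_ne_zero_of_mul hz0
    rw [hH2 n y hy0]
    simp only [norm_mul, norm_pow, Complex.norm_ofNat] at hn1 hn2
    have hp : (0 : ℝ) < 2 ^ n := by positivity
    have hy1 : 1 ≤ ‖y‖ := by
      by_contra hcon
      nlinarith
    have hy2 : ‖y‖ ≤ 2 := by
      rw [pow_succ] at hn2
      exact (lt_of_mul_lt_mul_left hn2 hp.le).le
    have h1 := hC y hy1
    rw [pow_zero, one_mul] at h1
    have hlog0 : 0 ≤ Real.log ‖y‖ := Real.log_nonneg hy1
    have hlog1 : Real.log ‖y‖ ≤ 1 := (Real.log_le_sub_one_of_pos (by linarith)).trans (by linarith)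
    calc ‖H y‖ = ‖-(g y - H y) + g y‖ := by congr 1; ring
      _ ≤ ‖g y - H y‖ + ‖g y‖ := by
        refine (norm_add_le _ _).trans_eq (by rw [norm_neg])
      _ ≤ C + (‖logPotential χ y‖ + ‖α * Real.log ‖y‖‖) := by
        gcongr; exact norm_sub_le _ _
      _ ≤ C + (D * 2 + ‖α‖ * 1) := by
        rw [norm_mul, Complex.norm_real, Real.norm_of_nonneg hlog0]
        gcongr
        exact (hD y).trans (by gcongr)
  have hpow : ∀ w, 1 ≤ ‖w‖ → ∀ n : ℕ, H (conj w ^ n) = H 1 - n * d w := by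
    intro w hw n
    have hw0 : w ≠ 0 := by rintro rfl; simp at hw; linarith
    induction n with
    | zero => simp
    | succ n ih =>
      have := hdH w (conj w ^ n) hw0 (pow_ne_zero _ (by simpa using hw0))
      rw [pow_succ']; push_cast
      linear_combination ih - this
  -- a nonzero `d w` would make `H` unbounded along the powers of `conj w`
  have hd0 : ∀ w, 1 ≤ ‖w‖ → d w = 0 := by
    intro w hw
    by_contra hne
    obtain ⟨n, hn⟩ := exists_nat_gt (2 * B / ‖d w‖)
    rw [div_lt_iff₀ (norm_pos_iff.2 hne)] at hn
    have h1 := hB (conj w ^ n) (by simpa using one_le_pow₀ hw)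
    have h2 := hB 1 (by simp)
    have h3 : (n : ℂ) * d w = H 1 - H (conj w ^ n) := by rw [hpow w hw n]; ring
    have h4 : n * ‖d w‖ ≤ ‖H 1‖ + ‖H (conj w ^ n)‖ := by
      rw [← Complex.norm_natCast, ← norm_mul, h3]; exact norm_sub_le _ _
    linarith
  have hconst : ∀ z, z ≠ 0 → H z = H 1 := by
    intro z hz
    rcases le_total 1 ‖z‖ with h1 | h1
    · have := hdH (conj z) 1 (by simpa using hz) one_ne_zero
      rw [hd0 _ (by simpa using h1), Complex.conj_conj, mul_one] at this
      exact (sub_eq_zero.1 this).symm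
    · have := hdH (conj z)⁻¹ z (by simpa using hz) hz
      rw [hd0 _ (by simpa using (one_le_inv₀ (norm_pos_iff.2 hz)).2 h1), map_inv₀,
        Complex.conj_conj, inv_mul_cancel₀ hz] at this
      exact sub_eq_zero.1 this
  refine ⟨α, H 1, hH.congr fun z hz => ?_⟩
  simp only [hg, hconst z hz]; ring

/-! ### Sums of homogeneous functions -/

/-- Finite linear combinations of the functions `homMonomial p q` with `p + q = n`, as functions
on the punctured plane. -/
inductive IsHomSum : ℤ → (ℂ → ℂ) → Prop
  | mono (c : ℂ) (p q : ℤ) {f : ℂ → ℂ} (h : ∀ θ, θ ≠ 0 → f θ = c * homMonomial p q θ) :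
      IsHomSum (p + q) f
  | add {n : ℤ} {f g : ℂ → ℂ} (hf : IsHomSum n f) (hg : IsHomSum n g) :
      IsHomSum n (fun θ => f θ + g θ)

lemma IsHomSum.congr {n : ℤ} {f g : ℂ → ℂ} (hf : IsHomSum n f) (h : ∀ θ, θ ≠ 0 → g θ = f θ) :
    IsHomSum n g := by
  induction hf generalizing g with
  | mono c p q h' => exact .mono c p q fun θ hθ => (h θ hθ).trans (h' θ hθ)
  | @add n f₁ f₂ h₁ h₂ ih₁ ih₂ =>
    -- nothing is required at the origin, so the first summand can take any value there
    have e : g = fun θ => (fun θ => if θ = 0 then g 0 - f₂ 0 else f₁ θ) θ + f₂ θ := by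
      ext θ
      by_cases hθ : θ = 0
      · simp [hθ]
      · simp [hθ, h θ hθ]
    rw [e]
    exact (ih₁ fun θ hθ => if_neg hθ).add h₂

lemma isHomSum_zero (n : ℤ) : IsHomSum n (fun _ => 0) := by
  have := IsHomSum.mono 0 n 0 (f := fun _ => 0) (by simp)
  rwa [add_zero] at this

lemma IsHomSum.sum {ι : Type*} {n : ℤ} (s : Finset ι) {f : ι → ℂ → ℂ}
    (h : ∀ i ∈ s, IsHomSum n (f i)) : IsHomSum n (fun θ => ∑ i ∈ s, f i θ) := by
  classical
  induction s using Finset.induction_on with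
  | empty => simpa using isHomSum_zero n
  | insert a s ha ih =>
    simp only [Finset.sum_insert ha]
    exact (h a (by simp)).add (ih fun i hi => h i (by simp [hi]))

lemma IsHomSum.mul {n m : ℤ} {f g : ℂ → ℂ} (hf : IsHomSum n f) (hg : IsHomSum m g) :
    IsHomSum (n + m) (fun θ => f θ * g θ) := by
  induction hf with
  | mono c p q h =>
    induction hg with
    | mono c' p' q' h' =>
      have e : p + q + (p' + q') = (p + p') + (q + q') := by ring
      rw [e]
      refine .mono (c * c') _ _ fun θ hθ => ?_
      have hcθ : conj θ ≠ 0 := by simpa using hθ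
      rw [h θ hθ, h' θ hθ, homMonomial, homMonomial, homMonomial, zpow_add₀ hθ, zpow_add₀ hcθ]
      ring
    | add _ _ ih₁ ih₂ => simpa only [mul_add] using ih₁.add ih₂
  | add _ _ ih₁ ih₂ => simpa only [add_mul] using ih₁.add ih₂

lemma isHomSum_const (c : ℂ) : IsHomSum 0 (fun _ => c) :=
  .mono c 0 0 (by simp [homMonomial])

lemma IsHomSum.const_mul {n : ℤ} {f : ℂ → ℂ} (hf : IsHomSum n f) (c : ℂ) :
    IsHomSum n (fun θ => c * f θ) := by
  simpa using (isHomSum_const c).mul hf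

lemma IsHomSum.pow {n : ℤ} {f : ℂ → ℂ} (hf : IsHomSum n f) (k : ℕ) :
    IsHomSum (k * n) (fun θ => f θ ^ k) := by
  induction k with
  | zero => simpa using isHomSum_const 1
  | succ k ih =>
    simp only [pow_succ]
    have := ih.mul hf
    rwa [show ((k + 1 : ℕ) : ℤ) * n = k * n + n by push_cast; ring]

lemma isHomSum_inner (x : ℂ) : IsHomSum 1 (fun θ => ((inner ℝ θ x : ℝ) : ℂ)) := by
  have h1 := IsHomSum.mono (conj x / 2) 1 0 (fun θ _ => rfl)
  have h2 := IsHomSum.mono (x / 2) 0 1 (fun θ _ => rfl)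
  refine (h1.add h2).congr fun θ _ => ?_
  simp only [homMonomial, zpow_one, zpow_zero, mul_one, one_mul]
  rw [Complex.inner, Complex.re_eq_add_conj]
  simp; ring

/-! ### The reciprocal of a symbol -/

/-- The divided Taylor remainders at `0` of a symbol: `Ψ (i + 1)` is the divided difference in `t`
of `Ψ i`, all of them are homogeneous under `(t, θ) ↦ (t / s, s θ)`, and the leading symbol
`Ψ 0 0` is the isotropic quadratic form `c ‖θ‖²`. The radius `ρ` bounds a disc on which the
symbol has no zero but the origin. -/
structure IsSymbolTower (Ψ : ℕ → ℝ → ℂ → ℂ) (c : ℂ) (ρ : ℝ) : Prop where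
  contDiff : ∀ i, ContDiff ℝ ∞ fun q : ℝ × ℂ => Ψ i q.1 q.2
  step : ∀ i t θ, t * Ψ (i + 1) t θ = Ψ i t θ - Ψ i 0 θ
  homog : ∀ i t (s : ℝ) θ, Ψ i t (s * θ) = s ^ (i + 2) * Ψ i (t * s) θ
  isHomSum : ∀ i : ℕ, IsHomSum (i + 2) (Ψ i 0)
  leading : ∀ θ, Ψ 0 0 θ = c * homMonomial 1 1 θ
  const_ne : c ≠ 0
  radius_pos : 0 < ρ
  ne_zero : ∀ t θ, |t| ≤ 2 → ‖θ‖ ≤ ρ → θ ≠ 0 → Ψ 0 t θ ≠ 0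

/-- The coefficients of the formal reciprocal of the power series `∑ ψ i * t ^ i`. -/
noncomputable def recipCoeff (ψ : ℕ → ℂ) (M : ℕ) : ℂ :=
  ((if M = 0 then 1 else 0) - ∑ i : Fin M, ψ (i + 1) * recipCoeff ψ (M - 1 - i)) / ψ 0
decreasing_by omega

lemma recipCoeff_eq (ψ : ℕ → ℂ) (M : ℕ) : recipCoeff ψ M =
    ((if M = 0 then 1 else 0) - ∑ i ∈ Finset.range M, ψ (i + 1) * recipCoeff ψ (M - 1 - i))
      / ψ 0 := by
  rw [recipCoeff, Finset.sum_range fun i => ψ (i + 1) * recipCoeff ψ (M - 1 - i)]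

/-- The `M`-th divided Taylor remainder in `t` of the reciprocal `1 / Ψ 0 t θ`. -/
noncomputable def recipRem (Ψ : ℕ → ℝ → ℂ → ℂ) (M : ℕ) (t : ℝ) (θ : ℂ) : ℂ :=
  ((if M = 0 then 1 else 0) - ∑ i ∈ Finset.range M,
    Ψ (i + 1) t θ * recipCoeff (fun j => Ψ j 0 θ) (M - 1 - i)) / Ψ 0 t θ

lemma recipRem_zero_right (Ψ : ℕ → ℝ → ℂ → ℂ) (M : ℕ) (θ : ℂ) :
    recipRem Ψ M 0 θ = recipCoeff (fun j => Ψ j 0 θ) M := by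
  rw [recipRem, recipCoeff_eq]

namespace IsSymbolTower

variable {Ψ : ℕ → ℝ → ℂ → ℂ} {c : ℂ} {ρ : ℝ}

lemma leading_ne_zero (h : IsSymbolTower Ψ c ρ) {θ : ℂ} (hθ : θ ≠ 0) : Ψ 0 0 θ ≠ 0 := by
  rw [h.leading]; exact mul_ne_zero h.const_ne (homMonomial_ne_zero _ _ hθ)

/-- Each remainder is the divided difference at `t = 0` of the preceding one. -/
lemma recipRem_succ (h : IsSymbolTower Ψ c ρ) (M : ℕ) {t : ℝ} {θ : ℂ} (hθ : θ ≠ 0)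
    (h0 : Ψ 0 t θ ≠ 0) :
    recipRem Ψ M t θ = recipCoeff (fun j => Ψ j 0 θ) M + t * recipRem Ψ (M + 1) t θ := by
  set F := recipCoeff (fun j => Ψ j 0 θ) with hF
  have h00 := h.leading_ne_zero hθ
  have hFM : Ψ 0 0 θ * F M + ∑ i ∈ Finset.range M, Ψ (i + 1) 0 θ * F (M - 1 - i)
      = if M = 0 then 1 else 0 := by
    have := recipCoeff_eq (fun j => Ψ j 0 θ) M
    rw [← hF] at this
    rw [this]; field_simp; ring
  have hs : ∑ i ∈ Finset.range (M + 1), (t : ℂ) * (Ψ (i + 1) t θ * F (M - i))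
      = ∑ i ∈ Finset.range M, Ψ (i + 1) t θ * F (M - 1 - i) + Ψ 0 t θ * F M
        - (if M = 0 then 1 else 0) := by
    rw [← hFM]
    simp only [← mul_assoc, h.step, sub_mul, Finset.sum_sub_distrib]
    rw [Finset.sum_range_succ' (fun i => Ψ i t θ * F (M - i)),
      Finset.sum_range_succ' (fun i => Ψ i 0 θ * F (M - i))]
    have e : ∀ i, M - 1 - i = M - (i + 1) := fun i => by omega
    simp only [e, Nat.sub_zero]
    ring
  rw [recipRem, recipRem, ← hF]
  simp only [Nat.add_sub_cancel, Nat.succ_ne_zero, if_false, zero_sub]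
  rw [← Finset.mul_sum] at hs
  field_simp
  linear_combination hs

/-- The remainder of order `M` is homogeneous of degree `M - 2` under `(t, θ) ↦ (t / s, s θ)`. -/
lemma recipRem_mul (h : IsSymbolTower Ψ c ρ) (M : ℕ) (t : ℝ) {s : ℝ} (hs : s ≠ 0) (θ : ℂ) :
    recipRem Ψ M t (s * θ) = (s : ℂ) ^ (M - 2 : ℤ) * recipRem Ψ M (t * s) θ := by
  have hs' : (s : ℂ) ≠ 0 := by exact_mod_cast hs
  induction M using Nat.strong_induction_on generalizing t with
  | _ M ih =>
    have hF : ∀ m < M, recipCoeff (fun j => Ψ j 0 (s * θ)) m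
        = (s : ℂ) ^ (m - 2 : ℤ) * recipCoeff (fun j => Ψ j 0 θ) m := by
      intro m hm
      have := ih m hm 0
      rwa [zero_mul, recipRem_zero_right, recipRem_zero_right] at this
    rw [recipRem, recipRem, h.homog]
    have hsum : ∑ i ∈ Finset.range M, Ψ (i + 1) t (s * θ) *
          recipCoeff (fun j => Ψ j 0 (s * θ)) (M - 1 - i)
        = (s : ℂ) ^ M * ∑ i ∈ Finset.range M, Ψ (i + 1) (t * s) θ *
          recipCoeff (fun j => Ψ j 0 θ) (M - 1 - i) := by
      rw [Finset.mul_sum]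
      refine Finset.sum_congr rfl fun i hi => ?_
      rw [Finset.mem_range] at hi
      rw [h.homog, hF _ (by omega)]
      have e : (s : ℂ) ^ M = (s : ℂ) ^ (i + 1 + 2) * (s : ℂ) ^ (((M - 1 - i : ℕ) : ℤ) - 2) := by
        rw [← zpow_natCast, ← zpow_natCast, ← zpow_add₀ hs']
        congr 1; push_cast; omega
      rw [e]; ring
    have hδ : (if M = 0 then (1 : ℂ) else 0) = (s : ℂ) ^ M * (if M = 0 then 1 else 0) := by
      split_ifs with hM <;> simp [hM]
    rw [hsum, hδ, ← mul_sub, zpow_sub₀ hs', zpow_natCast, zero_add, ← hδ, mul_div_mul_comm]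
    rfl

/-- The Taylor coefficient of order `M` of the reciprocal symbol is homogeneous of degree
`M - 2`. -/
lemma isHomSum_recipCoeff (h : IsSymbolTower Ψ c ρ) (M : ℕ) :
    IsHomSum (M - 2) (fun θ => recipCoeff (fun j => Ψ j 0 θ) M) := by
  induction M using Nat.strong_induction_on with
  | _ M ih =>
    have hinv : IsHomSum (-1 + -1) (fun θ => (Ψ 0 0 θ)⁻¹) := .mono c⁻¹ _ _ fun θ hθ => by
      rw [h.leading, mul_inv]; simp [homMonomial, mul_comm]
    have hδ : IsHomSum M (fun _ => if M = 0 then 1 else 0) := by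
      split_ifs with hM
      · rw [hM]; exact isHomSum_const 1
      · exact isHomSum_zero _
    have hs : IsHomSum M (fun θ => ∑ i ∈ Finset.range M, Ψ (i + 1) 0 θ *
        recipCoeff (fun j => Ψ j 0 θ) (M - 1 - i)) := by
      refine IsHomSum.sum _ fun i hi => ?_
      rw [Finset.mem_range] at hi
      have := (h.isHomSum (i + 1)).mul (ih (M - 1 - i) (by omega))
      rwa [show ((i + 1 : ℕ) : ℤ) + 2 + (((M - 1 - i : ℕ) : ℤ) - 2) = M by omega] at this
    have := (hδ.add (hs.const_mul (-1))).mul hinv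
    rw [show (M : ℤ) + (-1 + -1) = M - 2 by ring] at this
    refine this.congr fun θ _ => ?_
    rw [recipCoeff_eq]; ring

/-- The remainders are jointly smooth in `t` and `θ`, including at `t = 0`, wherever the symbol does
not vanish. -/
lemma contDiffAt_recipRem (h : IsSymbolTower Ψ c ρ) (M : ℕ) {t : ℝ} {θ : ℂ} (hθ : θ ≠ 0)
    (h0 : Ψ 0 t θ ≠ 0) : ContDiffAt ℝ ∞ (fun q : ℝ × ℂ => recipRem Ψ M q.1 q.2) (t, θ) := by
  induction M using Nat.strong_induction_on generalizing t with
  | _ M ih =>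
    have hF : ∀ m < M, ContDiffAt ℝ ∞
        (fun q : ℝ × ℂ => recipCoeff (fun j => Ψ j 0 q.2) m) (t, θ) := by
      intro m hm
      have := ih m hm (h.leading_ne_zero hθ)
      simp only [← recipRem_zero_right]
      exact ContDiffAt.comp (t, θ) (f := fun q : ℝ × ℂ => ((0 : ℝ), q.2)) this
        (by fun_prop)
    simp only [recipRem, div_eq_mul_inv]
    refine ContDiffAt.mul ?_ ((h.contDiff 0).contDiffAt.inv h0)
    refine contDiffAt_const.sub (ContDiffAt.sum fun i hi => ?_)
    rw [Finset.mem_range] at hi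
    exact (h.contDiff (i + 1)).contDiffAt.mul (hF _ (by omega))

end IsSymbolTower

/-! ### Transforms of the Taylor remainders -/

lemma aestronglyMeasurable_of_continuousAt {f : ℂ → ℂ} (h : ∀ θ, θ ≠ 0 → ContinuousAt f θ) :
    AEStronglyMeasurable f := by
  have := (show ContinuousOn f {0}ᶜ from fun θ hθ => (h θ hθ).continuousWithinAt)
    |>.aestronglyMeasurable (μ := volume) (measurableSet_singleton (0 : ℂ)).compl
  rwa [restrict_compl_singleton] at this

namespace IsSymbolTower

variable {Ψ : ℕ → ℝ → ℂ → ℂ} {c : ℂ} {ρ : ℝ}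

/-- By homogeneity the remainder at `t = 1` is controlled by its values on the compact set
`[0, 1] × {‖θ‖ = ρ}`. -/
lemma exists_norm_recipRem_le (h : IsSymbolTower Ψ c ρ) (M : ℕ) :
    ∃ C, ∀ ξ, ξ ≠ 0 → ‖ξ‖ ≤ ρ → ‖recipRem Ψ M 1 ξ‖ ≤ C * ‖ξ‖ ^ (M - 2 : ℤ) := by
  have hK : IsCompact (Set.Icc (0 : ℝ) 1 ×ˢ Metric.sphere (0 : ℂ) ρ) :=
    isCompact_Icc.prod (isCompact_sphere _ _)
  obtain ⟨C, hC⟩ := hK.exists_bound_of_continuousOn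
    (f := fun q : ℝ × ℂ => recipRem Ψ M q.1 q.2) (by
      rintro ⟨t, θ⟩ ⟨ht, hθ⟩
      have hθn : ‖θ‖ = ρ := by simpa using hθ
      have hθ0 : θ ≠ 0 := norm_pos_iff.1 (hθn ▸ h.radius_pos)
      refine (h.contDiffAt_recipRem M hθ0 (h.ne_zero t θ ?_ hθn.le hθ0)).continuousAt
        |>.continuousWithinAt
      rw [abs_of_nonneg ht.1]; linarith [ht.2])
  refine ⟨C * (ρ ^ (M - 2 : ℤ))⁻¹, fun ξ hξ hξρ => ?_⟩
  have hρ := h.radius_pos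
  have hξ' : 0 < ‖ξ‖ := norm_pos_iff.2 hξ
  set s : ℝ := ‖ξ‖ / ρ with hs
  have hs0 : 0 < s := by positivity
  have hs0' : (s : ℂ) ≠ 0 := by exact_mod_cast hs0.ne'
  have e : ξ = s * (ξ / s) := by field_simp
  have hn : ‖ξ / s‖ = ρ := by
    rw [norm_div, Complex.norm_real, Real.norm_of_nonneg hs0.le, hs, div_div_cancel₀ hξ'.ne']
  have hb := hC (s, ξ / s) ⟨⟨hs0.le, (div_le_one hρ).2 hξρ⟩, by simpa using hn⟩
  calc ‖recipRem Ψ M 1 ξ‖ = s ^ (M - 2 : ℤ) * ‖recipRem Ψ M s (ξ / s)‖ := by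
        conv_lhs => rw [e]
        rw [h.recipRem_mul M 1 hs0.ne', one_mul, norm_mul, norm_zpow, Complex.norm_real,
          Real.norm_of_nonneg hs0.le]
    _ ≤ s ^ (M - 2 : ℤ) * C := by gcongr
    _ = _ := by rw [hs, div_zpow]; ring

lemma contDiffAt_cutoff_mul_recipRem (h : IsSymbolTower Ψ c ρ) {χ : ℂ → ℂ}
    (hχ : ContDiff ℝ ∞ χ) (hρ : ∀ ξ ∈ tsupport χ, ‖ξ‖ ≤ ρ) (M : ℕ) {θ : ℂ} (hθ : θ ≠ 0) :
    ContDiffAt ℝ ∞ (fun ξ => χ ξ * recipRem Ψ M 1 ξ) θ := by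
  by_cases ht : θ ∈ tsupport χ
  · refine hχ.contDiffAt.mul ?_
    exact ContDiffAt.comp θ (f := fun ξ : ℂ => ((1 : ℝ), ξ))
      (h.contDiffAt_recipRem M hθ (h.ne_zero 1 θ (by norm_num) (hρ θ ht) hθ)) (by fun_prop)
  · refine (contDiffAt_const (c := (0 : ℂ))).congr_of_eventuallyEq ?_
    filter_upwards [notMem_tsupport_iff_eventuallyEq.1 ht] with ξ hξ
    simp [hξ]

lemma integrable_cutoff_mul_recipRem (h : IsSymbolTower Ψ c ρ) {χ : ℂ → ℂ}
    (hχ : IsCutoff χ) (hρ : ∀ ξ ∈ tsupport χ, ‖ξ‖ ≤ ρ) {M : ℕ} (hM : 1 ≤ M) :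
    Integrable fun ξ => χ ξ * recipRem Ψ M 1 ξ := by
  obtain ⟨C, hC⟩ := h.exists_norm_recipRem_le M
  obtain ⟨A, hA⟩ := hχ.compact.exists_bound_of_continuous hχ.contDiff.continuous
  obtain ⟨n, rfl⟩ : ∃ n, M = n + 1 := ⟨M - 1, by omega⟩
  refine integrable_of_norm_le_inv (C := A * (|C| * ρ ^ n)) hχ.compact.mul_right
    (aestronglyMeasurable_of_continuousAt fun θ hθ =>
      (h.contDiffAt_cutoff_mul_recipRem hχ.contDiff hρ _ hθ).continuousAt) fun ξ hξ => ?_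
  have hA0 : 0 ≤ A := (norm_nonneg _).trans (hA 0)
  have hρ0 := h.radius_pos
  by_cases ht : ξ ∈ tsupport χ
  · have hξ' : 0 < ‖ξ‖ := norm_pos_iff.2 hξ
    have h1 := hC ξ hξ (hρ ξ ht)
    have e : ‖ξ‖ ^ (((n + 1 : ℕ) : ℤ) - 2) = ‖ξ‖ ^ n * ‖ξ‖⁻¹ := by
      rw [show (((n + 1 : ℕ) : ℤ) - 2) = n - 1 by push_cast; ring, zpow_sub_one₀ hξ'.ne',
        zpow_natCast]
    rw [e] at h1
    rw [norm_mul]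
    calc _ ≤ A * (|C| * (ρ ^ n * ‖ξ‖⁻¹)) := by
          refine mul_le_mul (hA ξ) (h1.trans ?_) (norm_nonneg _) hA0
          refine mul_le_mul (le_abs_self C) ?_ (by positivity) (abs_nonneg C)
          gcongr
          exact hρ ξ ht
      _ = _ := by ring
  · rw [image_eq_zero_of_notMem_tsupport ht]; simp; positivity

/-- The transform of a cut-off Taylor remainder of the reciprocal symbol decays at the rate
dictated by homogeneity. The dyadic pieces of the cutoff, rescaled to unit size, form one smooth
compactly supported family down to the scale parameter `t = 0`. -/
lemma exists_pow_mul_norm_planeFT_recipRem_le (h : IsSymbolTower Ψ c ρ) {χ : ℂ → ℂ}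
    (hχ : IsCutoff χ) (hρ : ∀ ξ ∈ tsupport χ, ‖ξ‖ ≤ ρ) (n : ℕ) :
    ∃ C, ∀ z, z ≠ 0 →
      ‖z‖ ^ n * ‖planeFT (fun ξ => χ ξ * recipRem Ψ (n + 1) 1 ξ) z‖ ≤ C := by
  set R := recipRem Ψ (n + 1) with hR
  let κ : ContDiffBump (0 : ℝ) := ⟨1, 2, by norm_num, by norm_num⟩
  have hχ2 := hχ.comp_mul (two_ne_zero (α := ℂ))
  set η : ℂ → ℂ := fun ξ => χ ξ - χ (2 * ξ) with hη
  have hηd : ContDiff ℝ ∞ η := hχ.contDiff.sub hχ2.contDiff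
  have hηc : HasCompactSupport η := hχ.compact.sub hχ2.compact
  have hηs : ∀ ξ, ρ < ‖ξ‖ → η ξ = 0 := by
    intro ξ hξ
    have h1 : ξ ∉ tsupport χ := fun ht => (hρ ξ ht).not_gt hξ
    have h2 : 2 * ξ ∉ tsupport χ := fun ht => by
      have := hρ _ ht
      rw [norm_mul, Complex.norm_ofNat] at this
      linarith [h.radius_pos]
    simp [hη, image_eq_zero_of_notMem_tsupport h1, image_eq_zero_of_notMem_tsupport h2]
  set G : ℝ × ℂ → ℂ := fun q => (κ q.1 : ℂ) * (η q.2 * R q.1 q.2) with hG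
  -- `G` vanishes near `θ = 0` and outside a bounded set, and in between the symbol has no zeros
  have hGd : ContDiff ℝ ∞ G := by
    rw [contDiff_iff_contDiffAt]
    rintro ⟨t, θ⟩
    have hz : (∀ᶠ q : ℝ × ℂ in 𝓝 (t, θ), G q = 0) → ContDiffAt ℝ ∞ G (t, θ) := fun he =>
      (contDiffAt_const (c := (0 : ℂ))).congr_of_eventuallyEq he
    by_cases hθ : θ = 0
    · subst hθ
      refine hz ?_
      filter_upwards [(continuous_snd.tendsto (t, (0 : ℂ))).eventually hχ.one_near,
        (continuous_snd.tendsto (t, (0 : ℂ))).eventually hχ2.one_near] with q h1 h2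
      simp [hG, hη, h1, h2]
    by_cases ht : |t| ≤ 2
    · by_cases hθρ : ‖θ‖ ≤ ρ
      · refine ContDiffAt.mul ?_ (ContDiffAt.mul ?_
          (h.contDiffAt_recipRem _ hθ (h.ne_zero t θ ht hθρ hθ)))
        · exact (Complex.ofRealCLM.contDiff.comp (κ.contDiff.comp contDiff_fst)).contDiffAt
        · exact (hηd.comp contDiff_snd).contDiffAt
      · refine hz ?_
        filter_upwards [((continuous_norm.comp continuous_snd).tendsto (t, θ)).eventually
          (lt_mem_nhds (not_le.1 hθρ))] with q hq
        simp [hG, hηs q.2 hq]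
    · refine hz ?_
      filter_upwards [((continuous_abs.comp continuous_fst).tendsto (t, θ)).eventually
          (lt_mem_nhds (not_le.1 ht))] with q hq
      have : κ q.1 = 0 := κ.zero_of_le_dist (by simpa using le_of_lt hq)
      simp [hG, this]
  have hGc : HasCompactSupport G := by
    refine HasCompactSupport.intro (κ.hasCompactSupport.isCompact.prod hηc.isCompact) ?_
    rintro ⟨t, ξ⟩ hq
    rw [Set.mem_prod, not_and_or] at hq
    rcases hq with hq | hq
    · simp [hG, image_eq_zero_of_notMem_tsupport hq]
    · simp [hG, image_eq_zero_of_notMem_tsupport hq]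
  obtain ⟨C, hC⟩ := exists_pow_mul_norm_planeFT_le_of_family hGd hGc n
  have hκ1 : ∀ t, |t| ≤ 1 → κ t = 1 := fun t ht =>
    κ.one_of_mem_closedBall (by simpa [κ] using ht)
  -- the transform with the cutoff shrunk `j` times
  set T : ℂ → ℕ → ℂ := fun z j => planeFT (fun ξ => χ (2 ^ j * ξ) * R 1 ξ) z with hT
  have hcut : ∀ j : ℕ, IsCutoff fun ξ => χ (2 ^ j * ξ) := fun j =>
    hχ.comp_mul (pow_ne_zero _ two_ne_zero)
  have hsup : ∀ (j : ℕ) ξ, ξ ∈ tsupport (fun ξ => χ (2 ^ j * ξ)) → ‖ξ‖ ≤ ρ := by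
    intro j ξ hξ
    have h1 : 2 ^ j * ξ ∈ tsupport χ :=
      tsupport_comp_subset_preimage χ (f := fun ξ : ℂ => 2 ^ j * ξ) (by fun_prop) hξ
    have h2 := hρ _ h1
    rw [norm_mul, norm_pow, Complex.norm_ofNat] at h2
    exact (le_mul_of_one_le_left (norm_nonneg _) (one_le_pow₀ (by norm_num))).trans h2
  have hint : ∀ j : ℕ, Integrable fun ξ => χ (2 ^ j * ξ) * R 1 ξ := fun j =>
    h.integrable_cutoff_mul_recipRem (hcut j) (hsup j) (by omega)
  -- removing one dyadic piece changes the transform by a rescaled member of the family `G`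
  have hstep : ∀ z, z ≠ 0 → ∀ j, dist (T z j) (T z (j + 1)) ≤ C / ‖z‖ ^ n * (1 / 2) ^ j := by
    intro z hz j
    have hz' : 0 < ‖z‖ := norm_pos_iff.2 hz
    set s : ℝ := (1 / 2) ^ j with hs
    have hs0 : 0 < s := by positivity
    have hs1 : s ≤ 1 := pow_le_one₀ (by norm_num) (by norm_num)
    have hsc : (s : ℂ) ≠ 0 := by exact_mod_cast hs0.ne'
    have h2s : (2 : ℂ) ^ j * s = 1 := by
      rw [hs]; push_cast; rw [← mul_pow]; norm_num
    have e1 : T z j - T z (j + 1) = planeFT (fun ξ => η (2 ^ j * ξ) * R 1 ξ) z := by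
      simp only [hT]
      rw [← planeFT_sub (hint j) (hint (j + 1))]
      congr 1; ext ξ
      simp only [hη]
      rw [← mul_assoc 2, ← pow_succ']; ring
    have e2 : planeFT (fun ξ => η (2 ^ j * ξ) * R 1 ξ) z =
        (s : ℂ) ^ (n + 1) * planeFT (fun ξ => G (s, ξ)) (s * z) := by
      rw [planeFT_comp_mul hsc, Complex.conj_ofReal, Complex.norm_real,
        Real.norm_of_nonneg hs0.le]
      have : (fun ξ => η (2 ^ j * (s * ξ)) * R 1 (s * ξ)) = fun ξ =>
          (s : ℂ) ^ (((n + 1 : ℕ) : ℤ) - 2) * G (s, ξ) := by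
        ext ξ
        rw [← mul_assoc, h2s, one_mul, hR, h.recipRem_mul _ _ hs0.ne', one_mul]
        simp only [hG, hR, hκ1 s (by rwa [abs_of_pos hs0])]
        push_cast; ring
      rw [this, planeFT_const_mul, ← mul_assoc, ← zpow_natCast (s : ℂ) 2,
        ← zpow_natCast (s : ℂ) (n + 1), ← zpow_add₀ hsc]
      congr 2; push_cast; ring
    rw [dist_eq_norm, e1, e2, norm_mul, norm_pow, Complex.norm_real, Real.norm_of_nonneg hs0.le]
    have := hC s (s * z)
    rw [norm_mul, Complex.norm_real, Real.norm_of_nonneg hs0.le, mul_pow] at this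
    rw [div_mul_eq_mul_div, le_div_iff₀ (by positivity)]
    calc _ = s * (s ^ n * ‖z‖ ^ n * ‖planeFT (fun ξ => G (s, ξ)) (s * z)‖) := by ring
      _ ≤ s * C := by gcongr
      _ = C * s := mul_comm _ _
  obtain ⟨A, hA⟩ := hχ.compact.exists_bound_of_continuous hχ.contDiff.continuous
  -- the transform tends to zero as the cutoff shrinks to the origin
  have hT0 : ∀ z, Tendsto (T z) atTop (𝓝 0) := by
    intro z
    obtain ⟨D, hD⟩ := h.exists_norm_recipRem_le (n + 1)
    have hdom : Integrable ((Metric.ball (0 : ℂ) (ρ + 1)).indicator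
        fun ξ => A * (|D| * (ρ ^ n * ‖ξ‖⁻¹))) :=
      (integrable_indicator_iff measurableSet_ball).2
        ((((integrableOn_norm_inv _).const_mul _).const_mul _).const_mul _)
    have := tendsto_integral_of_dominated_convergence
      (F := fun (j : ℕ) ξ => planeChar (-z) ξ * (χ (2 ^ j * ξ) * R 1 ξ)) (f := fun _ => 0) _
      (fun j => (integrable_planeChar_mul (hint j) _).aestronglyMeasurable) hdom (by
        intro j
        filter_upwards [compl_mem_ae_iff.2 (measure_singleton (0 : ℂ))] with ξ hξ
        have hξ' : 0 < ‖ξ‖ := norm_pos_iff.2 hξ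
        rw [norm_mul, norm_planeChar, one_mul, norm_mul]
        by_cases ht : ξ ∈ tsupport (fun ξ => χ (2 ^ j * ξ))
        · have hξρ := hsup j ξ ht
          rw [Set.indicator_of_mem (by simp; linarith)]
          have h1 := hD ξ hξ hξρ
          have e : ‖ξ‖ ^ (((n + 1 : ℕ) : ℤ) - 2) = ‖ξ‖ ^ n * ‖ξ‖⁻¹ := by
            rw [show (((n + 1 : ℕ) : ℤ) - 2) = n - 1 by push_cast; ring, zpow_sub_one₀ hξ'.ne',
              zpow_natCast]
          rw [e] at h1
          refine mul_le_mul (hA _) (h1.trans ?_) (norm_nonneg _) ((norm_nonneg _).trans (hA 0))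
          refine mul_le_mul (le_abs_self D) ?_ (by positivity) (abs_nonneg D)
          gcongr
        · have h0 : χ (2 ^ j * ξ) = 0 :=
            image_eq_zero_of_notMem_tsupport (f := fun ξ => χ (2 ^ j * ξ)) ht
          rw [h0, norm_zero, zero_mul]
          refine Set.indicator_nonneg (fun y _ => ?_) ξ
          have hA0 : 0 ≤ A := (norm_nonneg _).trans (hA 0)
          have := h.radius_pos
          positivity) (by
        filter_upwards [compl_mem_ae_iff.2 (measure_singleton (0 : ℂ))] with ξ hξ
        have hξ' : 0 < ‖ξ‖ := norm_pos_iff.2 hξ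
        refine tendsto_const_nhds.congr' ?_
        have hlarge := (tendsto_pow_atTop_atTop_of_one_lt (one_lt_two : (1 : ℝ) < 2)).eventually
          (eventually_gt_atTop (ρ / ‖ξ‖))
        filter_upwards [hlarge] with j hj
        rw [div_lt_iff₀ hξ'] at hj
        have : 2 ^ j * ξ ∉ tsupport χ := fun ht => by
          have h2 := hρ _ ht
          rw [norm_mul, norm_pow, Complex.norm_ofNat] at h2
          linarith
        simp [image_eq_zero_of_notMem_tsupport this])
    simpa [hT, planeFT] using this
  refine ⟨2 * C, fun z hz => ?_⟩
  have hz' : 0 < ‖z‖ := norm_pos_iff.2 hz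
  have := dist_le_of_le_geometric_of_tendsto₀ _ _ (by norm_num) (hstep z hz) (hT0 z)
  simp only [hT, pow_zero, one_mul, dist_zero_right] at this
  calc _ ≤ ‖z‖ ^ n * (C / ‖z‖ ^ n / (1 - 1 / 2)) := by gcongr
    _ = 2 * C := by field_simp; ring

end IsSymbolTower

/-! ### Angular expansions of transforms of homogeneous functions -/

/-- Up to a rapidly decaying error, the real part of `J` is that of a finite sum of functions
`z ^ l / ‖z‖ ^ (l + m)` with `l ≥ m`. -/
def HasAngularExpansion (m : ℕ) (J : ℂ → ℂ) : Prop :=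
  ∃ T : ℕ →₀ ℂ, (∀ l < m, T l = 0) ∧
    RapidDecay fun z => (((J z - T.sum fun l a => a * (z ^ l / (‖z‖ : ℂ) ^ (l + m))).re : ℝ) : ℂ)

lemma HasAngularExpansion.add {m : ℕ} {J J' : ℂ → ℂ} (h : HasAngularExpansion m J)
    (h' : HasAngularExpansion m J') : HasAngularExpansion m fun z => J z + J' z := by
  obtain ⟨T, hT, hd⟩ := h
  obtain ⟨T', hT', hd'⟩ := h'
  refine ⟨T + T', fun l hl => by simp [hT l hl, hT' l hl], (hd.add hd').congr fun z _ => ?_⟩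
  rw [Finsupp.sum_add_index (by simp) (by intros; ring)]
  simp only [Complex.sub_re, Complex.add_re]
  push_cast; ring

lemma RapidDecay.mono {f g : ℂ → ℂ} (hf : RapidDecay f) (h : ∀ z, z ≠ 0 → ‖g z‖ ≤ ‖f z‖) :
    RapidDecay g := by
  intro N r hr
  obtain ⟨C, hC⟩ := hf N r hr
  refine ⟨C, fun z hz => le_trans ?_ (hC z hz)⟩
  have := h z (norm_pos_iff.1 (hr.trans_le hz))
  gcongr

/-- The dual of `homMonomial p q` with `p + q = m - 2` has angular frequency `|p - q|`. When `p` or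
`q` is negative this is at least `m`; otherwise the monomial is a polynomial, and its cut-off
transform decays rapidly. -/
lemma hasAngularExpansion_homMonomial {χ : ℂ → ℂ} (hχ : IsCutoff χ) (a : ℂ) {p q : ℤ} {m : ℕ}
    (hm : 1 ≤ m) (hpq : p + q = m - 2) :
    HasAngularExpansion m (fun z => a * planeFT (fun ξ => χ ξ * homMonomial p q ξ) z) := by
  obtain ⟨b, hb⟩ := exists_planeFT_homMonomial_sub hχ (p := p) (q := q) (by omega)
  have hre : ∀ w : ℂ, ‖((w.re : ℝ) : ℂ)‖ ≤ ‖w‖ := fun w => by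
    rw [Complex.norm_real]; exact Complex.abs_re_le_norm w
  have hzz : ∀ z : ℂ, z ≠ 0 → ∀ k : ℤ, (z * conj z) ^ k = (‖z‖ : ℂ) ^ (2 * k) := fun z _ k => by
    rw [Complex.mul_conj', ← zpow_natCast, ← zpow_mul]; norm_num
  rcases lt_or_ge p 0 with hp | hp
  · -- negative angular frequency: pass to the complex conjugate
    obtain ⟨l, hl⟩ : ∃ l : ℕ, q - p = l := ⟨(q - p).toNat, by omega⟩
    refine ⟨Finsupp.single l (conj (a * b)), fun l' hl' => ?_, ?_⟩
    · rw [Finsupp.single_eq_of_ne (by omega)]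
    refine (hb.const_mul a).mono fun z hz => ?_
    have hcz : conj z ≠ 0 := by simpa using hz
    have hn : (‖z‖ : ℂ) ≠ 0 := by simpa using hz
    have hv : homMonomial (-1 - q) (-1 - p) z = conj (z ^ l / (‖z‖ : ℂ) ^ (l + m)) := by
      rw [map_div₀, map_pow, map_pow, Complex.conj_ofReal, ← zpow_natCast (‖z‖ : ℂ),
        ← zpow_natCast (conj z), show ((l + m : ℕ) : ℤ) = 2 * (q + 1) by push_cast; omega,
        ← hzz z hz, mul_zpow, homMonomial, ← hl, eq_div_iff (by positivity),
        mul_mul_mul_comm, ← zpow_add₀ hz, ← zpow_add₀ hcz]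
      rw [show -1 - q + (q + 1) = 0 by ring, zpow_zero, one_mul]
      congr 1; ring
    rw [Finsupp.sum_single_index (by simp)]
    refine le_trans (le_of_eq ?_) (hre _)
    rw [hv, mul_sub, Complex.sub_re, Complex.sub_re]
    congr 3
    rw [← Complex.conj_re]
    simp only [map_mul, Complex.conj_conj]
    congr 1; ring
  rcases lt_or_ge q 0 with hq | hq
  · obtain ⟨l, hl⟩ : ∃ l : ℕ, p - q = l := ⟨(p - q).toNat, by omega⟩
    refine ⟨Finsupp.single l (a * b), fun l' hl' => ?_, ?_⟩
    · rw [Finsupp.single_eq_of_ne (by omega)]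
    refine (hb.const_mul a).mono fun z hz => ?_
    have hcz : conj z ≠ 0 := by simpa using hz
    have hn : (‖z‖ : ℂ) ≠ 0 := by simpa using hz
    have hv : homMonomial (-1 - q) (-1 - p) z = z ^ l / (‖z‖ : ℂ) ^ (l + m) := by
      rw [← zpow_natCast (‖z‖ : ℂ), ← zpow_natCast z,
        show ((l + m : ℕ) : ℤ) = 2 * (p + 1) by push_cast; omega,
        ← hzz z hz, mul_zpow, homMonomial, ← hl, eq_div_iff (by positivity),
        mul_mul_mul_comm, ← zpow_add₀ hz, ← zpow_add₀ hcz]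
      rw [show -1 - p + (p + 1) = 0 by ring, zpow_zero, mul_one]
      congr 1; ring
    rw [Finsupp.sum_single_index (by simp)]
    refine le_trans (le_of_eq ?_) (hre _)
    rw [hv, mul_sub, mul_assoc]
  · -- a polynomial symbol contributes nothing
    obtain ⟨p, rfl⟩ := Int.eq_ofNat_of_zero_le hp
    obtain ⟨q, rfl⟩ := Int.eq_ofNat_of_zero_le hq
    refine ⟨0, fun _ _ => rfl, ?_⟩
    refine ((rapidDecay_planeFT_homMonomial_natCast hχ p q).const_mul a).mono fun z _ => ?_
    rw [Finsupp.sum_zero_index, sub_zero]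
    exact hre _

/-- A sum of homogeneous functions of degree `m - 2` contributes terms of order `m` with angular
frequencies at least `m`. -/
lemma IsHomSum.hasAngularExpansion {χ : ℂ → ℂ} (hχ : IsCutoff χ) {n : ℤ} {f : ℂ → ℂ}
    (hf : IsHomSum n f) {m : ℕ} (hm : 1 ≤ m) (hn : n = m - 2) :
    Integrable (fun ξ => χ ξ * f ξ) ∧ HasAngularExpansion m (planeFT fun ξ => χ ξ * f ξ) := by
  induction hf with
  | @mono a p q f h =>
    have hae : (fun ξ => χ ξ * f ξ) =ᵐ[volume] fun ξ => a * (χ ξ * homMonomial p q ξ) := by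
      filter_upwards [compl_mem_ae_iff.2 (measure_singleton (0 : ℂ))] with ξ hξ
      rw [h ξ hξ]; ring
    refine ⟨((hχ.integrable_mul_homMonomial (by omega)).const_mul a).congr hae.symm, ?_⟩
    have e : (planeFT fun ξ => χ ξ * f ξ) =
        fun z => a * planeFT (fun ξ => χ ξ * homMonomial p q ξ) z := by
      ext z
      rw [← planeFT_const_mul]
      exact integral_congr_ae (hae.mono fun ξ hξ => by simp only at hξ ⊢; rw [hξ])
    rw [e]
    exact hasAngularExpansion_homMonomial hχ a hm hn
  | add _ _ ih₁ ih₂ =>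
    obtain ⟨i₁, e₁⟩ := ih₁ hn
    obtain ⟨i₂, e₂⟩ := ih₂ hn
    simp only [mul_add]
    refine ⟨i₁.add i₂, ?_⟩
    have := e₁.add e₂
    rwa [show (planeFT fun ξ => _ + _) = fun z => _ from funext fun z => planeFT_add i₁ i₂ z]

/-! ### The characteristic function of a finitely supported distribution -/

/-- The iterated divided differences at `0` of the entire function `s ↦ exp (2πi s)`. -/
noncomputable def expQuot : ℕ → ℂ → ℂ
  | 0 => fun s => Complex.exp (2 * Real.pi * Complex.I * s)
  | j + 1 => dslope (expQuot j) 0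

lemma differentiable_expQuot (j : ℕ) : Differentiable ℂ (expQuot j) := by
  induction j with
  | zero => unfold expQuot; fun_prop
  | succ j ih =>
    rw [← differentiableOn_univ, expQuot, Complex.differentiableOn_dslope Filter.univ_mem]
    exact ih.differentiableOn

lemma expQuot_step (j : ℕ) (s : ℂ) : s * expQuot (j + 1) s = expQuot j s - expQuot j 0 := by
  have := sub_smul_dslope (expQuot j) 0 s
  rw [expQuot]
  simpa using this

/-- The second-order Taylor formula for `s ↦ exp (2πi s)`. -/
lemma expQuot_zero_eq (s : ℂ) : Complex.exp (2 * Real.pi * Complex.I * s) =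
    1 + s * expQuot 1 0 + s ^ 2 * expQuot 2 s := by
  have h0 := expQuot_step 0 s
  have h1 := expQuot_step 1 s
  simp only [expQuot, mul_zero, Complex.exp_zero] at h0 h1 ⊢
  linear_combination -h0 - s * h1

lemma expQuot_two_zero_ne : expQuot 2 0 ≠ 0 := by
  intro h
  -- otherwise `exp (2πi s)` would have a vanishing second derivative at the origin
  have h2 := differentiable_expQuot 2
  have hd1 : ∀ s : ℂ, HasDerivAt (fun s : ℂ => Complex.exp (2 * Real.pi * Complex.I * s))
      (expQuot 1 0 + (2 * s * expQuot 2 s + s ^ 2 * deriv (expQuot 2) s)) s := by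
    intro s
    have e : (fun s : ℂ => Complex.exp (2 * Real.pi * Complex.I * s)) =
        fun s => 1 + s * expQuot 1 0 + s ^ 2 * expQuot 2 s := funext expQuot_zero_eq
    rw [e]
    have ha := ((hasDerivAt_id s).mul_const (expQuot 1 0)).const_add 1
    have hb := ((hasDerivAt_id s).pow 2).mul (h2 s).hasDerivAt
    refine (ha.add hb).congr_deriv ?_
    simp
  have hd1' : ∀ s : ℂ, HasDerivAt (fun s : ℂ => Complex.exp (2 * Real.pi * Complex.I * s))
      (2 * Real.pi * Complex.I * Complex.exp (2 * Real.pi * Complex.I * s)) s := by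
    intro s
    refine (((hasDerivAt_id s).const_mul (2 * Real.pi * Complex.I)).cexp).congr_deriv ?_
    simp; ring
  have heq : (fun s : ℂ => 2 * Real.pi * Complex.I * Complex.exp (2 * Real.pi * Complex.I * s)) =
      fun s => expQuot 1 0 + (2 * s * expQuot 2 s + s ^ 2 * deriv (expQuot 2) s) :=
    funext fun s => (hd1' s).unique (hd1 s)
  have hA : HasDerivAt
      (fun s : ℂ => 2 * Real.pi * Complex.I * Complex.exp (2 * Real.pi * Complex.I * s))
      ((2 * Real.pi * Complex.I) ^ 2) 0 := by
    refine ((hd1' 0).const_mul (2 * Real.pi * Complex.I)).congr_deriv ?_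
    simp; ring
  have hB : HasDerivAt
      (fun s : ℂ => expQuot 1 0 + (2 * s * expQuot 2 s + s ^ 2 * deriv (expQuot 2) s)) 0 0 := by
    have hdd : DifferentiableAt ℂ (deriv (expQuot 2)) 0 :=
      ((h2.contDiff (n := 2)).differentiable_deriv_two) 0
    have ha := ((hasDerivAt_id (0 : ℂ)).const_mul 2).mul (h2 0).hasDerivAt
    have hb := ((hasDerivAt_id (0 : ℂ)).pow 2).mul hdd.hasDerivAt
    refine ((ha.add hb).const_add (expQuot 1 0)).congr_deriv ?_
    simp [h]
  rw [heq] at hA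
  have := hA.unique hB
  simp [Real.pi_ne_zero] at this

/-- The characteristic function of the distribution `∑ x ∈ S, p x • δ_x`. -/
noncomputable def charSum (S : Finset ℂ) (p : ℂ → ℝ) (ξ : ℂ) : ℂ :=
  ∑ x ∈ S, (p x : ℂ) * planeChar x ξ

/-- The divided Taylor remainders of `1 - charSum S p`, starting at order two. -/
noncomputable def symbolTower (S : Finset ℂ) (p : ℂ → ℝ) (i : ℕ) (t : ℝ) (θ : ℂ) : ℂ :=
  -∑ x ∈ S, (p x : ℂ) * ((inner ℝ θ x : ℝ) : ℂ) ^ (i + 2) * expQuot (i + 2) (t * (inner ℝ θ x : ℝ))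

lemma contDiff_charSum (S : Finset ℂ) (p : ℂ → ℝ) : ContDiff ℝ ∞ (charSum S p) := by
  unfold charSum
  refine ContDiff.sum fun x _ => contDiff_const.mul ?_
  exact contDiff_planeChar_uncurry.comp (by fun_prop : ContDiff ℝ ∞ fun ξ : ℂ => (x, ξ))

/-- For a centred distribution `1 - charSum S p` vanishes to second order at the origin, and the
first symbol is its quotient by `t ^ 2`. -/
lemma one_sub_charSum {S : Finset ℂ} {p : ℂ → ℝ} (h1 : ∑ x ∈ S, p x = 1)
    (hm : ∑ x ∈ S, (p x : ℂ) * x = 0) (t : ℝ) (θ : ℂ) :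
    1 - charSum S p (t * θ) = (t : ℂ) ^ 2 * symbolTower S p 0 t θ := by
  have hin : ∀ x : ℂ, inner ℝ ((t : ℂ) * θ) x = t * inner ℝ θ x := fun x => by
    rw [← Complex.real_smul, real_inner_smul_left]
  have hmean : ∑ x ∈ S, (p x : ℂ) * ((inner ℝ θ x : ℝ) : ℂ) = 0 := by
    have : inner ℝ θ (∑ x ∈ S, (p x : ℂ) * x) = ∑ x ∈ S, p x * inner ℝ θ x := by
      rw [inner_sum]
      exact Finset.sum_congr rfl fun x _ => by rw [← Complex.real_smul, real_inner_smul_right]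
    rw [hm, inner_zero_right] at this
    exact_mod_cast this.symm
  have h1' : ∑ x ∈ S, (p x : ℂ) = 1 := by exact_mod_cast h1
  have hx : ∀ x : ℂ, (p x : ℂ) * planeChar x (t * θ) = p x +
      (t * expQuot 1 0) * ((p x : ℂ) * ((inner ℝ θ x : ℝ) : ℂ)) +
      (t : ℂ) ^ 2 * ((p x : ℂ) * ((inner ℝ θ x : ℝ) : ℂ) ^ (0 + 2) *
        expQuot (0 + 2) (t * (inner ℝ θ x : ℝ))) := fun x => by
    rw [planeChar, hin, expQuot_zero_eq]; push_cast; ring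
  simp only [charSum, symbolTower, hx, Finset.sum_add_distrib, ← Finset.mul_sum, h1', hmean]
  ring

/-- A centred isotropic distribution gives a symbol tower. The hypothesis on `2 * ρ` provides for
the parameters `|t| ≤ 2`. -/
lemma isSymbolTower_symbolTower {S : Finset ℂ} {p : ℂ → ℝ} (h1 : ∑ x ∈ S, p x = 1)
    (hm : ∑ x ∈ S, (p x : ℂ) * x = 0) {C : ℝ} (hC : C ≠ 0)
    (hcov : ∀ θ : ℂ, ∑ x ∈ S, p x * (inner ℝ θ x) ^ 2 = C * ‖θ‖ ^ 2) {ρ : ℝ} (hρ : 0 < ρ)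
    (hne : ∀ ξ, ξ ≠ 0 → ‖ξ‖ ≤ 2 * ρ → charSum S p ξ ≠ 1) :
    IsSymbolTower (symbolTower S p) (-(C * expQuot 2 0)) ρ := by
  have hlead : ∀ θ, symbolTower S p 0 0 θ = -(C * expQuot 2 0) * homMonomial 1 1 θ := by
    intro θ
    have hc : ∑ x ∈ S, (p x : ℂ) * ((inner ℝ θ x : ℝ) : ℂ) ^ 2 = C * (‖θ‖ : ℂ) ^ 2 := by
      exact_mod_cast hcov θ
    simp only [symbolTower, Complex.ofReal_zero, zero_mul, zero_add, ← Finset.sum_mul, hc,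
      homMonomial, zpow_one, Complex.mul_conj']
    ring
  have hne0 : -((C : ℂ) * expQuot 2 0) ≠ 0 :=
    neg_ne_zero.2 (mul_ne_zero (by exact_mod_cast hC) expQuot_two_zero_ne)
  refine ⟨fun i => ?_, fun i t θ => ?_, fun i t s θ => ?_, fun i => ?_, hlead, hne0, hρ,
    fun t θ ht hθρ hθ => ?_⟩
  · unfold symbolTower
    refine (ContDiff.sum fun x _ => ?_).neg
    have hin : ContDiff ℝ ∞ fun q : ℝ × ℂ => ((inner ℝ q.2 x : ℝ) : ℂ) :=
      Complex.ofRealCLM.contDiff.comp (contDiff_snd.inner ℝ contDiff_const)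
    refine (contDiff_const.mul (hin.pow _)).mul ?_
    have hE : ContDiff ℝ ∞ (expQuot (i + 2)) :=
      ((differentiable_expQuot _).contDiff (n := ∞)).restrict_scalars ℝ
    exact hE.comp ((Complex.ofRealCLM.contDiff.comp contDiff_fst).mul hin)
  · simp only [symbolTower]
    rw [mul_neg, Finset.mul_sum, neg_sub_neg, ← Finset.sum_sub_distrib, ← Finset.sum_neg_distrib]
    refine Finset.sum_congr rfl fun x _ => ?_
    have := expQuot_step (i + 2) (t * (inner ℝ θ x : ℝ))
    simp only [Complex.ofReal_zero, zero_mul]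
    rw [show i + 1 + 2 = i + 2 + 1 by ring]
    linear_combination -(p x : ℂ) * ((inner ℝ θ x : ℝ) : ℂ) ^ (i + 2) * this
  · have hin : ∀ x : ℂ, inner ℝ ((s : ℂ) * θ) x = s * inner ℝ θ x := fun x => by
      rw [← Complex.real_smul, real_inner_smul_left]
    simp only [symbolTower, hin, mul_neg, Finset.mul_sum]
    congr 1
    refine Finset.sum_congr rfl fun x _ => ?_
    push_cast
    rw [mul_assoc (t : ℂ)]; ring
  · have hs : IsHomSum (i + 2) fun θ => ∑ x ∈ S, (-(p x : ℂ) * expQuot (i + 2) 0) *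
        ((inner ℝ θ x : ℝ) : ℂ) ^ (i + 2) := by
      refine IsHomSum.sum _ fun x _ => IsHomSum.const_mul ?_ _
      have := (isHomSum_inner x).pow (i + 2)
      rwa [mul_one, Nat.cast_add, Nat.cast_ofNat] at this
    refine hs.congr fun θ _ => ?_
    simp only [symbolTower, Complex.ofReal_zero, zero_mul, ← Finset.sum_neg_distrib]
    refine Finset.sum_congr rfl fun x _ => by ring
  · by_cases ht0 : t = 0
    · rw [ht0, hlead]; exact mul_ne_zero hne0 (homMonomial_ne_zero _ _ hθ)
    intro h0
    have := one_sub_charSum h1 hm t θ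
    rw [h0, mul_zero, sub_eq_zero] at this
    refine hne (t * θ) (mul_ne_zero (by exact_mod_cast ht0) hθ) ?_ this.symm
    rw [norm_mul, Complex.norm_real, Real.norm_eq_abs]
    gcongr

/-! ### A smooth weight adapted to the dual lattice -/

lemma Real.smoothTransition_add_one_sub (x : ℝ) :
    Real.smoothTransition x + Real.smoothTransition (1 - x) = 1 := by
  have := (Real.smoothTransition.pos_denom x).ne'
  simp only [Real.smoothTransition, sub_sub_cancel]
  rw [add_comm (expNegInvGlue (1 - x))]
  field_simp

/-- A smooth bump on `[-2/3, 2/3]`, equal to one on `[-1/3, 1/3]`, whose integer translates sum to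
one. -/
noncomputable def unitWindow (s : ℝ) : ℝ :=
  Real.smoothTransition (3 * s + 2) * Real.smoothTransition (2 - 3 * s)

lemma contDiff_unitWindow : ContDiff ℝ ∞ unitWindow := by
  unfold unitWindow
  exact (Real.smoothTransition.contDiff.comp (by fun_prop)).mul
    (Real.smoothTransition.contDiff.comp (by fun_prop))

lemma unitWindow_eq_one {s : ℝ} (h : |s| ≤ 1 / 3) : unitWindow s = 1 := by
  obtain ⟨h1, h2⟩ := abs_le.1 h
  rw [unitWindow, Real.smoothTransition.one_of_one_le (by linarith),
    Real.smoothTransition.one_of_one_le (by linarith), one_mul]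

lemma unitWindow_eq_zero {s : ℝ} (h : 2 / 3 ≤ |s|) : unitWindow s = 0 := by
  rw [unitWindow]
  rcases le_abs.1 h with h | h
  · rw [Real.smoothTransition.zero_of_nonpos (x := 2 - 3 * s) (by linarith), mul_zero]
  · rw [Real.smoothTransition.zero_of_nonpos (x := 3 * s + 2) (by linarith), zero_mul]

lemma unitWindow_add_sub_one {s : ℝ} (h0 : 0 ≤ s) (h1 : s ≤ 1) :
    unitWindow s + unitWindow (s - 1) = 1 := by
  have := Real.smoothTransition_add_one_sub (2 - 3 * s)
  rw [unitWindow, unitWindow, Real.smoothTransition.one_of_one_le (x := 3 * s + 2) (by linarith),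
    Real.smoothTransition.one_of_one_le (x := 2 - 3 * (s - 1)) (by linarith), one_mul, mul_one,
    show 3 * (s - 1) + 2 = 1 - (2 - 3 * s) by ring, this]

/-- The integer Fourier coefficients of the window are those of a point mass: folding it onto the
circle gives the constant one. -/
lemma integral_unitWindow_mul_exp (m : ℤ) :
    ∫ s : ℝ, Complex.exp (2 * Real.pi * Complex.I * (m * s)) * (unitWindow s : ℂ) =
      if m = 0 then 1 else 0 := by
  set f : ℝ → ℂ := fun s => Complex.exp (2 * Real.pi * Complex.I * (m * s)) * (unitWindow s : ℂ)
    with hf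
  have hcont : Continuous f := by
    have := contDiff_unitWindow.continuous
    fun_prop
  have hsub : ∀ s : ℝ, Complex.exp (2 * Real.pi * Complex.I * (m * ((s - 1 : ℝ) : ℂ))) =
      Complex.exp (2 * Real.pi * Complex.I * (m * s)) := by
    intro s
    rw [Complex.exp_eq_exp_iff_exists_int]
    exact ⟨-m, by push_cast; ring⟩
  have h1 : ∫ s, f s = ∫ s in (-1 : ℝ)..1, f s := by
    rw [intervalIntegral.integral_eq_integral_of_support_subset]
    intro s hs
    by_contra hcon
    refine hs ?_
    have : 2 / 3 ≤ |s| := by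
      by_contra hlt
      have := abs_lt.1 (not_le.1 hlt)
      exact hcon ⟨by linarith, by linarith⟩
    simp [hf, unitWindow_eq_zero this]
  have h2 : ∫ s in (-1 : ℝ)..0, f s = ∫ s in (0 : ℝ)..1, f (s - 1) := by
    rw [intervalIntegral.integral_comp_sub_right]; norm_num
  rw [h1, ← intervalIntegral.integral_add_adjacent_intervals (b := 0)
    (hcont.intervalIntegrable _ _) (hcont.intervalIntegrable _ _), h2,
    ← intervalIntegral.integral_add
      (f := fun s => f (s - 1))
      ((hcont.comp (continuous_sub_right (1 : ℝ))).intervalIntegrable 0 1)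
      (hcont.intervalIntegrable _ _)]
  have h3 : ∫ s in (0 : ℝ)..1, (f (s - 1) + f s) =
      ∫ s in (0 : ℝ)..1, Complex.exp (2 * Real.pi * Complex.I * m * s) := by
    refine intervalIntegral.integral_congr fun s hs => ?_
    rw [Set.uIcc_of_le zero_le_one] at hs
    have hw : ((unitWindow s + unitWindow (s - 1) : ℝ) : ℂ) = 1 := by
      rw [unitWindow_add_sub_one hs.1 hs.2]; simp
    push_cast at hw
    simp only [hf, hsub]
    rw [← mul_add, add_comm, hw, mul_one, mul_assoc (2 * (Real.pi : ℂ) * Complex.I)]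
  rw [h3]
  split_ifs with hm
  · simp [hm]
  · have hc : 2 * (Real.pi : ℂ) * Complex.I * m ≠ 0 := by
      simp [Real.pi_ne_zero, hm]
    rw [integral_exp_mul_complex hc]
    have : Complex.exp (2 * Real.pi * Complex.I * m * (1 : ℝ)) = 1 := by
      rw [Complex.exp_eq_one_iff]; exact ⟨m, by push_cast; ring⟩
    rw [this]; simp

/-- A smooth compactly supported weight on the plane which is constant near the origin, whose
support meets the lattice dual to that spanned by `b` in the origin only, and whose Fourier
transform restricts to a point mass on the lattice spanned by `b`. -/
lemma exists_dual_window (b : Module.Basis (Fin 2) ℝ ℂ) :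
    ∃ (w : ℂ → ℂ) (w₀ : ℂ), ContDiff ℝ ∞ w ∧ HasCompactSupport w ∧ w₀ ≠ 0 ∧
      (∀ᶠ ξ in 𝓝 0, w ξ = w₀) ∧
      (∀ ξ ∈ tsupport w, (∀ i, ∃ n : ℤ, inner ℝ ξ (b i) = (n : ℝ)) → ξ = 0) ∧
      ∀ m n : ℤ, ∫ ξ, planeChar (m * b 0 + n * b 1) ξ * w ξ = if m = 0 ∧ n = 0 then 1 else 0 := by
  -- coordinates dual to the basis `b`; the measure becomes a multiple of Lebesgue measure
  let T₀ : ℂ →ₗ[ℝ] ℝ × ℝ :=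
    ((innerSL ℝ (b 0)).prod (innerSL ℝ (b 1)) : ℂ →L[ℝ] ℝ × ℝ)
  have hT₀ : ∀ ξ, T₀ ξ = (inner ℝ ξ (b 0), inner ℝ ξ (b 1)) := fun ξ => by
    simp [T₀, real_inner_comm]
  have hinj : Function.Injective T₀ := by
    rw [← LinearMap.ker_eq_bot, LinearMap.ker_eq_bot']
    intro ξ hξ
    rw [hT₀, Prod.mk_eq_zero] at hξ
    refine InnerProductSpace.ext_inner_right_basis b fun i => ?_
    fin_cases i
    · simpa using hξ.1
    · simpa using hξ.2
  let T : ℂ ≃L[ℝ] ℝ × ℝ :=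
    (LinearEquiv.ofInjectiveOfFinrankEq T₀ hinj (by simp)).toContinuousLinearEquiv
  have hT : ∀ ξ, T ξ = (inner ℝ ξ (b 0), inner ℝ ξ (b 1)) := hT₀
  have hmap : ((volume : Measure ℂ).map T).IsAddHaarMeasure := T.isAddHaarMeasure_map _
  set c : ℝ := NNReal.toReal
    (((volume : Measure ℂ).map T).addHaarScalarFactor (volume : Measure (ℝ × ℝ))) with hcdef
  have hc : (volume : Measure ℂ).map T =
      ((volume : Measure ℂ).map T).addHaarScalarFactor (volume : Measure (ℝ × ℝ)) • volume :=
    Measure.isAddLeftInvariant_eq_smul _ _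
  have hcr : c ≠ 0 := by
    have := Measure.addHaarScalarFactor_pos_of_isAddHaarMeasure ((volume : Measure ℂ).map T)
      (volume : Measure (ℝ × ℝ))
    rw [hcdef]
    exact_mod_cast this.ne'
  have hint : ∀ F : ℝ × ℝ → ℂ, ∫ ξ, F (T ξ) = c * ∫ q, F q := by
    intro F
    have := MeasurableEmbedding.integral_map (μ := (volume : Measure ℂ))
      T.toHomeomorph.measurableEmbedding F
    change ∫ q, F q ∂((volume : Measure ℂ).map T) = ∫ ξ, F (T ξ) at this
    rw [← this, hc, integral_smul_nnreal_measure, NNReal.smul_def, Complex.real_smul]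
  -- the weight is the product window in these coordinates
  set W : ℝ × ℝ → ℂ := fun q => ((unitWindow q.1 * unitWindow q.2 : ℝ) : ℂ) with hW
  have hWd : ContDiff ℝ ∞ W := Complex.ofRealCLM.contDiff.comp
    ((contDiff_unitWindow.comp contDiff_fst).mul (contDiff_unitWindow.comp contDiff_snd))
  have hW0 : ∀ q, W q ≠ 0 → |q.1| ≤ 2 / 3 ∧ |q.2| ≤ 2 / 3 := by
    intro q hq
    constructor
    · by_contra hcon
      exact hq (by simp [hW, unitWindow_eq_zero (not_le.1 hcon).le])
    · by_contra hcon
      exact hq (by simp [hW, unitWindow_eq_zero (not_le.1 hcon).le])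
  have hWc : HasCompactSupport W := by
    refine HasCompactSupport.intro
      ((isCompact_Icc (a := -(2 / 3 : ℝ)) (b := 2 / 3)).prod
        (isCompact_Icc (a := -(2 / 3 : ℝ)) (b := 2 / 3))) fun q hq => ?_
    by_contra hcon
    obtain ⟨h1, h2⟩ := hW0 q hcon
    exact hq ⟨abs_le.1 h1, abs_le.1 h2⟩
  have hcc : ((c : ℂ)) ≠ 0 := by exact_mod_cast hcr
  refine ⟨fun ξ => (c : ℂ)⁻¹ * W (T ξ), (c : ℂ)⁻¹,
    contDiff_const.mul (hWd.comp T.contDiff),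
    (hWc.comp_homeomorph T.toHomeomorph).mul_left, inv_ne_zero hcc, ?_, ?_, ?_⟩
  · have h0 : ∀ i, ∀ᶠ ξ : ℂ in 𝓝 0, |inner ℝ ξ (b i)| ≤ 1 / 3 := fun i => by
      have hcont : Continuous fun ξ : ℂ => |inner ℝ ξ (b i)| := by fun_prop
      refine (hcont.tendsto 0).eventually (ge_mem_nhds ?_)
      rw [inner_zero_left, abs_zero]; norm_num
    filter_upwards [h0 0, h0 1] with ξ h1 h2
    simp only [hT, hW, unitWindow_eq_one h1, unitWindow_eq_one h2]
    simp
  · intro ξ hξ hdual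
    have hclosed : IsClosed {ξ : ℂ | ∀ i, |inner ℝ ξ (b i)| ≤ 2 / 3} := by
      simp only [Set.ofPred_forall]
      refine isClosed_iInter fun i => isClosed_le ?_ continuous_const
      fun_prop
    have hsub : Function.support (fun ξ => (c : ℂ)⁻¹ * W (T ξ)) ⊆
        {ξ : ℂ | ∀ i, |inner ℝ ξ (b i)| ≤ 2 / 3} := by
      intro y hy i
      have := hW0 (T y) (right_ne_zero_of_mul hy)
      rw [hT] at this
      fin_cases i
      · exact this.1
      · exact this.2
    have hle : ∀ i, |inner ℝ ξ (b i)| ≤ 2 / 3 := closure_minimal hsub hclosed hξ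
    have hz : ∀ i, inner ℝ ξ (b i) = 0 := by
      intro i
      obtain ⟨n, hn⟩ := hdual i
      have h1 := hle i
      rw [hn] at h1 ⊢
      have h2 : |n| < 1 := by
        have : (|n| : ℝ) < 1 := by linarith
        exact_mod_cast this
      rw [Int.abs_lt_one_iff.1 h2, Int.cast_zero]
    refine InnerProductSpace.ext_inner_right_basis b fun i => ?_
    rw [hz, inner_zero_left]
  · intro m n
    have hch : ∀ ξ, planeChar (m * b 0 + n * b 1) ξ * ((c : ℂ)⁻¹ * W (T ξ)) =
        (fun q : ℝ × ℝ => (c : ℂ)⁻¹ *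
          ((Complex.exp (2 * Real.pi * Complex.I * (m * q.1)) * (unitWindow q.1 : ℂ)) *
          (Complex.exp (2 * Real.pi * Complex.I * (n * q.2)) * (unitWindow q.2 : ℂ)))) (T ξ) := by
      intro ξ
      have hm : ∀ (k : ℤ) (x : ℂ), inner ℝ ξ (k * x) = k * inner ℝ ξ x := fun k x => by
        have := real_inner_smul_right ξ x (k : ℝ)
        rwa [Complex.real_smul, Complex.ofReal_intCast] at this
      rw [planeChar_add, planeChar, planeChar, hm, hm, hT]
      simp only [hW]
      push_cast; ring
    simp only [hch]
    rw [hint (fun q : ℝ × ℝ => (c : ℂ)⁻¹ *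
      ((Complex.exp (2 * Real.pi * Complex.I * (m * q.1)) * (unitWindow q.1 : ℂ)) *
      (Complex.exp (2 * Real.pi * Complex.I * (n * q.2)) * (unitWindow q.2 : ℂ)))),
      integral_const_mul, mul_inv_cancel_left₀ hcc, Measure.volume_eq_prod,
      integral_prod_mul
        (fun x : ℝ => Complex.exp (2 * Real.pi * Complex.I * (m * x)) * (unitWindow x : ℂ))
        (fun y : ℝ => Complex.exp (2 * Real.pi * Complex.I * (n * y)) * (unitWindow y : ℂ)),
      integral_unitWindow_mul_exp, integral_unitWindow_mul_exp]
    by_cases h1 : m = 0 <;> by_cases h2 : n = 0 <;> simp [h1, h2]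

/-! ### Asymptotics of the potential integral -/

namespace IsSymbolTower

variable {Ψ : ℕ → ℝ → ℂ → ℂ} {c : ℂ} {ρ : ℝ}

/-- Away from the origin of the frequency plane, the reciprocal symbol at `t = 1` is its leading
term plus its first Taylor remainder. -/
lemma inv_eq_leading_add (h : IsSymbolTower Ψ c ρ) {ξ : ℂ} (hξ : ξ ≠ 0) (hξρ : ‖ξ‖ ≤ ρ) :
    (Ψ 0 1 ξ)⁻¹ = c⁻¹ * homMonomial (-1) (-1) ξ + recipRem Ψ 1 1 ξ := by
  have h0 := h.recipRem_succ 0 hξ (h.ne_zero 1 ξ (by norm_num) hξρ hξ)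
  have e : ∀ t, recipRem Ψ 0 t ξ = (Ψ 0 t ξ)⁻¹ := fun t => by simp [recipRem]
  rw [← recipRem_zero_right, e, e, Complex.ofReal_one, one_mul, zero_add, h.leading] at h0
  rw [h0]
  simp [homMonomial, mul_comm]

/-- The transform of the cut-off first remainder has an expansion into angular terms, with the
decay of the error increasing with the number of terms. -/
lemma exists_angular_expansion (h : IsSymbolTower Ψ c ρ) {χ : ℂ → ℂ}
    (hχ : IsCutoff χ) (hρ : ∀ ξ ∈ tsupport χ, ‖ξ‖ ≤ ρ) (a : ℂ) :
    ∃ T : ℕ → ℕ →₀ ℂ, (∀ m l, 1 ≤ m → l < m → T m l = 0) ∧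
      ∀ (K : ℕ) (r : ℝ), 0 < r → ∃ C, ∀ z, r ≤ ‖z‖ → ‖z‖ ^ K *
        |(a * planeFT (fun ξ => χ ξ * recipRem Ψ 1 1 ξ) z -
          ∑ m ∈ Finset.Icc 1 K, (T m).sum fun l b => b * (z ^ l / (‖z‖ : ℂ) ^ (l + m))).re| ≤ C := by
  set F : ℕ → ℂ → ℂ := fun m θ => recipCoeff (fun j => Ψ j 0 θ) m with hF
  have hterm : ∀ m : ℕ, 1 ≤ m → Integrable (fun ξ => χ ξ * (a * F m ξ)) ∧
      HasAngularExpansion m (planeFT fun ξ => χ ξ * (a * F m ξ)) := fun m hm =>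
    ((h.isHomSum_recipCoeff m).const_mul a).hasAngularExpansion hχ hm rfl
  have hex : ∀ m : ℕ, ∃ T : ℕ →₀ ℂ, 1 ≤ m → ((∀ l < m, T l = 0) ∧
      RapidDecay fun z => (((planeFT (fun ξ => χ ξ * (a * F m ξ)) z -
        T.sum fun l b => b * (z ^ l / (‖z‖ : ℂ) ^ (l + m))).re : ℝ) : ℂ)) := fun m => by
    by_cases hm : 1 ≤ m
    · obtain ⟨T, hT⟩ := (hterm m hm).2
      exact ⟨T, fun _ => hT⟩
    · exact ⟨0, fun h => absurd h hm⟩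
  choose T hT using hex
  refine ⟨T, fun m l hm hl => (hT m hm).1 l hl, fun K r hr => ?_⟩
  -- peel off the Taylor coefficients one at a time
  have hsplit : ∀ (K : ℕ) (z : ℂ), a * planeFT (fun ξ => χ ξ * recipRem Ψ 1 1 ξ) z =
      ∑ m ∈ Finset.Icc 1 K, planeFT (fun ξ => χ ξ * (a * F m ξ)) z +
        a * planeFT (fun ξ => χ ξ * recipRem Ψ (K + 1) 1 ξ) z := by
    intro K z
    induction K with
    | zero => simp
    | succ K ih =>
      have hsum : planeFT (fun ξ => χ ξ * recipRem Ψ (K + 1) 1 ξ * a) z =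
          planeFT (fun ξ => χ ξ * (a * F (K + 1) ξ) + a * (χ ξ * recipRem Ψ (K + 2) 1 ξ)) z := by
        refine integral_congr_ae ?_
        filter_upwards [compl_mem_ae_iff.2 (measure_singleton (0 : ℂ))] with ξ hξ
        by_cases ht : ξ ∈ tsupport χ
        · have := h.recipRem_succ (K + 1) hξ (h.ne_zero 1 ξ (by norm_num) (hρ ξ ht) hξ)
          simp only [this, hF, Complex.ofReal_one]; ring
        · simp [image_eq_zero_of_notMem_tsupport ht]
      rw [planeFT_add (hterm (K + 1) (by omega)).1
        ((h.integrable_cutoff_mul_recipRem hχ hρ (by omega)).const_mul a),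
        planeFT_const_mul] at hsum
      have hc : planeFT (fun ξ => χ ξ * recipRem Ψ (K + 1) 1 ξ * a) z =
          a * planeFT (fun ξ => χ ξ * recipRem Ψ (K + 1) 1 ξ) z := by
        rw [← planeFT_const_mul]; congr 1; ext ξ; ring
      rw [ih, ← hc, hsum, Finset.sum_Icc_succ_top (by omega), add_assoc]
  have hb : ∀ m ∈ Finset.Icc 1 K, ∃ C, ∀ z : ℂ, r ≤ ‖z‖ → ‖z‖ ^ K *
      |(planeFT (fun ξ => χ ξ * (a * F m ξ)) z -
        (T m).sum fun l b => b * (z ^ l / (‖z‖ : ℂ) ^ (l + m))).re| ≤ C := fun m hm => by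
    obtain ⟨C, hC⟩ := (hT m (Finset.mem_Icc.1 hm).1).2 K r hr
    refine ⟨C, fun z hz => ?_⟩
    simpa only [Complex.norm_real, Real.norm_eq_abs] using hC z hz
  choose! D hD using hb
  obtain ⟨E, hE⟩ := h.exists_pow_mul_norm_planeFT_recipRem_le hχ hρ K
  refine ⟨∑ m ∈ Finset.Icc 1 K, D m + ‖a‖ * E, fun z hz => ?_⟩
  have hz0 : z ≠ 0 := norm_pos_iff.1 (hr.trans_le hz)
  rw [hsplit K z, add_sub_right_comm, ← Finset.sum_sub_distrib, Complex.add_re, Complex.re_sum]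
  calc _ ≤ ‖z‖ ^ K * (∑ m ∈ Finset.Icc 1 K, |(planeFT (fun ξ => χ ξ * (a * F m ξ)) z -
        (T m).sum fun l b => b * (z ^ l / (‖z‖ : ℂ) ^ (l + m))).re| +
        ‖a * planeFT (fun ξ => χ ξ * recipRem Ψ (K + 1) 1 ξ) z‖) := by
        gcongr
        exact (abs_add_le _ _).trans
          (add_le_add (Finset.abs_sum_le_sum_abs _ _) (Complex.abs_re_le_norm _))
    _ ≤ _ := by
        rw [mul_add, Finset.mul_sum, norm_mul, mul_left_comm]
        exact add_le_add (Finset.sum_le_sum fun m hm => hD m hm z hz)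
          (mul_le_mul_of_nonneg_left (hE z hz0) (norm_nonneg a))

end IsSymbolTower

/-- The potential `∫ w (1 - exp (-2πi ⟨ξ, z⟩)) / (1 - φ)` of an isotropic centred finitely
supported distribution with characteristic function `φ`, localised by a weight `w` that isolates
the zero of `1 - φ` at the origin: the integral exists, and its real part is a logarithm plus a
constant plus a series of angular terms. -/
lemma exists_potential_expansion {S : Finset ℂ} {p : ℂ → ℝ} (h1 : ∑ x ∈ S, p x = 1)
    (hm : ∑ x ∈ S, (p x : ℂ) * x = 0) {V : ℝ} (hV : V ≠ 0)
    (hcov : ∀ θ : ℂ, ∑ x ∈ S, p x * (inner ℝ θ x) ^ 2 = V * ‖θ‖ ^ 2)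
    {w : ℂ → ℂ} {w₀ : ℂ} (hw : ContDiff ℝ ∞ w) (hwc : HasCompactSupport w) (hw₀ : w₀ ≠ 0)
    (hnear : ∀ᶠ ξ in 𝓝 0, w ξ = w₀)
    (hne : ∀ ξ ∈ tsupport w, ξ ≠ 0 → charSum S p ξ ≠ 1) :
    (∀ z, Integrable fun ξ => w ξ * (1 - planeChar (-z) ξ) / (1 - charSum S p ξ)) ∧
    ∃ (α lam : ℝ) (T : ℕ → ℕ →₀ ℂ), (∀ m l, 1 ≤ m → l < m → T m l = 0) ∧
      ∀ (K : ℕ) (r : ℝ), 0 < r → ∃ C, ∀ z, r ≤ ‖z‖ → ‖z‖ ^ K *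
        |(∫ ξ, w ξ * (1 - planeChar (-z) ξ) / (1 - charSum S p ξ)).re -
          (α * Real.log ‖z‖ + lam + (∑ m ∈ Finset.Icc 1 K,
            (T m).sum fun l b => b * (z ^ l / (‖z‖ : ℂ) ^ (l + m))).re)| ≤ C := by
  obtain ⟨r₀, hr₀, hball⟩ := Metric.eventually_nhds_iff_ball.1 hnear
  set ρ := r₀ / 4 with hρdef
  have hρ0 : 0 < ρ := by positivity
  have hin : ∀ ξ : ℂ, ‖ξ‖ ≤ 2 * ρ → w ξ = w₀ := fun ξ hξ =>
    hball ξ (by rw [mem_ball_zero_iff]; linarith)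
  have hne' : ∀ ξ, ξ ≠ 0 → ‖ξ‖ ≤ 2 * ρ → charSum S p ξ ≠ 1 := fun ξ hξ hξρ =>
    hne ξ (subset_tsupport _ (by rw [Function.mem_support, hin ξ hξρ]; exact hw₀)) hξ
  have hΨ := isSymbolTower_symbolTower h1 hm hV hcov hρ0 hne'
  set c : ℂ := -(V * expQuot 2 0) with hc
  set R := recipRem (symbolTower S p) 1 1 with hR
  set φ := charSum S p with hφ
  -- a cutoff supported where `w` is constant and `1 - φ` has no zero but the origin
  let β : ContDiffBump (0 : ℂ) := ⟨ρ / 2, ρ, by positivity, by linarith⟩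
  set χ : ℂ → ℂ := fun ξ => (β ξ : ℂ) with hχdef
  have hsuppβ : ∀ ξ, ρ ≤ ‖ξ‖ → χ ξ = 0 := fun ξ hξ => by
    simp [hχdef, β.zero_of_le_dist (x := ξ) (by simpa using hξ)]
  have hχsupp : ∀ ξ ∈ tsupport χ, ‖ξ‖ ≤ ρ := by
    have : tsupport χ ⊆ Metric.closedBall 0 ρ := by
      refine closure_minimal (fun ξ hξ => ?_) Metric.isClosed_closedBall
      rw [mem_closedBall_zero_iff]
      by_contra hcon
      exact hξ (hsuppβ ξ (not_le.1 hcon).le)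
    exact fun ξ hξ => by simpa using this hξ
  have hχ : IsCutoff χ := by
    refine ⟨Complex.ofRealCLM.contDiff.comp β.contDiff, ?_, ?_⟩
    · exact HasCompactSupport.intro (isCompact_closedBall (0 : ℂ) ρ) fun ξ hξ =>
        hsuppβ ξ (by rw [mem_closedBall_zero_iff, not_le] at hξ; exact hξ.le)
    · filter_upwards [β.eventuallyEq_one] with ξ hξ
      simp [hχdef, hξ]
  -- the part of the integrand away from its singularity
  set out : ℂ → ℂ := fun ξ => (w ξ - w₀ * χ ξ) / (1 - φ ξ) with hout
  have hφd : ContDiff ℝ ∞ φ := contDiff_charSum S p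
  have houtc : HasCompactSupport out := by
    simp only [hout, div_eq_mul_inv]
    exact (hwc.sub (hχ.compact.mul_left (f := fun _ => w₀))).mul_right
  have houtd : ContDiff ℝ ∞ out := by
    rw [contDiff_iff_contDiffAt]
    intro ξ
    have hz : (∀ᶠ y in 𝓝 ξ, out y = 0) → ContDiffAt ℝ ∞ out ξ := fun he =>
      (contDiffAt_const (c := (0 : ℂ))).congr_of_eventuallyEq he
    by_cases hξ : ξ = 0
    · subst hξ
      refine hz ?_
      filter_upwards [hnear, hχ.one_near] with y h1 h2
      simp [hout, h1, h2]
    have hsm : φ ξ ≠ 1 → ContDiffAt ℝ ∞ out ξ := fun hφ1 => by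
      simp only [hout, div_eq_mul_inv]
      exact (hw.contDiffAt.sub (contDiffAt_const.mul hχ.contDiff.contDiffAt)).mul
        ((contDiffAt_const.sub hφd.contDiffAt).inv (sub_ne_zero.2 hφ1.symm))
    by_cases hwt : ξ ∈ tsupport w
    · exact hsm (hne ξ hwt hξ)
    by_cases hξt : ξ ∈ tsupport χ
    · exact hsm (hne' ξ hξ ((hχsupp ξ hξt).trans (by linarith)))
    refine hz ?_
    filter_upwards [notMem_tsupport_iff_eventuallyEq.1 hwt,
      notMem_tsupport_iff_eventuallyEq.1 hξt] with y h1 h2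
    simp [hout, h1, h2]
  have houti : Integrable out := houtd.continuous.integrable_of_hasCompactSupport houtc
  have hRi : Integrable fun ξ => χ ξ * R ξ :=
    hΨ.integrable_cutoff_mul_recipRem hχ hχsupp le_rfl
  -- split the singular part into the leading term, which gives the logarithm, and the remainder
  have hdec : ∀ z, (fun ξ => w ξ * (1 - planeChar (-z) ξ) / (1 - φ ξ)) =ᵐ[volume] fun ξ =>
      (out ξ - planeChar (-z) ξ * out ξ) +
      ((w₀ * c⁻¹) * (χ ξ * homMonomial (-1) (-1) ξ * (1 - planeChar (-z) ξ)) +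
      w₀ * (χ ξ * R ξ - planeChar (-z) ξ * (χ ξ * R ξ))) := by
    intro z
    filter_upwards [compl_mem_ae_iff.2 (measure_singleton (0 : ℂ))] with ξ hξ
    by_cases hξt : ξ ∈ tsupport χ
    · have hinv := hΨ.inv_eq_leading_add hξ (hχsupp ξ hξt)
      have hsymb := one_sub_charSum h1 hm 1 ξ
      simp only [Complex.ofReal_one, one_mul, one_pow] at hsymb
      rw [← hsymb] at hinv
      simp only [hout, div_eq_mul_inv]
      linear_combination (w₀ * χ ξ * (1 - planeChar (-z) ξ)) * hinv
    · simp only [hout, image_eq_zero_of_notMem_tsupport hξt]; ring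
  have hint : ∀ z, Integrable fun ξ => (out ξ - planeChar (-z) ξ * out ξ) := fun z =>
    houti.sub (integrable_planeChar_mul houti _)
  have hint' : ∀ z, Integrable fun ξ => (w₀ * c⁻¹) *
      (χ ξ * homMonomial (-1) (-1) ξ * (1 - planeChar (-z) ξ)) := fun z =>
    (hχ.integrable_log z).const_mul _
  have hint'' : ∀ z, Integrable fun ξ =>
      w₀ * (χ ξ * R ξ - planeChar (-z) ξ * (χ ξ * R ξ)) := fun z =>
    (hRi.sub (integrable_planeChar_mul hRi _)).const_mul _
  refine ⟨fun z => ((hint z).add ((hint' z).add (hint'' z))).congr (hdec z).symm, ?_⟩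
  have hA : ∀ z, ∫ ξ, w ξ * (1 - planeChar (-z) ξ) / (1 - φ ξ) =
      (∫ ξ, out ξ) - planeFT out z + (w₀ * c⁻¹ * logPotential χ z +
        w₀ * ((∫ ξ, χ ξ * R ξ) - planeFT (fun ξ => χ ξ * R ξ) z)) := by
    intro z
    have hsum : Integrable fun ξ => (w₀ * c⁻¹) *
        (χ ξ * homMonomial (-1) (-1) ξ * (1 - planeChar (-z) ξ)) +
        w₀ * (χ ξ * R ξ - planeChar (-z) ξ * (χ ξ * R ξ)) := (hint' z).add (hint'' z)
    rw [integral_congr_ae (hdec z), integral_add (hint z) hsum,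
      integral_add (hint' z) (hint'' z), integral_const_mul, integral_const_mul,
      integral_sub houti (integrable_planeChar_mul houti _),
      integral_sub hRi (integrable_planeChar_mul hRi _)]
    rfl
  obtain ⟨α, lam, hlog⟩ := exists_logPotential_sub hχ
  obtain ⟨T, hT0, hT⟩ := hΨ.exists_angular_expansion hχ hχsupp (-w₀)
  refine ⟨(w₀ * c⁻¹ * α).re,
    ((∫ ξ, out ξ) + w₀ * (∫ ξ, χ ξ * R ξ) + w₀ * c⁻¹ * lam).re, T, hT0, fun K r hr => ?_⟩
  obtain ⟨C, hC⟩ := hT K r hr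
  obtain ⟨D, hD⟩ := ((rapidDecay_planeFT houtd houtc).const_mul (-1)).add
    (hlog.const_mul (w₀ * c⁻¹)) K r hr
  refine ⟨D + C, fun z hz => ?_⟩
  have e : (∫ ξ, w ξ * (1 - planeChar (-z) ξ) / (1 - φ ξ)).re -
      ((w₀ * c⁻¹ * α).re * Real.log ‖z‖ +
        ((∫ ξ, out ξ) + w₀ * (∫ ξ, χ ξ * R ξ) + w₀ * c⁻¹ * lam).re +
        (∑ m ∈ Finset.Icc 1 K, (T m).sum fun l b => b * (z ^ l / (‖z‖ : ℂ) ^ (l + m))).re) =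
      (-1 * planeFT out z + w₀ * c⁻¹ *
        (logPotential χ z - (α * Real.log ‖z‖ + lam))).re +
      (-w₀ * planeFT (fun ξ => χ ξ * R ξ) z - ∑ m ∈ Finset.Icc 1 K,
        (T m).sum fun l b => b * (z ^ l / (‖z‖ : ℂ) ^ (l + m))).re := by
    rw [hA z, ← Complex.re_mul_ofReal, ← Complex.add_re, ← Complex.add_re, ← Complex.sub_re,
      ← Complex.add_re]
    congr 1; ring
  rw [e]
  calc _ ≤ ‖z‖ ^ K * (‖-1 * planeFT out z + w₀ * c⁻¹ *
        (logPotential χ z - (α * Real.log ‖z‖ + lam))‖ + _) := by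
        gcongr
        exact (abs_add_le _ _).trans (add_le_add_left (Complex.abs_re_le_norm _) _)
    _ ≤ D + C := by rw [mul_add]; exact add_le_add (hD z hz) (hC z hz)

end FourierAnalysis

section Walks

open scoped ComplexConjugate

/-! ### Characteristic functions of lattice walks -/

section FiniteStep

variable {Ω : Type*} [MeasurableSpace Ω] {μ : Measure Ω}

lemma integral_comp_of_ae_mem_finset [IsFiniteMeasure μ] {X : Ω → ℂ} (hX : Measurable X)
    {S : Finset ℂ} (hS : ∀ᵐ ω ∂μ, X ω ∈ S) {E : Type*} [NormedAddCommGroup E] [NormedSpace ℝ E]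
    [CompleteSpace E] (g : ℂ → E) :
    ∫ ω, g (X ω) ∂μ = ∑ x ∈ S, μ.real {ω | X ω = x} • g x := by
  classical
  have hms : ∀ x, MeasurableSet {ω | X ω = x} := fun x => hX (measurableSet_singleton x)
  have hae : (fun ω => g (X ω)) =ᵐ[μ]
      fun ω => ∑ x ∈ S, ({ω | X ω = x} : Set Ω).indicator (fun _ => g x) ω := by
    filter_upwards [hS] with ω hω
    rw [Finset.sum_eq_single (X ω)]
    · simp
    · intro x _ hx
      exact Set.indicator_of_notMem (fun h => hx h.symm) _
    · exact fun h => absurd hω h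
  rw [integral_congr_ae hae, integral_finsetSum]
  · exact Finset.sum_congr rfl fun x _ => integral_indicator_const _ (hms x)
  · exact fun x _ => (integrable_const _).indicator (hms x)

/-- A unimodular random variable of mean one is almost surely one. -/
lemma ae_planeChar_eq_one_of_integral_eq_one [IsProbabilityMeasure μ] {Y : Ω → ℂ}
    (hY : Measurable Y) {ξ : ℂ} (h : ∫ ω, planeChar (Y ω) ξ ∂μ = 1) :
    ∀ᵐ ω ∂μ, planeChar (Y ω) ξ = 1 := by
  have hm : Measurable fun ω => planeChar (Y ω) ξ :=
    (contDiff_planeChar_uncurry.continuous.comp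
      (by fun_prop : Continuous fun x : ℂ => (x, ξ))).measurable.comp hY
  have hi : Integrable (fun ω => planeChar (Y ω) ξ) μ :=
    (integrable_const (1 : ℝ)).mono' hm.aestronglyMeasurable
      (Eventually.of_forall fun ω => (norm_planeChar _ _).le)
  have hire : Integrable (fun ω => (planeChar (Y ω) ξ).re) μ := hi.re
  have hnn : ∀ ω, 0 ≤ 1 - (planeChar (Y ω) ξ).re := fun ω => by
    have := (Complex.re_le_norm (planeChar (Y ω) ξ)).trans_eq (norm_planeChar _ _)
    linarith
  have h0 : ∫ ω, (1 - (planeChar (Y ω) ξ).re) ∂μ = 0 := by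
    have hre : ∫ ω, (planeChar (Y ω) ξ).re ∂μ = 1 := by
      have := integral_re hi
      simp only [RCLike.re_to_complex] at this
      rw [this, h, Complex.one_re]
    rw [integral_sub (integrable_const _) hire, integral_const]
    simp [hre]
  rw [integral_eq_zero_iff_of_nonneg hnn ((integrable_const _).sub hire)] at h0
  filter_upwards [h0] with ω hω
  have hre : (planeChar (Y ω) ξ).re = 1 := by
    simp only [Pi.zero_apply] at hω; linarith
  have hn := Complex.sq_norm_sub_sq_re (planeChar (Y ω) ξ)
  rw [norm_planeChar, hre] at hn
  refine Complex.ext hre ?_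
  rw [Complex.one_im]
  nlinarith

end FiniteStep

lemma planeChar_eq_one_iff {z ξ : ℂ} : planeChar z ξ = 1 ↔ ∃ n : ℤ, inner ℝ ξ z = (n : ℝ) := by
  rw [planeChar, Complex.exp_eq_one_iff]
  refine exists_congr fun n => ?_
  have h2 : 2 * (Real.pi : ℂ) * Complex.I ≠ 0 := by simp [Real.pi_ne_zero]
  rw [mul_comm (n : ℂ), mul_right_inj' h2]
  exact_mod_cast Iff.rfl

/-- The frequencies at which a given nontrivial character equals one form a null set. -/
lemma ae_planeChar_ne_one {v : ℂ} (hv : v ≠ 0) : ∀ᵐ ξ : ℂ, planeChar v ξ ≠ 1 := by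
  have hnull : ∀ n : ℤ, volume {ξ : ℂ | inner ℝ ξ v = (n : ℝ)} = 0 := by
    intro n
    have hvv : inner ℝ v v ≠ (0 : ℝ) := inner_self_ne_zero.2 hv
    set ξ₀ : ℂ := ((n : ℝ) / inner ℝ v v) • v with hξ₀
    have hξ₀v : inner ℝ ξ₀ v = (n : ℝ) := by
      rw [hξ₀, real_inner_smul_left]; field_simp
    have hker : volume ((LinearMap.ker (innerSL ℝ v).toLinearMap : Submodule ℝ ℂ) : Set ℂ) = 0 := by
      refine Measure.addHaar_submodule _ _ fun htop => hvv ?_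
      have : v ∈ (LinearMap.ker (innerSL ℝ v).toLinearMap : Submodule ℝ ℂ) := by
        rw [htop]; trivial
      simpa using this
    have e : {ξ : ℂ | inner ℝ ξ v = (n : ℝ)} = (fun ξ => -ξ₀ + ξ) ⁻¹'
        ((LinearMap.ker (innerSL ℝ v).toLinearMap : Submodule ℝ ℂ) : Set ℂ) := by
      ext ξ
      simp only [Set.mem_ofPred_eq, Set.mem_preimage, SetLike.mem_coe, LinearMap.mem_ker,
        ContinuousLinearMap.coe_coe, innerSL_apply_apply, inner_add_right, inner_neg_right,
        real_inner_comm v]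
      rw [real_inner_comm ξ₀ v, hξ₀v]
      constructor <;> intro h <;> linarith
    rw [e, measure_preimage_add, hker]
  have hU : volume (⋃ n : ℤ, {ξ : ℂ | inner ℝ ξ v = (n : ℝ)}) = 0 :=
    measure_iUnion_null hnull
  filter_upwards [compl_mem_ae_iff.2 hU] with ξ hξ h1
  obtain ⟨n, hn⟩ := planeChar_eq_one_iff.1 h1
  exact hξ (Set.mem_iUnion.2 ⟨n, hn⟩)

lemma norm_charSum_le {S : Finset ℂ} {p : ℂ → ℝ} (hp : ∀ x ∈ S, 0 ≤ p x)
    (h1 : ∑ x ∈ S, p x = 1) (ξ : ℂ) : ‖charSum S p ξ‖ ≤ 1 := by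
  rw [← h1]
  refine (norm_sum_le _ _).trans (Finset.sum_le_sum fun x hx => ?_)
  rw [norm_mul, norm_planeChar, mul_one, Complex.norm_real, Real.norm_of_nonneg (hp x hx)]

/-- If the characteristic function has modulus one at `ξ`, then the characters of all atoms agree
at `ξ`. -/
lemma planeChar_eq_charSum {S : Finset ℂ} {p : ℂ → ℝ} (hp : ∀ x ∈ S, 0 ≤ p x)
    (h1 : ∑ x ∈ S, p x = 1) {ξ : ℂ} (hξ : ‖charSum S p ξ‖ = 1) {x : ℂ} (hx : x ∈ S)
    (hpx : p x ≠ 0) : planeChar x ξ = charSum S p ξ := by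
  set u := charSum S p ξ with hu
  have huu : conj u * u = 1 := by rw [mul_comm, Complex.mul_conj', hξ]; simp
  have hle : ∀ y, (conj u * planeChar y ξ).re ≤ 1 := fun y => by
    refine (Complex.re_le_norm _).trans_eq ?_
    rw [norm_mul, RCLike.norm_conj, hξ, norm_planeChar, one_mul]
  -- the nonnegative quantities `1 - Re (conj u * planeChar y ξ)` have mean zero
  have hsum : ∑ y ∈ S, p y * (1 - (conj u * planeChar y ξ).re) = 0 := by
    have : ∑ y ∈ S, p y * (conj u * planeChar y ξ).re = 1 := by
      have h2 : (conj u * u).re = ∑ y ∈ S, p y * (conj u * planeChar y ξ).re := by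
        conv_lhs => rw [hu]
        rw [charSum, Finset.mul_sum, Complex.re_sum]
        refine Finset.sum_congr rfl fun y _ => ?_
        rw [mul_left_comm, Complex.re_ofReal_mul]; rfl
      rw [← h2, huu, Complex.one_re]
    simp only [mul_sub, mul_one, Finset.sum_sub_distrib, h1, this, sub_self]
  have hx0 := (Finset.sum_eq_zero_iff_of_nonneg fun y hy =>
    mul_nonneg (hp y hy) (sub_nonneg.2 (hle y))).1 hsum x hx
  have hre : (conj u * planeChar x ξ).re = 1 := by
    have := (mul_eq_zero.1 hx0).resolve_left hpx
    linarith
  have hone : conj u * planeChar x ξ = 1 := by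
    have hn := Complex.sq_norm_sub_sq_re (conj u * planeChar x ξ)
    rw [norm_mul, RCLike.norm_conj, hξ, norm_planeChar, hre] at hn
    refine Complex.ext hre ?_
    rw [Complex.one_im]; nlinarith
  calc planeChar x ξ = (conj u * u) * planeChar x ξ := by rw [huu, one_mul]
    _ = u * (conj u * planeChar x ξ) := by ring
    _ = u := by rw [hone, mul_one]

section Walk

variable {Ω : Type*} [MeasurableSpace Ω] {μ : Measure Ω} {L : Submodule ℤ ℂ} {R : ℕ → Ω → L}

lemma IsLatticeWalk.measurable_coe (h : IsLatticeWalk μ L R) (n : ℕ) :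
    Measurable fun ω => (R n ω : ℂ) := measurable_subtype_coe.comp (h.measurable n)

lemma IsLatticeWalk.measurable_walkStep (h : IsLatticeWalk μ L R) : Measurable (walkStep R) := by
  have : walkStep R = fun ω => (R 1 ω : ℂ) - R 0 ω := by ext ω; simp [walkStep]
  rw [this]
  exact (h.measurable_coe 1).sub (h.measurable_coe 0)

lemma integral_planeChar_eq_charFun [IsProbabilityMeasure μ] {Y : Ω → ℂ} (hY : Measurable Y)
    (ξ : ℂ) : ∫ ω, planeChar (Y ω) ξ ∂μ = charFun (μ.map Y) ((2 * Real.pi) • ξ) := by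
  rw [charFun_apply, integral_map hY.aemeasurable (by
    refine Continuous.aestronglyMeasurable ?_
    fun_prop)]
  congr 1; ext ω
  rw [planeChar, real_inner_smul_right, real_inner_comm]
  congr 1; push_cast; ring

/-- The characteristic function of the walk at time `n` is the `n`-th power of that of its step. -/
lemma IsLatticeWalk.integral_planeChar [IsProbabilityMeasure μ] (h : IsLatticeWalk μ L R)
    (n : ℕ) (ξ : ℂ) :
    ∫ ω, planeChar (R n ω) ξ ∂μ = (∫ ω, planeChar (walkStep R ω) ξ ∂μ) ^ n := by
  set Y : ℕ → Ω → ℂ := fun i ω => ((R (i + 1) ω - R i ω : L) : ℂ) with hYdef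
  have hY : ∀ i, Measurable (Y i) := fun i => by
    have : Y i = fun ω => (R (i + 1) ω : ℂ) - R i ω := by ext ω; simp [hYdef]
    rw [this]
    exact (h.measurable_coe (i + 1)).sub (h.measurable_coe i)
  have hind : iIndepFun Y μ := h.indep.comp (fun _ (x : L) => (x : ℂ))
    fun _ => measurable_subtype_coe
  have hid : ∀ i, μ.map (Y i) = μ.map (walkStep R) := fun i =>
    ((h.identDistrib i).comp (u := fun x : L => (x : ℂ)) measurable_subtype_coe).map_eq
  have hsum : ∀ᵐ ω ∂μ, (R n ω : ℂ) = ∑ i ∈ Finset.range n, Y i ω := by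
    filter_upwards [h.start] with ω hω
    have : ∀ i, Y i ω = (R (i + 1) ω : ℂ) - R i ω := fun i => by simp [hYdef]
    simp only [this]
    rw [Finset.sum_range_sub (fun i => (R i ω : ℂ)), hω]
    simp
  have hms : Measurable fun ω => ∑ i ∈ Finset.range n, Y i ω :=
    Finset.measurable_sum _ fun i _ => hY i
  rw [integral_congr_ae (hsum.mono fun ω hω => by rw [hω]),
    integral_planeChar_eq_charFun hms, integral_planeChar_eq_charFun h.measurable_walkStep,
    iIndepFun.charFun_map_fun_finsetSum_eq_prod (fun i _ => (hY i).aemeasurable)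
      (iIndepFun.precomp (g := (Subtype.val : Finset.range n → ℕ)) Subtype.val_injective hind),
    Finset.prod_congr rfl fun i _ => by rw [hid i]]
  simp

/-- A bounded step takes finitely many values, the lattice being discrete. -/
lemma IsSpherical.exists_finset [DiscreteTopology L] (hs : IsSpherical μ R) :
    ∃ S : Finset ℂ, ∀ᵐ ω ∂μ, walkStep R ω ∈ S := by
  obtain ⟨B, hB⟩ := hs.bounded
  have hcl : IsClosed (L : Set ℂ) := by
    have : DiscreteTopology L.toAddSubgroup := ‹DiscreteTopology L›
    exact AddSubgroup.isClosed_of_discrete (H := L.toAddSubgroup)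
  have hfin : (Metric.closedBall (0 : ℂ) B ∩ (L : Set ℂ)).Finite := by
    have : DiscreteTopology (L : Set ℂ) := ‹DiscreteTopology L›
    exact Metric.finite_isBounded_inter_isClosed ⟨this⟩ Metric.isBounded_closedBall hcl
  refine ⟨hfin.toFinset, ?_⟩
  filter_upwards [hB] with ω hω
  rw [Set.Finite.mem_toFinset]
  exact ⟨by simpa using hω, Subtype.coe_prop _⟩

/-- A walk that reaches a nonzero point has a step that is not almost surely zero. -/
lemma IsLatticeWalk.not_ae_step_eq_zero [IsProbabilityMeasure μ] [DiscreteTopology L]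
    (h : IsLatticeWalk μ L R) {z : L} (hz : z ≠ 0) : ¬ ∀ᵐ ω ∂μ, walkStep R ω = 0 := by
  intro h0
  have hstep : ∀ n : ℕ, ∀ᵐ ω ∂μ, R (n + 1) ω - R n ω = 0 := by
    intro n
    have := (h.identDistrib n).symm.ae_snd (p := fun x : L => x = 0)
      (measurableSet_singleton (0 : L)) (h0.mono fun ω hω => by
        simpa [walkStep, sub_eq_zero] using hω)
    exact this
  have hR : ∀ n : ℕ, ∀ᵐ ω ∂μ, R n ω = 0 := by
    intro n
    induction n with
    | zero => exact h.start
    | succ n ih =>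
      filter_upwards [ih, hstep n] with ω h1 h2
      rw [h1, sub_zero] at h2; exact h2
  obtain ⟨n, hn⟩ := h.irreducible z
  refine hn.ne' ?_
  refine measure_mono_null (fun ω hω => ?_) (ae_iff.1 (hR n))
  intro h'
  exact hz (hω.symm.trans h')

end Walk

/-! ### The harmonic potential of a spherical walk -/

section WalkPotential

variable {Ω : Type*} [MeasurableSpace Ω] {μ : Measure Ω} {L : Submodule ℤ ℂ} {R : ℕ → Ω → L}

lemma exists_pos_le_norm_of_ne_zero (L : Submodule ℤ ℂ) [DiscreteTopology L] :
    ∃ r > 0, ∀ z : L, z ≠ 0 → r ≤ ‖(z : ℂ)‖ := by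
  obtain ⟨r, hr, hball⟩ := Metric.isOpen_singleton_iff.1 (isOpen_discrete ({0} : Set L))
  refine ⟨r, hr, fun z hz => not_lt.1 fun hlt => hz (hball z ?_)⟩
  rw [dist_zero_right]; exact hlt

/-- A planar lattice is spanned over the integers by a real basis of the plane. -/
lemma exists_basis_of_isZLattice (L : Submodule ℤ ℂ) [DiscreteTopology L] [IsZLattice ℝ L] :
    ∃ b : Module.Basis (Fin 2) ℝ ℂ, (∀ i, b i ∈ L) ∧
      ∀ x ∈ L, ∃ m n : ℤ, x = m * b 0 + n * b 1 := by
  have : Module.Free ℤ L := ZLattice.module_free ℝ L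
  have : Module.Finite ℤ L := ZLattice.module_finite ℝ L
  have hrank : Module.finrank ℤ L = 2 := by
    rw [ZLattice.rank ℝ L, Complex.finrank_real_complex]
  let b₀ : Module.Basis (Fin 2) ℤ L := Module.finBasisOfFinrankEq ℤ L hrank
  refine ⟨b₀.ofZLatticeBasis ℝ L, fun i => ?_, fun x hx => ?_⟩
  · rw [Module.Basis.ofZLatticeBasis_apply]; exact (b₀ i).2
  · refine ⟨b₀.repr ⟨x, hx⟩ 0, b₀.repr ⟨x, hx⟩ 1, ?_⟩
    have := congrArg (Subtype.val) (b₀.sum_repr ⟨x, hx⟩)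
    rw [Fin.sum_univ_two] at this
    simp only [Module.Basis.ofZLatticeBasis_apply]
    refine this.symm.trans ?_
    simp

/-- Fourier inversion on the lattice: the weight `w` has the transform of a point mass, so it
extracts the point probabilities of the walk from the powers of its characteristic function. -/
lemma IsLatticeWalk.walkProb_eq_integral [IsProbabilityMeasure μ] (h : IsLatticeWalk μ L R)
    {w : ℂ → ℂ} (hw : Integrable w)
    (hpt : ∀ x ∈ L, ∫ ξ, planeChar x ξ * w ξ = if x = 0 then 1 else 0) (n : ℕ) (z : L) :
    (walkProb μ R n z : ℂ) = ∫ ξ, w ξ * planeChar (-z) ξ *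
      (∫ ω, planeChar (walkStep R ω) ξ ∂μ) ^ n := by
  have hms : MeasurableSet {ω | R n ω = z} := h.measurable n (measurableSet_singleton z)
  have h1 : Measurable fun q : ℂ × Ω => planeChar ((R n q.2 : ℂ) - z) q.1 := by
    have h2 : Measurable fun q : ℂ × Ω => (R n q.2 : ℂ) - z :=
      ((h.measurable_coe n).comp measurable_snd).sub_const _
    have h0 : Measurable fun q : ℂ × Ω => (((R n q.2 : ℂ) - z), q.1) :=
      h2.prodMk measurable_fst
    have hc : Measurable fun p : ℂ × ℂ => planeChar p.1 p.2 :=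
      contDiff_planeChar_uncurry.continuous.measurable
    have hcomp := hc.comp h0
    exact hcomp
  have hint : Integrable (fun q : ℂ × Ω => planeChar ((R n q.2 : ℂ) - z) q.1 * w q.1)
      (volume.prod μ) :=
    (hw.comp_fst μ).bdd_mul (c := 1) h1.aestronglyMeasurable
      (Eventually.of_forall fun q => (norm_planeChar _ _).le)
  have hswap := integral_integral_swap
    (f := fun (ξ : ℂ) (ω : Ω) => planeChar ((R n ω : ℂ) - z) ξ * w ξ) hint
  have hL : ∀ ω, ∫ ξ, planeChar ((R n ω : ℂ) - z) ξ * w ξ =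
      ({ω | R n ω = z} : Set Ω).indicator (fun _ => (1 : ℂ)) ω := by
    intro ω
    rw [hpt _ (L.sub_mem (R n ω).2 z.2), Set.indicator_apply]
    refine if_congr ?_ rfl rfl
    rw [sub_eq_zero, Set.mem_ofPred_eq]
    exact Subtype.coe_inj
  simp only [hL] at hswap
  rw [integral_indicator_const _ hms, Complex.real_smul, mul_one] at hswap
  rw [walkProb, ← hswap]
  congr 1; ext ξ
  rw [← h.integral_planeChar, ← integral_const_mul]
  congr 1; ext ω
  rw [sub_eq_add_neg, planeChar_add]; ring

/-- A frequency at which the characteristic function of the step is one lies in the dual lattice: by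
irreducibility the walk carries this property from its steps to every lattice point. -/
lemma IsLatticeWalk.planeChar_eq_one [IsProbabilityMeasure μ] (h : IsLatticeWalk μ L R) {ξ : ℂ}
    (hξ : ∫ ω, planeChar (walkStep R ω) ξ ∂μ = 1) (z : L) : planeChar z ξ = 1 := by
  obtain ⟨n, hn⟩ := h.irreducible z
  have hone : ∫ ω, planeChar (R n ω) ξ ∂μ = 1 := by rw [h.integral_planeChar, hξ, one_pow]
  have hae := ae_planeChar_eq_one_of_integral_eq_one (h.measurable_coe n) hone
  by_contra hcon
  refine hn.ne' (measure_mono_null (fun ω hω => ?_) (ae_iff.1 hae))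
  rw [Set.mem_ofPred_eq] at hω
  change ¬ planeChar (R n ω) ξ = 1
  rwa [hω]

/-- The harmonic potential of a spherical walk exists and is asymptotically a logarithm plus a
constant plus a series of angular terms. -/
lemma IsLatticeWalk.exists_harmonicPotential [IsProbabilityMeasure μ] [DiscreteTopology L]
    [IsZLattice ℝ L] (h : IsLatticeWalk μ L R) (hs : IsSpherical μ R) :
    ∃ a : L → ℝ, IsHarmonicPotential μ R a ∧
    ∃ (α lam : ℝ) (T : ℕ → ℕ →₀ ℂ), (∀ m l, 1 ≤ m → l < m → T m l = 0) ∧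
      ∀ K : ℕ, ∃ C, ∀ z : L, z ≠ 0 → ‖(z : ℂ)‖ ^ K *
        |a z - (α * Real.log ‖(z : ℂ)‖ + lam + (∑ m ∈ Finset.Icc 1 K,
            (T m).sum fun l b => b * ((z : ℂ) ^ l / (‖(z : ℂ)‖ : ℂ) ^ (l + m))).re)| ≤ C := by
  obtain ⟨b, hbL, hb⟩ := exists_basis_of_isZLattice L
  obtain ⟨r, hr, hrL⟩ := exists_pos_le_norm_of_ne_zero L
  obtain ⟨S, hS⟩ := hs.exists_finset
  have hXm := h.measurable_walkStep
  set p : ℂ → ℝ := fun x => μ.real {ω | walkStep R ω = x} with hp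
  have hp0 : ∀ x ∈ S, 0 ≤ p x := fun x _ => measureReal_nonneg
  have hE : ∀ g : ℂ → ℝ, ∫ ω, g (walkStep R ω) ∂μ = ∑ x ∈ S, p x * g x := fun g =>
    integral_comp_of_ae_mem_finset hXm hS g
  have hEc : ∀ g : ℂ → ℂ, ∫ ω, g (walkStep R ω) ∂μ = ∑ x ∈ S, (p x : ℂ) * g x := fun g => by
    simpa only [Complex.real_smul] using integral_comp_of_ae_mem_finset hXm hS g
  have h1 : ∑ x ∈ S, p x = 1 := by
    have := hE fun _ => 1
    simpa using this.symm
  have hm : ∑ x ∈ S, (p x : ℂ) * x = 0 := by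
    rw [← hEc fun x => x]; exact hs.balanced
  obtain ⟨V, hV1, hV2, hV3⟩ := hs.correlation
  rw [hE fun x => x.re * x.re] at hV1
  rw [hE fun x => x.im * x.im] at hV2
  rw [hE fun x => x.re * x.im] at hV3
  have hcov : ∀ θ : ℂ, ∑ x ∈ S, p x * (inner ℝ θ x) ^ 2 = V * ‖θ‖ ^ 2 := by
    intro θ
    have e : ∀ x, p x * (inner ℝ θ x) ^ 2 = θ.re ^ 2 * (p x * (x.re * x.re)) +
        θ.im ^ 2 * (p x * (x.im * x.im)) + 2 * θ.re * θ.im * (p x * (x.re * x.im)) := fun x => by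
      rw [Complex.inner]; simp; ring
    simp only [e, Finset.sum_add_distrib, ← Finset.mul_sum, hV1, hV2, hV3]
    rw [Complex.sq_norm, Complex.normSq_apply]; ring
  -- an atom of the step at a nonzero point
  obtain ⟨x₁, hx₁S, hx₁, hpx₁⟩ : ∃ x ∈ S, x ≠ 0 ∧ p x ≠ 0 := by
    by_contra hcon
    push Not at hcon
    have hb0 : (⟨b 0, hbL 0⟩ : L) ≠ 0 := fun h0 => b.ne_zero 0 (congrArg Subtype.val h0)
    refine h.not_ae_step_eq_zero hb0 ?_
    have hall : ∀ᵐ ω ∂μ, ∀ x ∈ S, x ≠ 0 → walkStep R ω ≠ x := by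
      rw [Finset.eventually_all]
      intro x hx
      by_cases hx0 : x = 0
      · simp [hx0]
      · have : μ {ω | walkStep R ω = x} = 0 :=
          (measureReal_eq_zero_iff).1 (hcon x hx hx0)
        filter_upwards [compl_mem_ae_iff.2 this] with ω hω _ using hω
    filter_upwards [hS, hall] with ω h1 h2
    by_contra h3
    exact h2 _ h1 h3 rfl
  -- and, the mean being zero, another atom
  obtain ⟨x₂, hx₂S, hx₂, hpx₂⟩ : ∃ x ∈ S, x ≠ x₁ ∧ p x ≠ 0 := by
    by_contra hcon
    push Not at hcon
    have hs1 : ∑ x ∈ S, p x = p x₁ := Finset.sum_eq_single_of_mem _ hx₁S fun x hx hne =>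
      hcon x hx hne
    have hs2 : ∑ x ∈ S, (p x : ℂ) * x = p x₁ * x₁ :=
      Finset.sum_eq_single_of_mem _ hx₁S fun x hx hne => by rw [hcon x hx hne]; simp
    rw [hs2] at hm
    exact mul_ne_zero (by exact_mod_cast hpx₁) hx₁ hm
  have hV : V ≠ 0 := by
    intro hV0
    have hsum : ∑ x ∈ S, p x * ‖x‖ ^ 2 = 0 := by
      have e : ∀ x : ℂ, p x * ‖x‖ ^ 2 = p x * (x.re * x.re) + p x * (x.im * x.im) := fun x => by
        rw [Complex.sq_norm, Complex.normSq_apply]; ring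
      simp only [e, Finset.sum_add_distrib, hV1, hV2, hV0, add_zero]
    have := (Finset.sum_eq_zero_iff_of_nonneg fun x hx =>
      mul_nonneg (hp0 x hx) (by positivity)).1 hsum x₁ hx₁S
    exact mul_ne_zero hpx₁ (by simpa using hx₁) this
  have hφ : ∀ ξ, ∫ ω, planeChar (walkStep R ω) ξ ∂μ = charSum S p ξ := fun ξ =>
    hEc fun x => planeChar x ξ
  obtain ⟨w, w₀, hw, hwc, hw₀, hnear, hdual, hpt⟩ := exists_dual_window b
  have hwi : Integrable w := hw.continuous.integrable_of_hasCompactSupport hwc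
  have hptL : ∀ x ∈ L, ∫ ξ, planeChar x ξ * w ξ = if x = 0 then 1 else 0 := by
    intro x hx
    obtain ⟨m, n, rfl⟩ := hb x hx
    rw [hpt]
    refine if_congr ⟨?_, fun h0 => ?_⟩ rfl rfl
    · rintro ⟨rfl, rfl⟩; simp
    · have hli := Fintype.linearIndependent_iff.1 b.linearIndependent ![(m : ℝ), (n : ℝ)] (by
        simpa [Fin.sum_univ_two] using h0)
      have hm0 := hli 0
      have hn0 := hli 1
      simp at hm0 hn0
      exact ⟨hm0, hn0⟩
  have hne : ∀ ξ ∈ tsupport w, ξ ≠ 0 → charSum S p ξ ≠ 1 := by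
    intro ξ hξ hξ0 h1ξ
    refine hξ0 (hdual ξ hξ fun i => ?_)
    exact planeChar_eq_one_iff.1 (h.planeChar_eq_one ((hφ ξ).trans h1ξ) ⟨b i, hbL i⟩)
  obtain ⟨hint, α, lam, T, hT0, hT⟩ :=
    exists_potential_expansion h1 hm hV hcov hw hwc hw₀ hnear hne
  set A : ℂ → ℂ := fun z => ∫ ξ, w ξ * (1 - planeChar (-z) ξ) / (1 - charSum S p ξ) with hA
  refine ⟨fun z => (A z).re, fun z => ?_, α, lam, T, hT0, fun K => ?_⟩
  · -- the partial sums are integrals of geometric sums, dominated by the limiting integrand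
    -- almost everywhere the characters of the two atoms differ, whence `|φ| < 1`
    have hlt : ∀ᵐ ξ : ℂ, ‖charSum S p ξ‖ < 1 := by
      filter_upwards [ae_planeChar_ne_one (sub_ne_zero.2 hx₂)] with ξ hξ
      refine lt_of_le_of_ne (norm_charSum_le hp0 h1 ξ) fun h1ξ => hξ ?_
      have e1 := planeChar_eq_charSum hp0 h1 h1ξ hx₁S hpx₁
      have e2 := planeChar_eq_charSum hp0 h1 h1ξ hx₂S hpx₂
      have e3 : planeChar (x₂ - x₁) ξ * planeChar x₁ ξ = planeChar x₂ ξ := by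
        rw [← planeChar_add, sub_add_cancel]
      rw [e1, e2] at e3
      have hne0 : charSum S p ξ ≠ 0 := by
        rw [← norm_ne_zero_iff, h1ξ]; exact one_ne_zero
      exact mul_right_cancel₀ hne0 (e3.trans (one_mul _).symm)
    have hφc : Continuous (charSum S p) := (contDiff_charSum S p).continuous
    have hterm : ∀ (n : ℕ) (z : L), Integrable fun ξ =>
        w ξ * planeChar (-z) ξ * charSum S p ξ ^ n := fun n z => by
      refine Continuous.integrable_of_hasCompactSupport ?_ hwc.mul_right.mul_right
      exact (hw.continuous.mul (continuous_planeChar _)).mul (hφc.pow n)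
    have hpart : ∀ N : ℕ, ((∑ n ∈ Finset.range N, (walkProb μ R n 0 - walkProb μ R n z) : ℝ) : ℂ) =
        ∫ ξ, w ξ * (1 - planeChar (-z) ξ) / (1 - charSum S p ξ) * (1 - charSum S p ξ ^ N) := by
      intro N
      have hP := fun n (z : L) => h.walkProb_eq_integral hwi hptL n z
      simp only [hφ] at hP
      push_cast
      simp only [hP]
      have e : ∀ n : ℕ, (∫ ξ, w ξ * planeChar (-((0 : L) : ℂ)) ξ * charSum S p ξ ^ n) -
          ∫ ξ, w ξ * planeChar (-z) ξ * charSum S p ξ ^ n =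
          ∫ ξ, w ξ * (1 - planeChar (-z) ξ) * charSum S p ξ ^ n := fun n => by
        rw [← integral_sub (hterm n 0) (hterm n z)]
        congr 1; ext ξ
        rw [Submodule.coe_zero, neg_zero, planeChar_zero_left]; ring
      simp only [e]
      rw [← integral_finsetSum]
      · refine integral_congr_ae ?_
        filter_upwards [hlt] with ξ hξ
        have h1ξ : 1 - charSum S p ξ ≠ 0 := by
          intro h0
          rw [← sub_eq_zero.1 h0] at hξ
          simp at hξ
        rw [← Finset.mul_sum, ← mul_neg_geom_sum]
        field_simp
      · intro n _
        refine Continuous.integrable_of_hasCompactSupport ?_ hwc.mul_right.mul_right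
        exact (hw.continuous.mul (continuous_const.sub (continuous_planeChar _))).mul (hφc.pow n)
    have hlim : Tendsto (fun N : ℕ =>
        ((∑ n ∈ Finset.range N, (walkProb μ R n 0 - walkProb μ R n z) : ℝ) : ℂ)) atTop
        (𝓝 (A z)) := by
      simp only [hpart]
      refine tendsto_integral_of_dominated_convergence (fun ξ =>
        ‖w ξ * (1 - planeChar (-z) ξ) / (1 - charSum S p ξ)‖ * 2) (fun N => ?_)
        ((hint z).norm.mul_const 2) (fun N => ?_) ?_
      · exact (hint z).aestronglyMeasurable.mul
          (continuous_const.sub (hφc.pow N)).aestronglyMeasurable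
      · filter_upwards [hlt] with ξ hξ
        rw [norm_mul]
        gcongr
        refine (norm_sub_le _ _).trans ?_
        rw [norm_one, norm_pow]
        have := pow_le_one₀ (n := N) (norm_nonneg _) hξ.le
        linarith
      · filter_upwards [hlt] with ξ hξ
        have := (tendsto_pow_atTop_nhds_zero_of_norm_lt_one hξ).const_sub 1
        simpa using this.const_mul (w ξ * (1 - planeChar (-z) ξ) / (1 - charSum S p ξ))
    have := (Complex.continuous_re.tendsto _).comp hlim
    simpa [Function.comp_def] using this
  · obtain ⟨C, hC⟩ := hT K r hr
    exact ⟨C, fun z hz => hC z (hrL z hz)⟩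

end WalkPotential

/-! ### Separation of orders and directions -/

/-- Regrouping the terms of an expansion by their order `m = k - l`. -/
lemma sum_expansionIndex_eq {K D : ℕ} {c : ℕ → ℕ → ℂ} (hfin : (expansionIndex K c).Finite)
    (hD : ∀ m ∈ Finset.Icc 1 K, ∀ l, D ≤ l → c l (l + m) = 0) (f : ℕ → ℕ → ℂ) :
    ∑ p ∈ hfin.toFinset, c p.1 p.2 * f p.1 p.2 =
      ∑ m ∈ Finset.Icc 1 K, ∑ l ∈ Finset.range D, c l (l + m) * f l (l + m) := by
  rw [← Finset.sum_product', ← Finset.sum_image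
    (s := Finset.Icc 1 K ×ˢ Finset.range D) (g := fun q : ℕ × ℕ => (q.2, q.2 + q.1))
    (f := fun p : ℕ × ℕ => c p.1 p.2 * f p.1 p.2)]
  · refine Finset.sum_subset (fun p hp => ?_) (fun p hp hp' => ?_)
    · obtain ⟨h1, h2, h3⟩ := hfin.mem_toFinset.1 hp
      rw [Finset.mem_image]
      refine ⟨(p.2 - p.1, p.1), ?_, by ext <;> simp; omega⟩
      rw [Finset.mem_product, Finset.mem_Icc, Finset.mem_range]
      refine ⟨⟨by omega, by omega⟩, ?_⟩
      by_contra hcon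
      refine h3 ?_
      have := hD (p.2 - p.1) (Finset.mem_Icc.2 ⟨by omega, by omega⟩) p.1 (not_lt.1 hcon)
      rwa [show p.1 + (p.2 - p.1) = p.2 by omega] at this
    · rw [Finset.mem_image] at hp
      obtain ⟨q, hq, rfl⟩ := hp
      rw [Finset.mem_product, Finset.mem_Icc] at hq
      by_contra hne
      refine hp' (hfin.mem_toFinset.2 ⟨?_, ?_, left_ne_zero_of_mul hne⟩)
      · simp only; omega
      · simp only; omega
  · rintro ⟨a, b⟩ _ ⟨a', b'⟩ _ hab
    simp only [Prod.mk.injEq] at hab ⊢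
    omega

/-- The powers `1, n⁻¹, …, n⁻⁽ᴷ⁻¹⁾` are independent modulo `O(n⁻ᴷ)`. -/
lemma eq_zero_of_abs_sum_inv_pow_le {K M : ℕ} {s : ℕ → ℝ} {C : ℝ}
    (h : ∀ n : ℕ, 1 ≤ n → |∑ m ∈ Finset.range M, s m * ((n : ℝ)⁻¹) ^ m| ≤ C * ((n : ℝ)⁻¹) ^ K)
    {m : ℕ} (hmK : m < K) (hmM : m < M) : s m = 0 := by
  induction K generalizing M s m with
  | zero => omega
  | succ K ih =>
    obtain ⟨M, rfl⟩ : ∃ M', M = M' + 1 := ⟨M - 1, by omega⟩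
    have hs0 : s 0 = 0 := by
      have hcont : Continuous fun x : ℝ => ∑ m ∈ Finset.range (M + 1), s m * x ^ m := by
        fun_prop
      have hl := (hcont.tendsto 0).comp (tendsto_inv_atTop_nhds_zero_nat (𝕜 := ℝ))
      have e : ∑ m ∈ Finset.range (M + 1), s m * (0 : ℝ) ^ m = s 0 := by
        rw [Finset.sum_range_succ']; simp
      rw [e] at hl
      have hr : Tendsto (fun n : ℕ => C * ((n : ℝ)⁻¹) ^ (K + 1)) atTop (𝓝 0) := by
        have := ((tendsto_inv_atTop_nhds_zero_nat (𝕜 := ℝ)).pow (K + 1)).const_mul C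
        simpa using this
      refine tendsto_nhds_unique hl (squeeze_zero_norm' ?_ hr)
      filter_upwards [eventually_ge_atTop 1] with n hn using h n hn
    rcases Nat.eq_zero_or_pos m with rfl | hm
    · exact hs0
    have := ih (M := M) (s := fun j => s (j + 1)) (m := m - 1) (fun n hn => ?_)
      (by omega) (by omega)
    · simpa [Nat.sub_add_cancel hm] using this
    have hn0 : (0 : ℝ) < n := by exact_mod_cast hn
    have h1 := h n hn
    rw [Finset.sum_range_succ', hs0, zero_mul, add_zero] at h1
    have e : ∑ j ∈ Finset.range M, s (j + 1) * ((n : ℝ)⁻¹) ^ (j + 1) =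
        (n : ℝ)⁻¹ * ∑ j ∈ Finset.range M, s (j + 1) * ((n : ℝ)⁻¹) ^ j := by
      rw [Finset.mul_sum]
      exact Finset.sum_congr rfl fun j _ => by ring
    rw [e, abs_mul, abs_of_pos (inv_pos.2 hn0), pow_succ, ← mul_assoc, mul_comm _ (n : ℝ)⁻¹] at h1
    exact le_of_mul_le_mul_left h1 (inv_pos.2 hn0)

/-- The functions `log n, 1, n⁻¹, …, n⁻⁽ᴷ⁻¹⁾` are independent modulo `O(n⁻ᴷ)`. -/
lemma eq_zero_of_abs_log_add_sum_inv_pow_le {K M : ℕ} {a : ℝ} {s : ℕ → ℝ} {C : ℝ}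
    (h : ∀ n : ℕ, 1 ≤ n →
      |a * Real.log n + ∑ m ∈ Finset.range M, s m * ((n : ℝ)⁻¹) ^ m| ≤ C * ((n : ℝ)⁻¹) ^ K)
    {m : ℕ} (hmK : m < K) (hmM : m < M) : s m = 0 := by
  have ha : a = 0 := by
    by_contra hne
    have hlog : Tendsto (fun n : ℕ => |a| * Real.log n) atTop atTop :=
      (Real.tendsto_log_atTop.comp tendsto_natCast_atTop_atTop).const_mul_atTop
        (abs_pos.2 hne)
    obtain ⟨n, hn1, hn2⟩ := ((hlog.eventually_gt_atTop
      (|C| + ∑ m ∈ Finset.range M, |s m|)).and (eventually_ge_atTop 1)).exists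
    have hn0 : (1 : ℝ) ≤ n := by exact_mod_cast hn2
    have hi0 : (0 : ℝ) ≤ (n : ℝ)⁻¹ := by positivity
    have hi1 : (n : ℝ)⁻¹ ≤ 1 := inv_le_one_of_one_le₀ hn0
    have h1 : C * ((n : ℝ)⁻¹) ^ K ≤ |C| :=
      (mul_le_mul_of_nonneg_right (le_abs_self C) (by positivity)).trans
        (mul_le_of_le_one_right (abs_nonneg C) (pow_le_one₀ hi0 hi1))
    have h2 : |∑ m ∈ Finset.range M, s m * ((n : ℝ)⁻¹) ^ m| ≤ ∑ m ∈ Finset.range M, |s m| := by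
      refine (Finset.abs_sum_le_sum_abs _ _).trans (Finset.sum_le_sum fun m _ => ?_)
      rw [abs_mul, abs_of_nonneg (pow_nonneg hi0 m)]
      exact mul_le_of_le_one_right (abs_nonneg _) (pow_le_one₀ hi0 hi1)
    have h3 : |a| * Real.log n = |a * Real.log n| := by
      rw [abs_mul, abs_of_nonneg (Real.log_nonneg hn0)]
    have h4 := abs_sub_abs_le_abs_sub (a * Real.log n)
      (-∑ m ∈ Finset.range M, s m * ((n : ℝ)⁻¹) ^ m)
    rw [abs_neg, sub_neg_eq_add] at h4
    linarith [h n hn2]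
  refine eq_zero_of_abs_sum_inv_pow_le (fun n hn => ?_) hmK hmM (C := C)
  simpa [ha] using h n hn

/-- A trigonometric polynomial of nonnegative frequencies whose real part has infinitely many
zeros on the unit circle is an imaginary constant. -/
lemma trigPolynomial_coeff_eq_zero {D : ℕ} {d : ℕ → ℂ} {Z : Set ℂ} (hZ : Z.Infinite)
    (hunit : ∀ ζ ∈ Z, ‖ζ‖ = 1)
    (h0 : ∀ ζ ∈ Z, (∑ l ∈ Finset.range D, d l * ζ ^ l).re = 0) {l : ℕ} (hl : l < D) :
    (l = 0 → (d 0).re = 0) ∧ (l ≠ 0 → d l = 0) := by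
  classical
  -- on the unit circle `P` is `ζ ^ D` times twice the real part of the trigonometric polynomial
  set P : Polynomial ℂ := ∑ j ∈ Finset.range D,
    (Polynomial.C (d j) * Polynomial.X ^ (D + j) +
      Polynomial.C (conj (d j)) * Polynomial.X ^ (D - j)) with hP
  have hP0 : P = 0 := by
    refine Polynomial.eq_zero_of_infinite_isRoot P (hZ.mono fun ζ hζ => ?_)
    have hζζ : conj ζ * ζ = 1 := by rw [mul_comm, Complex.mul_conj', hunit ζ hζ]; simp
    have e : P.eval ζ = ζ ^ D * ((∑ l ∈ Finset.range D, d l * ζ ^ l) +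
        conj (∑ l ∈ Finset.range D, d l * ζ ^ l)) := by
      rw [hP, Polynomial.eval_finsetSum, map_sum, ← Finset.sum_add_distrib, Finset.mul_sum]
      refine Finset.sum_congr rfl fun j hj => ?_
      have hjD : j ≤ D := (Finset.mem_range.1 hj).le
      have e2 : ζ ^ D * conj ζ ^ j = ζ ^ (D - j) := by
        have hs : D = (D - j) + j := by omega
        conv_lhs => rw [hs, pow_add]
        rw [mul_assoc, ← mul_pow, mul_comm ζ, hζζ, one_pow, mul_one]
      simp only [Polynomial.eval_add, Polynomial.eval_mul, Polynomial.eval_C, Polynomial.eval_pow,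
        Polynomial.eval_X, map_mul, map_pow]
      rw [← e2, pow_add]; ring
    change P.eval ζ = 0
    rw [e, Complex.add_conj, h0 ζ hζ]; simp
  have hco : P.coeff (D + l) = 0 := by rw [hP0, Polynomial.coeff_zero]
  rw [hP, Polynomial.finsetSum_coeff] at hco
  simp only [Polynomial.coeff_add, Polynomial.coeff_C_mul, Polynomial.coeff_X_pow] at hco
  rw [Finset.sum_eq_single_of_mem l (Finset.mem_range.2 hl) (fun j hj hjl => by
    rw [if_neg (by omega), if_neg (by have := Finset.mem_range.1 hj; omega)]; simp)] at hco
  constructor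
  · rintro rfl
    simp only [add_zero, if_true, mul_one, Nat.sub_zero] at hco
    rw [Complex.add_conj] at hco
    have := congrArg Complex.re hco
    simpa using this
  · intro hl0
    rw [if_pos rfl, if_neg (by omega)] at hco
    simpa using hco

/-- A planar lattice has points in infinitely many directions. -/
lemma infinite_directions (L : Submodule ℤ ℂ) [DiscreteTopology L] [IsZLattice ℝ L] :
    {ζ : ℂ | ∃ z : L, z ≠ 0 ∧ ζ = z / ‖(z : ℂ)‖}.Infinite := by
  obtain ⟨b, hbL, -⟩ := exists_basis_of_isZLattice L
  have hind : ∀ x y : ℝ, (x : ℂ) * b 0 + y * b 1 = 0 → x = 0 ∧ y = 0 := fun x y hxy => by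
    have hli := Fintype.linearIndependent_iff.1 b.linearIndependent ![x, y] (by
      simpa [Fin.sum_univ_two] using hxy)
    exact ⟨by simpa using hli 0, by simpa using hli 1⟩
  have hv0 : ∀ n : ℕ, b 0 + n * b 1 ≠ 0 := fun n hn => by
    have := (hind 1 n (by simpa using hn)).1
    norm_num at this
  have hmem : ∀ n : ℕ, b 0 + n * b 1 ∈ L := fun n => by
    have := L.add_mem (hbL 0) (L.smul_mem (n : ℤ) (hbL 1))
    simpa using this
  refine Set.infinite_of_injective_forall_mem
    (f := fun n : ℕ => (b 0 + n * b 1) / ‖b 0 + n * b 1‖) (fun n n' hnn => ?_)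
    fun n => ⟨⟨_, hmem n⟩, fun h => hv0 n (congrArg Subtype.val h), rfl⟩
  have hr : (‖b 0 + n * b 1‖ : ℂ) ≠ 0 := by simpa using hv0 n
  have hr' : (‖b 0 + n' * b 1‖ : ℂ) ≠ 0 := by simpa using hv0 n'
  simp only at hnn
  rw [div_eq_div_iff hr hr'] at hnn
  have h2 := hind (‖b 0 + n' * b 1‖ - ‖b 0 + n * b 1‖)
    (n * ‖b 0 + n' * b 1‖ - n' * ‖b 0 + n * b 1‖) (by push_cast; linear_combination hnn)
  have h3 : ‖b 0 + n' * b 1‖ = ‖b 0 + n * b 1‖ := sub_eq_zero.1 h2.1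
  have h4 := h2.2
  rw [h3, ← sub_mul] at h4
  have h5 := (mul_eq_zero.1 h4).resolve_right (by simpa using hv0 n)
  exact_mod_cast sub_eq_zero.1 h5

section Expansion

variable {L : Submodule ℤ ℂ} {a : L → ℝ}

/-! ### Existence and uniqueness of expansions -/

/-- The coefficient array of an expansion whose terms of order `m` are the `T m l`; it is indexed by
`l` and `k = l + m`. -/
noncomputable def coeffArray (T : ℕ → ℕ →₀ ℂ) (l k : ℕ) : ℂ := if l < k then T (k - l) l else 0

lemma coeffArray_eq_zero {T : ℕ → ℕ →₀ ℂ} (hT : ∀ m l, 1 ≤ m → l < m → T m l = 0) {l k : ℕ}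
    (h : 2 * l < k) : coeffArray T l k = 0 := by
  rw [coeffArray, if_pos (by omega)]
  exact hT _ _ (by omega) (by omega)

lemma coeffArray_add {T : ℕ → ℕ →₀ ℂ} {l m : ℕ} (hm : 1 ≤ m) : coeffArray T l (l + m) = T m l := by
  rw [coeffArray, if_pos (by omega), Nat.add_sub_cancel_left]

lemma finite_expansionIndex_coeffArray (T : ℕ → ℕ →₀ ℂ) (K : ℕ) :
    (expansionIndex K (coeffArray T)).Finite := by
  refine ((Finset.Icc 1 K).biUnion fun m => (T m).support.image fun l => (l, l + m)).finite_toSet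
    |>.subset ?_
  rintro ⟨l, k⟩ ⟨h1, h2, h3⟩
  simp only at h1 h2 h3
  rw [coeffArray, if_pos (by omega)] at h3
  simp only [Finset.coe_biUnion, Set.mem_iUnion, Finset.coe_image, Set.mem_image, Finset.mem_coe]
  exact ⟨k - l, Finset.mem_Icc.2 ⟨by omega, by omega⟩, l, Finsupp.mem_support_iff.2 h3, by
    ext <;> simp; omega⟩

lemma exists_forall_coeff_eq_zero (K : ℕ) (g : ℕ → ℕ → ℂ)
    (h : ∀ m ∈ Finset.Icc 1 K, {l | g m l ≠ 0}.Finite) :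
    ∃ D, ∀ m ∈ Finset.Icc 1 K, ∀ l, D ≤ l → g m l = 0 := by
  have hb : ∀ m ∈ Finset.Icc 1 K, ∃ D, ∀ l, D ≤ l → g m l = 0 := fun m hm => by
    obtain ⟨D, hD⟩ := (h m hm).bddAbove
    refine ⟨D + 1, fun l hl => ?_⟩
    by_contra hne
    have : l ≤ D := hD hne
    omega
  choose! D hD using hb
  exact ⟨(Finset.Icc 1 K).sup D, fun m hm l hl => hD m hm l ((Finset.le_sup hm).trans hl)⟩

/-- The array `coeffArray T` does not depend on the order `K`, and it serves every order. -/
lemma isExpansion_coeffArray {α lam : ℝ} {T : ℕ → ℕ →₀ ℂ}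
    (hT : ∀ m l, 1 ≤ m → l < m → T m l = 0) {K : ℕ}
    (hb : ∃ C, ∀ z : L, z ≠ 0 → ‖(z : ℂ)‖ ^ K *
      |a z - (α * Real.log ‖(z : ℂ)‖ + lam + (∑ m ∈ Finset.Icc 1 K,
        (T m).sum fun l b => b * ((z : ℂ) ^ l / (‖(z : ℂ)‖ : ℂ) ^ (l + m))).re)| ≤ C) :
    IsExpansion a K α lam (coeffArray T) := by
  refine ⟨fun k => ?_, finite_expansionIndex_coeffArray T K, ?_⟩
  · rcases Nat.eq_zero_or_pos k with rfl | hk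
    · simp [coeffArray]
    · rw [coeffArray_eq_zero hT (by omega), Complex.zero_im]
  obtain ⟨C, hC⟩ := hb
  refine ⟨C, fun z hz => ?_⟩
  have hz0 : (z : ℂ) ≠ 0 := fun h => hz (Subtype.ext h)
  have hz' : 0 < ‖(z : ℂ)‖ := norm_pos_iff.2 hz0
  obtain ⟨D, hD⟩ := exists_forall_coeff_eq_zero K (fun m l => T m l) fun m _ =>
    (T m).support.finite_toSet.subset fun l hl => by simpa using hl
  rw [le_div_iff₀ (by positivity), mul_comm]
  refine le_trans (le_of_eq ?_) (hC z hz)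
  rw [sum_expansionIndex_eq (D := D) _ (fun m hm l hl => by
    rw [coeffArray_add (Finset.mem_Icc.1 hm).1]; exact hD m hm l hl)
    (fun l k => (z : ℂ) ^ l / (‖(z : ℂ)‖ : ℂ) ^ k)]
  congr 5
  refine Finset.sum_congr rfl fun m hm => ?_
  rw [Finsupp.sum_of_support_subset (T m) (s := Finset.range D) _ _ (by simp)]
  · exact Finset.sum_congr rfl fun l _ => by rw [coeffArray_add (Finset.mem_Icc.1 hm).1]
  · intro l hl
    rw [Finset.mem_range]
    by_contra hcon
    exact Finsupp.mem_support_iff.1 hl (hD m hm l (not_lt.1 hcon))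

/-- Two expansions of the same order have the same coefficients, except in the top order: along
each ray of lattice points the orders separate, and a trigonometric polynomial is determined by
its values in infinitely many directions. -/
lemma IsExpansion.coeff_eq [DiscreteTopology L] [IsZLattice ℝ L] {K : ℕ} {α α' lam lam' : ℝ}
    {c c' : ℕ → ℕ → ℂ} (h : IsExpansion a K α lam c) (h' : IsExpansion a K α' lam' c') {l k : ℕ}
    (hlk : l < k) (hkK : k < l + K) : c l k = c' l k := by
  have hfin : ∀ {c : ℕ → ℕ → ℂ}, (expansionIndex K c).Finite → ∀ m ∈ Finset.Icc 1 K,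
      {l | c l (l + m) ≠ 0}.Finite := fun {c} hc m hm => by
    refine (hc.image Prod.fst).subset fun l hl => ⟨(l, l + m), ⟨?_, ?_, hl⟩, rfl⟩
    · have := (Finset.mem_Icc.1 hm).1; simp only; omega
    · have := (Finset.mem_Icc.1 hm).2; simp only; omega
  obtain ⟨D₁, hD₁⟩ := exists_forall_coeff_eq_zero K (fun m l => c l (l + m)) (hfin h.finite)
  obtain ⟨D₂, hD₂⟩ := exists_forall_coeff_eq_zero K (fun m l => c' l (l + m)) (hfin h'.finite)
  set D := max (max D₁ D₂) (l + 1) with hDdef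
  have hDc : ∀ m ∈ Finset.Icc 1 K, ∀ l, D ≤ l → c l (l + m) = 0 := fun m hm l hl =>
    hD₁ m hm l (by omega)
  have hDc' : ∀ m ∈ Finset.Icc 1 K, ∀ l, D ≤ l → c' l (l + m) = 0 := fun m hm l hl =>
    hD₂ m hm l (by omega)
  set d : ℕ → ℕ → ℂ := fun m l => c l (l + m) - c' l (l + m) with hd
  obtain ⟨C₁, hC₁⟩ := h.bound
  obtain ⟨C₂, hC₂⟩ := h'.bound
  have hdiff : ∀ z : L, z ≠ 0 → |(α - α') * Real.log ‖(z : ℂ)‖ + (lam - lam') +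
      ∑ m ∈ Finset.Icc 1 K, (∑ l ∈ Finset.range D,
        d m l * ((z : ℂ) ^ l / (‖(z : ℂ)‖ : ℂ) ^ (l + m))).re| ≤ (C₁ + C₂) / ‖(z : ℂ)‖ ^ K := by
    intro z hz
    have b₁ := hC₁ z hz
    have b₂ := hC₂ z hz
    rw [sum_expansionIndex_eq h.finite hDc
      (fun l k => (z : ℂ) ^ l / (‖(z : ℂ)‖ : ℂ) ^ k)] at b₁
    rw [sum_expansionIndex_eq h'.finite hDc'
      (fun l k => (z : ℂ) ^ l / (‖(z : ℂ)‖ : ℂ) ^ k)] at b₂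
    rw [add_div]
    refine le_trans (le_of_eq ?_) ((abs_sub _ _).trans (add_le_add b₂ b₁) |>.trans_eq
      (add_comm _ _))
    congr 1
    simp only [hd, sub_mul, Finset.sum_sub_distrib, Complex.sub_re, Complex.re_sum]
    ring
  set m₀ := k - l with hm₀
  have hm₀1 : 1 ≤ m₀ := by omega
  -- on each ray the term of order `m₀` vanishes
  have hray : ∀ z : L, z ≠ 0 →
      (∑ l ∈ Finset.range D, d m₀ l * ((z : ℂ) ^ l / (‖(z : ℂ)‖ : ℂ) ^ (l + m₀))).re = 0 := by
    intro z hz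
    have hz0 : (z : ℂ) ≠ 0 := fun h => hz (Subtype.ext h)
    have hz' : 0 < ‖(z : ℂ)‖ := norm_pos_iff.2 hz0
    -- the coefficients of `n ^ (-m)` along the ray of the points `n • z`
    set s : ℕ → ℝ := fun m => if m = 0 then (α - α') * Real.log ‖(z : ℂ)‖ + (lam - lam') else
      (∑ l ∈ Finset.range D, d m l * ((z : ℂ) ^ l / (‖(z : ℂ)‖ : ℂ) ^ (l + m))).re with hs
    have hs0 : s m₀ = 0 := by
      refine eq_zero_of_abs_log_add_sum_inv_pow_le (K := K) (M := K + 1) (a := α - α')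
        (C := (C₁ + C₂) / ‖(z : ℂ)‖ ^ K) (fun n hn => ?_) (by omega) (by omega)
      have hn0 : (0 : ℝ) < n := by exact_mod_cast hn
      have hnc : (n : ℂ) ≠ 0 := by exact_mod_cast hn0.ne'
      have hnz : (n • z : L) ≠ 0 := by
        intro h0
        have := congrArg Subtype.val h0
        simp only [Submodule.coe_smul_of_tower, nsmul_eq_mul, Submodule.coe_zero] at this
        exact mul_ne_zero hnc hz0 this
      have hb := hdiff (n • z) hnz
      have hcoe : ((n • z : L) : ℂ) = n * (z : ℂ) := by simp
      have hnorm : ‖(n : ℂ) * (z : ℂ)‖ = n * ‖(z : ℂ)‖ := by simp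
      rw [hcoe, hnorm, Real.log_mul hn0.ne' hz'.ne', mul_pow] at hb
      refine le_trans (le_of_eq ?_) (hb.trans_eq ?_)
      · congr 1
        rw [Finset.range_eq_Ico, Finset.sum_eq_sum_Ico_succ_bot (by omega)]
        have e : ∑ m ∈ Finset.Ico (0 + 1) (K + 1), s m * ((n : ℝ)⁻¹) ^ m =
            ∑ m ∈ Finset.Icc 1 K, (∑ l ∈ Finset.range D,
              d m l * (((n : ℂ) * z) ^ l / ((n * ‖(z : ℂ)‖ : ℝ) : ℂ) ^ (l + m))).re := by
          rw [zero_add, Finset.Ico_add_one_right_eq_Icc]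
          refine Finset.sum_congr rfl fun m hm => ?_
          have hm1 := (Finset.mem_Icc.1 hm).1
          simp only [hs]
          rw [if_neg (by omega), mul_comm, ← Complex.re_ofReal_mul, Finset.mul_sum]
          congr 1
          refine Finset.sum_congr rfl fun l _ => ?_
          have hzc : (‖(z : ℂ)‖ : ℂ) ≠ 0 := by simpa using hz0
          push_cast
          rw [mul_pow, mul_pow, pow_add (n : ℂ), inv_pow]
          field_simp
        rw [e]
        simp only [hs, if_true, pow_zero, mul_one]
        ring
      · rw [inv_pow]; field_simp
    simpa [hs, show m₀ ≠ 0 by omega] using hs0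
  have htrig := trigPolynomial_coeff_eq_zero (D := D) (d := d m₀) (infinite_directions L)
    (by
      rintro ζ ⟨z, hz, rfl⟩
      have hz0 : (z : ℂ) ≠ 0 := fun h => hz (Subtype.ext h)
      have : ‖(z : ℂ)‖ ≠ 0 := by simpa using hz0
      simp [this])
    (by
      rintro ζ ⟨z, hz, rfl⟩
      have hz0 : (z : ℂ) ≠ 0 := fun h => hz (Subtype.ext h)
      have hzc : (‖(z : ℂ)‖ : ℂ) ≠ 0 := by simpa using hz0
      have e : ∑ l ∈ Finset.range D, d m₀ l * ((z : ℂ) / ‖(z : ℂ)‖) ^ l =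
          ((‖(z : ℂ)‖ ^ m₀ : ℝ) : ℂ) * ∑ l ∈ Finset.range D,
            d m₀ l * ((z : ℂ) ^ l / (‖(z : ℂ)‖ : ℂ) ^ (l + m₀)) := by
        rw [Finset.mul_sum]
        refine Finset.sum_congr rfl fun l _ => ?_
        push_cast
        rw [div_pow, pow_add]; field_simp
      rw [e, Complex.re_ofReal_mul, hray z hz, mul_zero])
    (l := l) (by omega)
  have hdl : d m₀ l = c l k - c' l k := by
    simp only [hd, hm₀]
    rw [show l + (k - l) = k by omega]
  rcases Nat.eq_zero_or_pos l with rfl | hl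
  · have hre := htrig.1 rfl
    rw [hdl, Complex.sub_re] at hre
    exact Complex.ext (sub_eq_zero.1 hre) (by rw [h.real_zero, h'.real_zero])
  · have := htrig.2 hl.ne'
    rw [hdl] at this
    exact sub_eq_zero.1 this

end Expansion

end Walks

theorem mainTheorem2 {Ω : Type*} [MeasurableSpace Ω] (μ : Measure Ω) [IsProbabilityMeasure μ]
    (L : Submodule ℤ ℂ) [DiscreteTopology L] [IsZLattice ℝ L]
    (R : ℕ → Ω → L) (hwalk : IsLatticeWalk μ L R) (hsph : IsSpherical μ R) :
    ∃ a : L → ℝ, IsHarmonicPotential μ R a ∧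
      (∃ (α lam : ℝ) (c : ℕ → ℕ → ℂ),
        (∀ K : ℕ, 0 < K → IsExpansion a K α lam c) ∧
        (∀ l k : ℕ, 2 * l < k → c l k = 0)) ∧
      (∀ (K : ℕ) (α lam : ℝ) (c : ℕ → ℕ → ℂ), 0 < K → IsExpansion a K α lam c →
        ∀ l k : ℕ, k < l + K → 2 * l < k → c l k = 0) := by
  obtain ⟨a, ha, α, lam, T, hT, hb⟩ := hwalk.exists_harmonicPotential hsph
  have hexp : ∀ K, IsExpansion a K α lam (coeffArray T) := fun K => isExpansion_coeffArray hT (hb K)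
  refine ⟨a, ha, ⟨α, lam, coeffArray T, fun K _ => hexp K, fun l k h => coeffArray_eq_zero hT h⟩,
    fun K α' lam' c _ hc l k hkK hlk => ?_⟩
  rw [hc.coeff_eq (hexp K) (by omega) hkK, coeffArray_eq_zero hT hlk]
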